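/- Let $k\ge 1$ and let $X_1,\dots,X_k$ be subshifts over finite alphabets $\mathcal A_1,\dots,\mathcal A_k$, either all one-sided (closed $X_i\subseteq \mathcal A_i^{\mathbb N}$, $\mathbb N=\{1,2,\dots\}$, with $\sigma X_i\subseteq X_i$) or all two-sided (closed $X_i\subseteq\mathcal A_i^{\mathbb Z}$ with $\sigma X_i=X_i$), where $(\sigma x)_j=x_{j+1}$; write $\sigma_{X_i}$ for the restriction of $\sigma$ to $X_i$, and assume $X_1\neq\emptyset$. Let $\pi_i:X_i\to X_{i+1}$ ($1\le i\le k-1$) be factor maps, i.e. continuous surjections with $\pi_i\circ\sigma_{X_i}=\sigma_{X_{i+1}}\circ\pi_i$, and let $\tau_0=\mathrm{id}_{X_1}$ and $\tau_i=\pi_i\circ\cdots\circ\pi_1:X_1\to X_{i+1}$. A finite word is called legal if it occurs as a consecutive string in some point of $X_1$. We say that $X_1$ satisfies weak specification (respectively, specification) if there is an integer $p\ge 0$ such that for all legal words $I,J$ there is a word $K$ of length at most $p$ (respectively, of length exactly $p$) such that $IKJ$ is legal. Let $V(\sigma_{X_1})$ be the set of continuous $f:X_1\to\mathbb R$ for which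 there is $c>0$ such that for all $n\ge1$, $|S_nf(x)-S_nf(y)|\le c$ whenever $x,y\in X_1$ satisfy $x_j=y_j$ for $1\le j\le n$, where $S_nf=\sum_{i=0}^{n-1}f\circ\sigma_{X_1}^i$. For a $\sigma_{X_i}$-invariant Borel probability measure $\nu$ on $X_i$, let $h_\nu(\sigma_{X_i})=-\lim_{n\to\infty}\frac1n\sum_{I}\nu([I])\log\nu([I])$ be its measure-theoretic entropy, where $I$ runs over the words of length $n$, $[I]$ is the set of points of $X_i$ that carry the word $I$ at $n$ fixed consecutive coordinates, and $0\log 0=0$. Let $\mathbf a=(a_1,\dots,a_k)\in\mathbb R^k$ with $a_1>0$ and $a_i\ge0$ for $i\ge2$. An $\mathbf a$-weighted equilibrium state of $f$ is a $\sigma_{X_1}$-invariant Borel probability measure $\mu$ on $X_1$ that maximizes $$\mu\mapsto\int f\,d\mu+\sum_{i=1}^k a_i\,h_{\mu\circ\tau_{i-1}^{-1}}(\sigma_{X_i})$$ among all $\sigma_{X_1}$-invariant Borel probability measures on $X_1$. **Theorem.** Assume that $X_1$ satisfies weak specification. Then every $f\in V(\sigma_{X_1})$ has exactly one $\mathbf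 a$-weighted equilibrium state $\mu$. The measure $\mu$ is ergodic, and there exist an integer $p\ge 0$ and $c>0$ such that $$\liminf_{n\to\infty}\sum_{i=0}^p\mu\big(A\cap\sigma_{X_1}^{-n-i}(B)\big)\ge c\,\mu(A)\mu(B)\qquad\text{for all Borel sets }A,B\subseteq X_1.$$ If, moreover, $X_1$ satisfies specification, then there exists $c>0$ such that $$\liminf_{n\to\infty}\mu\big(A\cap\sigma_{X_1}^{-n}(B)\big)\ge c\,\mu(A)\mu(B)\qquad\text{for all Borel sets }A,B\subseteq X_1.$$ -/

import Mathlib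

open MeasureTheory Filter SymbolicDynamics.FullShift
open scoped NNReal ENNReal

namespace WeightedEquilibrium

/-! Subshifts are Mathlib's `Subshift A G`: closed subsets of `G → A` that are invariant under all
translations by elements of `G`.  For `G = ℕ` this is a one-sided subshift (`σ X ⊆ X`), and for
`G = ℤ` it is a two-sided subshift (`σ X = X`).  The coordinates of a one-sided sequence are
numbered `0, 1, 2, …`. -/

/-- The left shift `σ_X`, `(σ x)_i = x_{i+1}`, as a self-map of the subshift `X`. -/
def shiftMap {A G : Type*} [TopologicalSpace A] [AddMonoidWithOne G] (X : Subshift A G) :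
    X.carrier → X.carrier :=
  fun x => ⟨shift (1 : G) x.1, X.mapsTo 1 x.2⟩

/-- The word `w` belongs to the language of `X`: it occurs as a consecutive string
`x_g x_{g+1} … x_{g+|w|-1}` in some point `x` of `X`. -/
def IsLegal {A G : Type*} [TopologicalSpace A] [AddMonoidWithOne G] (X : Subshift A G)
    (w : List A) : Prop :=
  ∃ x ∈ X.carrier, ∃ g : G, ∀ (j : ℕ) (hj : j < w.length), w[j] = x (g + (j : G))

/-- Weak specification. -/
def WeakSpecification {A G : Type*} [TopologicalSpace A] [AddMonoidWithOne G]
    (X : Subshift A G) : Prop :=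
  ∃ p : ℕ, ∀ I J : List A, IsLegal X I → IsLegal X J →
    ∃ K : List A, K.length ≤ p ∧ IsLegal X (I ++ K ++ J)

/-- Specification. -/
def Specification {A G : Type*} [TopologicalSpace A] [AddMonoidWithOne G]
    (X : Subshift A G) : Prop :=
  ∃ p : ℕ, ∀ I J : List A, IsLegal X I → IsLegal X J →
    ∃ K : List A, K.length = p ∧ IsLegal X (I ++ K ++ J)

/-- Factor maps: continuous surjections that commute with the shifts. -/
structure IsFactorMap {A B G : Type*} [TopologicalSpace A] [TopologicalSpace B]
    [AddMonoidWithOne G] (X : Subshift A G) (Y : Subshift B G)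
    (π : X.carrier → Y.carrier) : Prop where
  continuous : Continuous π
  surjective : Function.Surjective π
  semiconj : Function.Semiconj π (shiftMap X) (shiftMap Y)

/-- The compositions `τ_i = π_{i-1} ∘ ⋯ ∘ π_0 : X_0 → X_i` (with `τ_0 = id`) of the maps
`π_i : X_i → X_{i+1}` of a chain `X_0 → X_1 → ⋯ → X_m`. -/
def tower {m : ℕ} {A : Fin (m + 1) → Type*} {G : Type*} [∀ i, TopologicalSpace (A i)]
    [AddMonoidWithOne G] (X : ∀ i, Subshift (A i) G)
    (π : ∀ i : Fin m, (X i.castSucc).carrier → (X i.succ).carrier) (i : Fin (m + 1)) :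
    (X 0).carrier → (X i).carrier :=
  Fin.induction (motive := fun i => (X 0).carrier → (X i).carrier) id (fun i t => π i ∘ t) i

/-- `μ` is a shift-invariant Borel probability measure on `X`. -/
structure IsInvariantProbability {A G : Type*} [TopologicalSpace A] [MeasurableSpace A]
    [AddMonoidWithOne G] (X : Subshift A G) (μ : Measure X.carrier) : Prop where
  isProbabilityMeasure : IsProbabilityMeasure μ
  measurePreserving : MeasurePreserving (shiftMap X) μ μ

/-- The entropy `-∑_I μ[I] log μ[I]` of the partition of `X` into the cylinders of length `n`
(words that do not occur in `X` have empty cylinder and contribute `0`). -/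
noncomputable def cylinderEntropy {A G : Type*} [Fintype A] [TopologicalSpace A]
    [MeasurableSpace A] [AddMonoidWithOne G] (X : Subshift A G) (μ : Measure X.carrier)
    (n : ℕ) : ℝ :=
  ∑ I : Fin n → A,
    Real.negMulLog (μ.real {x : X.carrier | ∀ j : Fin n, x.1 ((j : ℕ) : G) = I j})

/-- The measure-theoretic entropy `h_μ(σ_X) = lim_n -(1/n) ∑_I μ[I] log μ[I]`.  For an invariant
probability measure the limit exists by subadditivity of `n ↦ -∑_I μ[I] log μ[I]`. -/
noncomputable def entropy {A G : Type*} [Fintype A] [TopologicalSpace A]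
    [MeasurableSpace A] [AddMonoidWithOne G] (X : Subshift A G) (μ : Measure X.carrier) : ℝ :=
  limUnder atTop (fun n : ℕ => cylinderEntropy X μ n / (n : ℝ))

/-- `μ(f) + ∑_i a_i h_{μ ∘ τ_i⁻¹}(σ_{X_i})`. -/
noncomputable def weightedFreeEnergy {m : ℕ} {A : Fin (m + 1) → Type*} {G : Type*}
    [∀ i, Fintype (A i)] [∀ i, TopologicalSpace (A i)] [∀ i, MeasurableSpace (A i)]
    [AddMonoidWithOne G] (X : ∀ i, Subshift (A i) G)
    (π : ∀ i : Fin m, (X i.castSucc).carrier → (X i.succ).carrier)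
    (a : Fin (m + 1) → ℝ) (f : C((X 0).carrier, ℝ)) (μ : Measure (X 0).carrier) : ℝ :=
  ∫ x, f x ∂μ + ∑ i, a i * entropy (X i) (μ.map (tower X π i))

/-- `μ` is an `a`-weighted equilibrium state of `f`: an invariant Borel probability measure at
which the weighted free energy attains its supremum over all such measures. -/
def IsWeightedEquilibriumState {m : ℕ} {A : Fin (m + 1) → Type*} {G : Type*}
    [∀ i, Fintype (A i)] [∀ i, TopologicalSpace (A i)] [∀ i, MeasurableSpace (A i)]
    [AddMonoidWithOne G] (X : ∀ i, Subshift (A i) G)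
    (π : ∀ i : Fin m, (X i.castSucc).carrier → (X i.succ).carrier)
    (a : Fin (m + 1) → ℝ) (f : C((X 0).carrier, ℝ)) (μ : Measure (X 0).carrier) : Prop :=
  IsInvariantProbability (X 0) μ ∧
    ∀ η : Measure (X 0).carrier, IsInvariantProbability (X 0) η →
      weightedFreeEnergy X π a f η ≤ weightedFreeEnergy X π a f μ

/-- The class `V(σ_X)`: the ergodic sums `S_n f(x) = ∑_{i<n} f(σ^i x)` satisfy
`|S_n f(x) - S_n f(y)| ≤ c` whenever `x` and `y` agree at the `n` coordinates
`s, s + 1, …, s + n - 1`.  It is used with `s = 0`, the first coordinate of a one-sided sequence,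
and with `s = 1` for two-sided sequences (agreement at the coordinates `1, …, n`). -/
def HasBoundedErgodicSumVariation {A G : Type*} [TopologicalSpace A] [AddMonoidWithOne G]
    (X : Subshift A G) (s : G) (f : C(X.carrier, ℝ)) : Prop :=
  ∃ c : ℝ, 0 < c ∧ ∀ n : ℕ, 1 ≤ n → ∀ x y : X.carrier,
    (∀ j : ℕ, j < n → x.1 (s + (j : G)) = y.1 (s + (j : G))) →
      |∑ i ∈ Finset.range n, f ((shiftMap X)^[i] x)
        - ∑ i ∈ Finset.range n, f ((shiftMap X)^[i] y)| ≤ c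

end WeightedEquilibrium

open WeightedEquilibrium

set_option linter.unusedSectionVars false

namespace WeightedEquilibrium

/-! ### Finite words and their distributions -/

/-! Recoding each factor by windows of letters gives maps `ζ i` from the first subshift into one
finite alphabet with `ζ (i + 1) = g i ∘ ζ i`, so the factor maps act letter by letter and the
problem becomes one about weights on words. Start from `φ_0 w = sup_{[w]} exp (S_n f / a_0)`, put
`A_i = a_0 + ⋯ + a_i`, and let `φ_{i+1}` be the sum of `φ_i` over the fibres of `g i`, raised to the
power `A_i / A_{i+1}`. Let `Z_n` be the mass of the last weight `φ_m` on words of length `n`.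

The chain rule for relative entropy, applied level by level, shows that every distribution `p` on
the words of length `n` carried by `φ_0` satisfies `∑ a_i H(p_i) + a_0 ∑ p log φ_0 ≤ A_m log Z_n -
a_0 KL(p | ψ_n)`, where `p_i` is the image of `p` at level `i`; equality holds for `p = ψ_n`, the
distribution `chainWeight` (`chainEntropy_sub_le`, `chainEntropy_chainWeight`). All `φ_i` are
submultiplicative. Since the exponents are at most `1`, the specification property of `φ_0` passes
to all `φ_i`; hence `A_m log Z_n = n z + O(1)` (`exists_pressure`). The factor relating `ψ` to `φ_0`
is built from nonpositive powers of submultiplicative quantities, so `ψ (I K J) ≥ c ψ I ψ J` for a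
suitable short connecting word `K` (`exists_isGluingFamily`).

Consequently no invariant measure has free energy above `z`. Conversely, put mass `ψ_n w` on a point
of the cylinder `[w]`, average along orbits, and let `μ` be a weak limit: concavity and
subadditivity of block entropy give `μ` free energy at least `z` (`le_codedFreeEnergy_of_tendsto`).
Gluing survives in the limit as a domination `ψ_n P ≤ K μ[P]` (`eventWeight_le_measureReal`), which
together with a pigeonhole choice of positions yields the lower bound on correlations, and hence
ergodicity.

For uniqueness, the error term was kept: if `η` is another equilibrium state, then `KL(η_n | ψ_n)`
is bounded independently of `n`, because the error in `log Z_n` is `O(1)` and not merely `o(n)`.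
With the domination of `ψ_n` by `μ` this forces `η ≪ μ` (`absolutelyContinuous_of_klSum_le`), and
ergodicity of `μ` gives `η = μ`. -/

/-- The words of length `n` over the finite alphabet `B`. -/
def words (B : Type*) [Fintype B] (n : ℕ) : Finset (List B) :=
  Finset.univ.map ⟨fun f : Fin n → B => List.ofFn f, List.ofFn_injective⟩

section Words

variable {B : Type*} [Fintype B]

@[simp] theorem mem_words {n : ℕ} {w : List B} : w ∈ words B n ↔ w.length = n := by
  constructor
  · intro h
    obtain ⟨f, -, rfl⟩ := Finset.mem_map.1 h
    simp
  · rintro rfl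
    exact Finset.mem_map.2 ⟨fun i => w.get i, Finset.mem_univ _, by simp⟩

theorem words_zero : words B 0 = {[]} := by
  ext w; simp

theorem card_words (n : ℕ) : (words B n).card = Fintype.card B ^ n := by
  simp [words]

theorem sum_words_add (n m : ℕ) (F : List B → ℝ) :
    ∑ w ∈ words B (n + m), F w = ∑ u ∈ words B n, ∑ v ∈ words B m, F (u ++ v) := by
  rw [← Finset.sum_product']
  symm
  refine Finset.sum_bij' (fun p _ => p.1 ++ p.2) (fun w _ => (w.take n, w.drop n)) ?_ ?_ ?_ ?_ ?_
  · rintro ⟨u, v⟩ h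
    simp only [Finset.mem_product, mem_words] at h
    simp [h.1, h.2]
  · intro w h
    simp only [mem_words] at h
    simp [h]
  · rintro ⟨u, v⟩ h
    simp only [Finset.mem_product, mem_words] at h
    simp [← h.1]
  · intro w h
    simp
  · intros; rfl

/-- Gibbs' inequality. -/
theorem gibbs_inequality {ι : Type*} (s : Finset ι) (p q : ι → ℝ) (hp : ∀ i ∈ s, 0 ≤ p i)
    (hq : ∀ i ∈ s, 0 ≤ q i) (hpq : ∀ i ∈ s, q i = 0 → p i = 0)
    (hsum : ∑ i ∈ s, q i ≤ ∑ i ∈ s, p i) :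
    0 ≤ ∑ i ∈ s, p i * (Real.log (p i) - Real.log (q i)) := by
  have h : ∑ i ∈ s, (p i - q i) ≤ ∑ i ∈ s, p i * (Real.log (p i) - Real.log (q i)) := by
    refine Finset.sum_le_sum fun i hi => ?_
    rcases (hp i hi).eq_or_lt with h0 | h0
    · rw [← h0]; simpa using hq i hi
    · have hq0 : 0 < q i := lt_of_le_of_ne (hq i hi) fun h => h0.ne' (hpq i hi h.symm)
      have h1 := Real.log_le_sub_one_of_pos (div_pos hq0 h0)
      rw [Real.log_div hq0.ne' h0.ne'] at h1
      have h2 := mul_le_mul_of_nonneg_left h1 h0.le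
      have h3 : p i * (q i / p i - 1) = q i - p i := by field_simp
      nlinarith
  rw [Finset.sum_sub_distrib] at h
  linarith

/-- The entropy of a distribution on the words of length `n`. -/
noncomputable def wordEntropy (n : ℕ) (p : List B → ℝ) : ℝ :=
  ∑ w ∈ words B n, Real.negMulLog (p w)

/-- The relative entropy of two distributions on the words of length `n`. -/
noncomputable def klSum (n : ℕ) (p q : List B → ℝ) : ℝ :=
  ∑ w ∈ words B n, p w * (Real.log (p w) - Real.log (q w))

theorem klSum_eq (n : ℕ) (p q : List B → ℝ) :
    klSum n p q = -wordEntropy n p - ∑ w ∈ words B n, p w * Real.log (q w) := by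
  simp only [klSum, wordEntropy, Real.negMulLog, mul_sub, Finset.sum_sub_distrib,
    ← Finset.sum_neg_distrib]
  simp

/-- Mutual information is nonnegative: this is Gibbs' inequality for `p` against the product of its
two marginals. -/
theorem wordEntropy_append_le (n m : ℕ) (p p₁ p₂ : List B → ℝ)
    (hp : ∀ w ∈ words B (n + m), 0 ≤ p w) (hsum : ∑ w ∈ words B (n + m), p w = 1)
    (h₁ : ∀ u ∈ words B n, p₁ u = ∑ v ∈ words B m, p (u ++ v))
    (h₂ : ∀ v ∈ words B m, p₂ v = ∑ u ∈ words B n, p (u ++ v)) :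
    wordEntropy (n + m) p ≤ wordEntropy n p₁ + wordEntropy m p₂ := by
  have hp' : ∀ u ∈ words B n, ∀ v ∈ words B m, 0 ≤ p (u ++ v) := fun u hu v hv =>
    hp _ (by simp_all)
  have e₁ : ∑ u ∈ words B n, p₁ u = 1 := by
    rw [Finset.sum_congr rfl h₁, ← sum_words_add, hsum]
  have e₂ : ∑ u ∈ words B m, p₂ u = 1 := by
    rw [Finset.sum_congr rfl h₂, Finset.sum_comm, ← sum_words_add, hsum]
  have n₁ : ∀ u ∈ words B n, 0 ≤ p₁ u := fun u hu => by
    rw [h₁ u hu]; exact Finset.sum_nonneg fun v hv => hp' u hu v hv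
  have n₂ : ∀ u ∈ words B m, 0 ≤ p₂ u := fun v hv => by
    rw [h₂ v hv]; exact Finset.sum_nonneg fun u hu => hp' u hu v hv
  have z₁ : ∀ u ∈ words B n, ∀ v ∈ words B m, p₁ u = 0 → p (u ++ v) = 0 := by
    intro u hu v hv h
    rw [h₁ u hu] at h
    exact (Finset.sum_eq_zero_iff_of_nonneg fun v hv => hp' u hu v hv).1 h v hv
  have z₂ : ∀ u ∈ words B n, ∀ v ∈ words B m, p₂ v = 0 → p (u ++ v) = 0 := by
    intro u hu v hv h
    rw [h₂ v hv] at h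
    exact (Finset.sum_eq_zero_iff_of_nonneg fun u hu => hp' u hu v hv).1 h u hu
  have key := gibbs_inequality (words B n ×ˢ words B m) (fun x => p (x.1 ++ x.2))
    (fun x => p₁ x.1 * p₂ x.2) ?_ ?_ ?_ ?_
  · have hE : ∑ x ∈ words B n ×ˢ words B m, p (x.1 ++ x.2) *
        (Real.log (p (x.1 ++ x.2)) - Real.log (p₁ x.1 * p₂ x.2)) =
        ∑ x ∈ words B n ×ˢ words B m, (p (x.1 ++ x.2) * Real.log (p (x.1 ++ x.2)) -
          p (x.1 ++ x.2) * Real.log (p₁ x.1) - p (x.1 ++ x.2) * Real.log (p₂ x.2)) := by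
      refine Finset.sum_congr rfl fun x hx => ?_
      rw [Finset.mem_product] at hx
      by_cases h1 : p₁ x.1 = 0
      · simp [z₁ _ hx.1 _ hx.2 h1]
      by_cases h2 : p₂ x.2 = 0
      · simp [z₂ _ hx.1 _ hx.2 h2]
      rw [Real.log_mul h1 h2]; ring
    rw [hE, Finset.sum_sub_distrib, Finset.sum_sub_distrib, Finset.sum_product,
      Finset.sum_product, Finset.sum_product_right] at key
    simp only [← Finset.sum_mul] at key
    have a₁ : ∑ u ∈ words B n, (∑ v ∈ words B m, p (u ++ v)) * Real.log (p₁ u) =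
        ∑ u ∈ words B n, p₁ u * Real.log (p₁ u) :=
      Finset.sum_congr rfl fun u hu => by rw [h₁ u hu]
    have a₂ : ∑ v ∈ words B m, (∑ u ∈ words B n, p (u ++ v)) * Real.log (p₂ v) =
        ∑ v ∈ words B m, p₂ v * Real.log (p₂ v) :=
      Finset.sum_congr rfl fun v hv => by rw [h₂ v hv]
    rw [a₁, a₂] at key
    simp only [wordEntropy, Real.negMulLog, neg_mul, Finset.sum_neg_distrib]
    rw [sum_words_add]
    linarith
  · rintro ⟨u, v⟩ h
    rw [Finset.mem_product] at h
    exact hp' _ h.1 _ h.2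
  · rintro ⟨u, v⟩ h
    rw [Finset.mem_product] at h
    exact mul_nonneg (n₁ _ h.1) (n₂ _ h.2)
  · rintro ⟨u, v⟩ h h0
    rw [Finset.mem_product] at h
    rcases mul_eq_zero.1 h0 with h0 | h0
    · exact z₁ _ h.1 _ h.2 h0
    · exact z₂ _ h.1 _ h.2 h0
  · rw [Finset.sum_product, Finset.sum_product, ← sum_words_add, hsum]
    simp only [← Finset.mul_sum, e₂, mul_one, e₁, le_refl]

theorem wordEntropy_le [Nonempty B] (n : ℕ) (p : List B → ℝ) (hp : ∀ w ∈ words B n, 0 ≤ p w)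
    (hsum : ∑ w ∈ words B n, p w = 1) :
    wordEntropy n p ≤ n * Real.log (Fintype.card B) := by
  have hc : (0 : ℝ) < Fintype.card B := by exact_mod_cast Fintype.card_pos
  have key := gibbs_inequality (words B n) p (fun _ => ((Fintype.card B : ℝ) ^ n)⁻¹) hp
    (fun _ _ => by positivity) (fun _ _ h => absurd h (by positivity)) ?_
  · simp only [mul_sub, Finset.sum_sub_distrib, ← Finset.sum_mul, hsum, Real.log_inv,
      Real.log_pow] at key
    simp only [wordEntropy, Real.negMulLog, neg_mul, Finset.sum_neg_distrib]
    linarith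
  · rw [Finset.sum_const, card_words, nsmul_eq_mul, hsum]
    push_cast
    rw [mul_inv_cancel₀ (by positivity)]

theorem wordEntropy_nonneg (n : ℕ) (p : List B → ℝ) (hp : ∀ w ∈ words B n, 0 ≤ p w)
    (hp1 : ∀ w ∈ words B n, p w ≤ 1) : 0 ≤ wordEntropy n p :=
  Finset.sum_nonneg fun w hw => Real.negMulLog_nonneg (hp w hw) (hp1 w hw)

/-! ### Images of weights under letter-to-letter codes -/

variable [DecidableEq B]

/-- The image of a weight on words under a letter-to-letter code. -/
def fiberSum (g : B → B) (p : List B → ℝ) (J : List B) : ℝ :=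
  ∑ I ∈ (words B J.length).filter (fun I => I.map g = J), p I

theorem fiberSum_nonneg {g : B → B} {p : List B → ℝ} (hp : ∀ w, 0 ≤ p w) (J : List B) :
    0 ≤ fiberSum g p J := Finset.sum_nonneg fun _ _ => hp _

theorem sum_mul_fiberSum (g : B → B) (p F : List B → ℝ) (n : ℕ) :
    ∑ J ∈ words B n, fiberSum g p J * F J = ∑ I ∈ words B n, p I * F (I.map g) := by
  symm
  rw [← Finset.sum_fiberwise_of_maps_to (t := words B n) (g := List.map g)
    (fun I hI => by simpa using hI)]
  refine Finset.sum_congr rfl fun J hJ => ?_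
  rw [mem_words] at hJ
  symm
  rw [fiberSum, Finset.sum_mul, hJ]
  refine Finset.sum_congr rfl fun I hI => ?_
  rw [(Finset.mem_filter.1 hI).2]

theorem sum_fiberSum (g : B → B) (p : List B → ℝ) (n : ℕ) :
    ∑ J ∈ words B n, fiberSum g p J = ∑ I ∈ words B n, p I := by
  simpa using sum_mul_fiberSum g p (fun _ => 1) n

theorem le_fiberSum {g : B → B} {p : List B → ℝ} (hp : ∀ w, 0 ≤ p w) (I : List B) :
    p I ≤ fiberSum g p (I.map g) :=
  Finset.single_le_sum (f := p) (fun w _ => hp w) (by simp)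

/-- A letter-to-letter code preserves lengths, so the preimages of a concatenation are exactly the
concatenations of preimages. -/
theorem fiberSum_append (g : B → B) (p : List B → ℝ) (I J : List B) :
    fiberSum g p (I ++ J) = ∑ u ∈ (words B I.length).filter (fun u => u.map g = I),
      ∑ v ∈ (words B J.length).filter (fun v => v.map g = J), p (u ++ v) := by
  rw [fiberSum, List.length_append, Finset.sum_filter, sum_words_add, Finset.sum_filter]
  refine Finset.sum_congr rfl fun u hu => ?_
  rw [mem_words] at hu
  rw [Finset.sum_filter]
  split_ifs with h
  · refine Finset.sum_congr rfl fun v hv => ?_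
    simp [h]
  · refine Finset.sum_eq_zero fun v hv => ?_
    rw [if_neg]
    intro h'
    rw [List.map_append] at h'
    exact h (List.append_inj_left h' (by simpa using hu))

theorem fiberSum_nil (g : B → B) (p : List B → ℝ) : fiberSum g p [] = p [] := by
  simp [fiberSum, words_zero, Finset.filter_singleton]

theorem fiberSum_congr {g : B → B} {p q : List B → ℝ} {n : ℕ} (h : ∀ w ∈ words B n, p w = q w)
    {J : List B} (hJ : J ∈ words B n) : fiberSum g p J = fiberSum g q J := by
  rw [mem_words] at hJ
  refine Finset.sum_congr rfl fun I hI => h I ?_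
  rw [← hJ]
  exact (Finset.mem_filter.1 hI).1

theorem fiberSum_mul_comp (g : B → B) (p r : List B → ℝ) (J : List B) :
    fiberSum g (fun w => p w * r (w.map g)) J = fiberSum g p J * r J := by
  rw [fiberSum, fiberSum, Finset.sum_mul]
  refine Finset.sum_congr rfl fun I hI => ?_
  rw [(Finset.mem_filter.1 hI).2]

/-- The conditional relative entropy of `p` with respect to `φ` over the code `g`. -/
noncomputable def klFiber (g : B → B) (n : ℕ) (p φ : List B → ℝ) : ℝ :=
  ∑ w ∈ words B n, p w * (Real.log (p w) - Real.log (φ w) - Real.log (fiberSum g p (w.map g)) +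
    Real.log (fiberSum g φ (w.map g)))

/-- Chain rule for relative entropy. The logarithms of the fibre sums cancel term by term, so no
positivity is needed. -/
theorem klSum_eq_add_klFiber (g : B → B) (n : ℕ) (p φ : List B → ℝ) :
    klSum n p φ = klSum n (fiberSum g p) (fiberSum g φ) + klFiber g n p φ := by
  rw [klSum, klSum, klFiber, sum_mul_fiberSum g p
    (fun J => Real.log (fiberSum g p J) - Real.log (fiberSum g φ J)), ← Finset.sum_add_distrib]
  exact Finset.sum_congr rfl fun w _ => by ring

end Words

/-! ### Submultiplicative weights on words -/

theorem sum_sum_sum_comm {α β γ : Type*} (s : Finset α) (t : Finset β) (r : Finset γ)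
    (F : α → β → γ → ℝ) :
    ∑ x ∈ s, ∑ y ∈ t, ∑ z ∈ r, F x y z = ∑ z ∈ r, ∑ x ∈ s, ∑ y ∈ t, F x y z := by
  calc _ = ∑ x ∈ s, ∑ z ∈ r, ∑ y ∈ t, F x y z :=
        Finset.sum_congr rfl fun x _ => Finset.sum_comm
    _ = _ := Finset.sum_comm

section Submultiplicative

variable {B : Type*} [Fintype B]

/-- The total mass of a weight on the words of length `n`. -/
def totalWeight (φ : List B → ℝ) (n : ℕ) : ℝ := ∑ w ∈ words B n, φ w

/-- Nonnegative submultiplicative weights on words. -/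
structure IsSubmultiplicativeWeight (φ : List B → ℝ) : Prop where
  nonneg : ∀ w, 0 ≤ φ w
  nil : φ [] = 1
  append_le : ∀ I J, φ (I ++ J) ≤ φ I * φ J

/-- `φ` is quasi-multiplicative after the insertion of connecting words of length at most `T`. -/
def HasGluing (φ : List B → ℝ) (T : ℕ) : Prop :=
  ∃ c : ℝ, 0 < c ∧ ∀ I J : List B, c * (φ I * φ J) ≤
    ∑ t ∈ Finset.range (T + 1), ∑ K ∈ words B t, φ (I ++ K ++ J)

namespace IsSubmultiplicativeWeight

variable {φ : List B → ℝ} (h : IsSubmultiplicativeWeight φ)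
include h

omit [Fintype B] in
theorem pos_of_append_pos {I J : List B} (hp : 0 < φ (I ++ J)) : 0 < φ I ∧ 0 < φ J := by
  have h1 := hp.trans_le (h.append_le I J)
  exact ⟨pos_of_mul_pos_left h1 (h.nonneg J), pos_of_mul_pos_right h1 (h.nonneg I)⟩

theorem exists_append_append_le (T : ℕ) : ∃ C : ℝ, 0 < C ∧ ∀ I K J : List B, K.length ≤ T →
    φ (I ++ K ++ J) ≤ C * (φ I * φ J) := by
  refine ⟨1 + ∑ t ∈ Finset.range (T + 1), totalWeight φ t, ?_, ?_⟩
  · have : 0 ≤ ∑ t ∈ Finset.range (T + 1), totalWeight φ t :=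
      Finset.sum_nonneg fun t _ => Finset.sum_nonneg fun w _ => h.nonneg w
    linarith
  · intro I K J hK
    have h1 : φ K ≤ totalWeight φ K.length :=
      Finset.single_le_sum (f := φ) (fun w _ => h.nonneg w) (by simp)
    have h2 : totalWeight φ K.length ≤ ∑ t ∈ Finset.range (T + 1), totalWeight φ t :=
      Finset.single_le_sum (f := totalWeight φ)
        (fun t _ => Finset.sum_nonneg fun w _ => h.nonneg w) (by simp; omega)
    calc φ (I ++ K ++ J) ≤ φ (I ++ K) * φ J := h.append_le _ _
      _ ≤ φ I * φ K * φ J := mul_le_mul_of_nonneg_right (h.append_le _ _) (h.nonneg J)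
      _ = φ K * (φ I * φ J) := by ring
      _ ≤ _ := mul_le_mul_of_nonneg_right (by linarith)
          (mul_nonneg (h.nonneg I) (h.nonneg J))

omit [Fintype B] in
theorem rpow {θ : ℝ} (hθ : 0 ≤ θ) : IsSubmultiplicativeWeight (fun w => φ w ^ θ) where
  nonneg w := Real.rpow_nonneg (h.nonneg w) θ
  nil := by simp [h.nil]
  append_le I J := by
    rw [← Real.mul_rpow (h.nonneg I) (h.nonneg J)]
    exact Real.rpow_le_rpow (h.nonneg _) (h.append_le I J) hθ

/-- Regarding the total mass as a weight that sees only the length of a word makes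
`exists_append_append_le` available for it. -/
theorem totalWeight_length :
    IsSubmultiplicativeWeight (fun w : List B => totalWeight φ w.length) where
  nonneg w := Finset.sum_nonneg fun w _ => h.nonneg w
  nil := by simp [totalWeight, words_zero, h.nil]
  append_le I J := by
    simp only [List.length_append, totalWeight]
    rw [sum_words_add, Finset.sum_mul_sum]
    exact Finset.sum_le_sum fun u _ => Finset.sum_le_sum fun v _ => h.append_le u v

theorem totalWeight_nonneg (n : ℕ) : 0 ≤ totalWeight φ n :=
  Finset.sum_nonneg fun w _ => h.nonneg w

theorem totalWeight_add_le (n m : ℕ) :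
    totalWeight φ (n + m) ≤ totalWeight φ n * totalWeight φ m := by
  simp only [totalWeight]
  rw [sum_words_add, Finset.sum_mul_sum]
  exact Finset.sum_le_sum fun u _ => Finset.sum_le_sum fun v _ => h.append_le u v

theorem totalWeight_pos {w : List B} (hw : 0 < φ w) : 0 < totalWeight φ w.length :=
  hw.trans_le (Finset.single_le_sum (f := φ) (fun w _ => h.nonneg w) (by simp))

/-- Summing the gluing inequality over both words bounds the product by masses at lengths `n + t +
m` with `t ≤ T`; submultiplicativity then removes the bounded gap `t` at the cost of a constant. -/
theorem exists_totalWeight_mul_le {T : ℕ} (hg : HasGluing φ T) :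
    ∃ C : ℝ, 0 < C ∧ ∀ n m, totalWeight φ n * totalWeight φ m ≤ C * totalWeight φ (n + m) := by
  obtain ⟨c, hc, hglue⟩ := hg
  have hS : 0 ≤ ∑ t ∈ Finset.range (T + 1), totalWeight φ t :=
    Finset.sum_nonneg fun t _ => h.totalWeight_nonneg t
  refine ⟨(1 + ∑ t ∈ Finset.range (T + 1), totalWeight φ t) / c, by positivity, fun n m => ?_⟩
  have h1 : c * (totalWeight φ n * totalWeight φ m) ≤
      ∑ t ∈ Finset.range (T + 1), totalWeight φ (n + t + m) := by
    calc c * (totalWeight φ n * totalWeight φ m)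
        = ∑ I ∈ words B n, ∑ J ∈ words B m, c * (φ I * φ J) := by
          rw [totalWeight, totalWeight, Finset.sum_mul_sum]
          simp only [Finset.mul_sum]
      _ ≤ ∑ I ∈ words B n, ∑ J ∈ words B m,
          ∑ t ∈ Finset.range (T + 1), ∑ K ∈ words B t, φ (I ++ K ++ J) :=
          Finset.sum_le_sum fun I _ => Finset.sum_le_sum fun J _ => hglue I J
      _ = ∑ t ∈ Finset.range (T + 1), totalWeight φ (n + t + m) := by
          rw [sum_sum_sum_comm]
          simp_rw [totalWeight, sum_words_add]
          exact Finset.sum_congr rfl fun t _ => Finset.sum_congr rfl fun u _ => Finset.sum_comm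
  have h2 : ∑ t ∈ Finset.range (T + 1), totalWeight φ (n + t + m) ≤
      (∑ t ∈ Finset.range (T + 1), totalWeight φ t) * totalWeight φ (n + m) := by
    rw [Finset.sum_mul]
    refine Finset.sum_le_sum fun t _ => ?_
    rw [show n + t + m = t + (n + m) by ring]
    exact h.totalWeight_add_le t (n + m)
  rw [div_mul_eq_mul_div, le_div_iff₀ hc]
  nlinarith [h.totalWeight_nonneg (n + m)]

end IsSubmultiplicativeWeight

theorem rpow_sum_le_sum_rpow {ι : Type*} (s : Finset ι) (f : ι → ℝ) (hf : ∀ i, 0 ≤ f i) {θ : ℝ}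
    (h0 : 0 < θ) (h1 : θ ≤ 1) : (∑ i ∈ s, f i) ^ θ ≤ ∑ i ∈ s, f i ^ θ := by
  classical
  induction s using Finset.induction_on with
  | empty => simp [Real.zero_rpow h0.ne']
  | insert i s hi ih =>
    rw [Finset.sum_insert hi, Finset.sum_insert hi]
    exact (Real.rpow_add_le_add_rpow (hf i) (Finset.sum_nonneg fun i _ => hf i) h0.le h1).trans
      (by linarith)

/-- Exponents at most `1` are essential: they make the power subadditive, so it can be moved inside
the sum over connecting words. -/
theorem HasGluing.rpow {φ : List B → ℝ} {T : ℕ} (h : HasGluing φ T)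
    (hφ : ∀ w, 0 ≤ φ w) {θ : ℝ} (h0 : 0 < θ) (h1 : θ ≤ 1) :
    HasGluing (fun w => φ w ^ θ) T := by
  obtain ⟨c, hc, hglue⟩ := h
  refine ⟨c ^ θ, Real.rpow_pos_of_pos hc θ, fun I J => ?_⟩
  rw [← Real.mul_rpow (hφ I) (hφ J), ← Real.mul_rpow hc.le (mul_nonneg (hφ I) (hφ J))]
  refine (Real.rpow_le_rpow (mul_nonneg hc.le (mul_nonneg (hφ I) (hφ J))) (hglue I J) h0.le).trans ?_
  refine (rpow_sum_le_sum_rpow _ _ (fun t => Finset.sum_nonneg fun K _ => hφ _) h0 h1).trans ?_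
  exact Finset.sum_le_sum fun t _ => rpow_sum_le_sum_rpow _ _ (fun K => hφ _) h0 h1

variable [DecidableEq B]

theorem IsSubmultiplicativeWeight.fiberSum {φ : List B → ℝ} (h : IsSubmultiplicativeWeight φ)
    (g : B → B) : IsSubmultiplicativeWeight (fiberSum g φ) where
  nonneg := fiberSum_nonneg h.nonneg
  nil := by rw [fiberSum_nil, h.nil]
  append_le I J := by
    rw [fiberSum_append, WeightedEquilibrium.fiberSum, WeightedEquilibrium.fiberSum,
      Finset.sum_mul_sum]
    exact Finset.sum_le_sum fun u _ => Finset.sum_le_sum fun v _ => h.append_le u v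

/-- Summing over all connecting words of the image, each with its fibre, runs through all connecting
words upstairs exactly once, so the constant does not change. -/
theorem HasGluing.fiberSum {φ : List B → ℝ} {T : ℕ} (h : HasGluing φ T) (g : B → B) :
    HasGluing (fiberSum g φ) T := by
  obtain ⟨c, hc, hglue⟩ := h
  refine ⟨c, hc, fun I J => ?_⟩
  set SI := (words B I.length).filter (fun u => u.map g = I) with hSI
  set SJ := (words B J.length).filter (fun u => u.map g = J) with hSJ
  have e : ∀ t, ∑ K ∈ words B t, WeightedEquilibrium.fiberSum g φ (I ++ K ++ J) =
      ∑ u ∈ SI, ∑ v ∈ SJ, ∑ K ∈ words B t, φ (u ++ K ++ v) := by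
    intro t
    have e1 : ∀ K ∈ words B t, WeightedEquilibrium.fiberSum g φ (I ++ K ++ J) =
        WeightedEquilibrium.fiberSum g
          (fun K' => ∑ u ∈ SI, ∑ v ∈ SJ, φ (u ++ K' ++ v)) K := by
      intro K hK
      rw [List.append_assoc, fiberSum_append, WeightedEquilibrium.fiberSum]
      trans ∑ u ∈ SI, ∑ K' ∈ (words B K.length).filter (fun K' => K'.map g = K), ∑ v ∈ SJ,
        φ (u ++ K' ++ v)
      · refine Finset.sum_congr rfl fun u _ => ?_
        have := fiberSum_append g (fun w => φ (u ++ w)) K J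
        rw [WeightedEquilibrium.fiberSum] at this
        rw [this]
        simp [hSJ]
      · exact Finset.sum_comm
    rw [Finset.sum_congr rfl e1, sum_fiberSum, ← sum_sum_sum_comm]
  calc c * (WeightedEquilibrium.fiberSum g φ I * WeightedEquilibrium.fiberSum g φ J)
      = ∑ u ∈ SI, ∑ v ∈ SJ, c * (φ u * φ v) := by
        rw [WeightedEquilibrium.fiberSum, WeightedEquilibrium.fiberSum, Finset.sum_mul_sum]
        simp only [Finset.mul_sum, hSI, hSJ]
    _ ≤ ∑ u ∈ SI, ∑ v ∈ SJ, ∑ t ∈ Finset.range (T + 1), ∑ K ∈ words B t, φ (u ++ K ++ v) :=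
        Finset.sum_le_sum fun u _ => Finset.sum_le_sum fun v _ => hglue u v
    _ = ∑ t ∈ Finset.range (T + 1), ∑ u ∈ SI, ∑ v ∈ SJ, ∑ K ∈ words B t, φ (u ++ K ++ v) := by
        rw [sum_sum_sum_comm]
    _ = _ := (Finset.sum_congr rfl fun t _ => e t).symm

end Submultiplicative

/-! ### Weights along a chain of letter-to-letter codes -/

section Chain

/-- The partial sums `a 0 + ⋯ + a i` of the coefficients. -/
def coeffSum (a : ℕ → ℝ) (i : ℕ) : ℝ := ∑ l ∈ Finset.range (i + 1), a l

theorem coeffSum_zero (a : ℕ → ℝ) : coeffSum a 0 = a 0 := by simp [coeffSum]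

theorem coeffSum_succ (a : ℕ → ℝ) (i : ℕ) : coeffSum a (i + 1) = coeffSum a i + a (i + 1) :=
  Finset.sum_range_succ _ _

variable {a : ℕ → ℝ} (ha : 0 < a 0) (ha' : ∀ i, 0 ≤ a i)
include ha ha'

theorem coeffSum_pos (i : ℕ) : 0 < coeffSum a i := by
  induction i with
  | zero => rwa [coeffSum_zero]
  | succ i ih => rw [coeffSum_succ]; linarith [ha' (i + 1)]

theorem coeffSum_ratio_pos (i : ℕ) : 0 < coeffSum a i / coeffSum a (i + 1) :=
  div_pos (coeffSum_pos ha ha' i) (coeffSum_pos ha ha' (i + 1))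

theorem coeffSum_ratio_le_one (i : ℕ) : coeffSum a i / coeffSum a (i + 1) ≤ 1 := by
  rw [div_le_one (coeffSum_pos ha ha' (i + 1)), coeffSum_succ]
  linarith [ha' (i + 1)]

omit ha ha'

variable {B : Type*} [Fintype B] [DecidableEq B]

/-- The weights `φ_{i+1} = (∑_{g_i I = J} φ_i(I))^{A_i / A_{i+1}}`, with `A_i = a 0 + ⋯ + a i`. -/
noncomputable def levelWeight (g : ℕ → B → B) (a : ℕ → ℝ) (φ : List B → ℝ) : ℕ → List B → ℝ
  | 0, w => φ w
  | i + 1, J =>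
      fiberSum (g i) (levelWeight g a φ i) J ^ (coeffSum a i / coeffSum a (i + 1))

/-- The correcting factor of `chainWeight`. -/
noncomputable def chainFactor (g : ℕ → B → B) (φ : ℕ → List B → ℝ) : ℕ → ℕ → List B → ℝ
  | 0, i, w => (totalWeight (φ i) w.length)⁻¹
  | k + 1, i, w => (fiberSum (g i) (φ i) (w.map (g i)))⁻¹ * φ (i + 1) (w.map (g i)) *
      chainFactor g φ k (i + 1) (w.map (g i))

/-- The normalized weight on the words of level `i` obtained from the levels `i, …, i + k`. -/
noncomputable def chainWeight (g : ℕ → B → B) (φ : ℕ → List B → ℝ) (k i : ℕ) (w : List B) : ℝ :=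
  φ i w * chainFactor g φ k i w

/-- The weighted sum of the entropies of the images of `p` at the levels `i + 1, …, i + k`. -/
noncomputable def chainEntropy (g : ℕ → B → B) (a : ℕ → ℝ) (n : ℕ) : ℕ → ℕ → (List B → ℝ) → ℝ
  | 0, _, _ => 0
  | k + 1, i, p => a (i + 1) * wordEntropy n (fiberSum (g i) p) +
      chainEntropy g a n k (i + 1) (fiberSum (g i) p)

include ha ha' in
theorem levelWeight_isSubmultiplicativeWeight (g : ℕ → B → B) {φ : List B → ℝ}
    (hφ : IsSubmultiplicativeWeight φ) (i : ℕ) :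
    IsSubmultiplicativeWeight (levelWeight g a φ i) := by
  induction i with
  | zero => exact hφ
  | succ i ih => exact (ih.fiberSum (g i)).rpow (coeffSum_ratio_pos ha ha' i).le

include ha ha' in
theorem levelWeight_hasGluing (g : ℕ → B → B) {φ : List B → ℝ}
    (hφ : IsSubmultiplicativeWeight φ) {T : ℕ} (h : HasGluing φ T) (i : ℕ) :
    HasGluing (levelWeight g a φ i) T := by
  induction i with
  | zero => exact h
  | succ i ih =>
    exact (ih.fiberSum (g i)).rpow
      ((levelWeight_isSubmultiplicativeWeight ha ha' g hφ i).fiberSum (g i)).nonneg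
      (coeffSum_ratio_pos ha ha' i) (coeffSum_ratio_le_one ha ha' i)

/-- The properties of the weights `levelWeight` on which the chain argument relies. -/
structure IsWeightChain (g : ℕ → B → B) (a : ℕ → ℝ) (φ : ℕ → List B → ℝ) : Prop where
  coeff_pos : 0 < a 0
  coeff_nonneg : ∀ i, 0 ≤ a i
  submul : ∀ i, IsSubmultiplicativeWeight (φ i)
  succ : ∀ i J, φ (i + 1) J = fiberSum (g i) (φ i) J ^ (coeffSum a i / coeffSum a (i + 1))

include ha ha' in
theorem isWeightChain_levelWeight (g : ℕ → B → B) {φ : List B → ℝ}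
    (hφ : IsSubmultiplicativeWeight φ) : IsWeightChain g a (levelWeight g a φ) :=
  ⟨ha, ha', levelWeight_isSubmultiplicativeWeight ha ha' g hφ, fun _ _ => rfl⟩

namespace IsWeightChain

variable {g : ℕ → B → B} {φ : ℕ → List B → ℝ} (h : IsWeightChain g a φ)
include h

theorem fiberSum_pos {i : ℕ} {w : List B} (hw : 0 < φ i w) :
    0 < fiberSum (g i) (φ i) (w.map (g i)) :=
  hw.trans_le (le_fiberSum (h.submul i).nonneg w)

theorem succ_pos {i : ℕ} {w : List B} (hw : 0 < φ i w) : 0 < φ (i + 1) (w.map (g i)) := by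
  rw [h.succ]; exact Real.rpow_pos_of_pos (h.fiberSum_pos hw) _

theorem chainFactor_pos (k : ℕ) : ∀ {i : ℕ} {w : List B}, 0 < φ i w →
    0 < chainFactor g φ k i w := by
  induction k with
  | zero => intro i w hw; exact inv_pos.2 ((h.submul i).totalWeight_pos hw)
  | succ k ih =>
    intro i w hw
    exact mul_pos (mul_pos (inv_pos.2 (h.fiberSum_pos hw)) (h.succ_pos hw)) (ih (h.succ_pos hw))

theorem chainFactor_nonneg (k : ℕ) : ∀ (i : ℕ) (w : List B), 0 ≤ chainFactor g φ k i w := by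
  induction k with
  | zero => intro i w; exact inv_nonneg.2 ((h.submul i).totalWeight_nonneg _)
  | succ k ih =>
    intro i w
    exact mul_nonneg (mul_nonneg (inv_nonneg.2 (fiberSum_nonneg (h.submul i).nonneg _))
      ((h.submul _).nonneg _)) (ih _ _)

theorem chainWeight_nonneg (k i : ℕ) (w : List B) : 0 ≤ chainWeight g φ k i w :=
  mul_nonneg ((h.submul i).nonneg w) (h.chainFactor_nonneg k i w)

theorem chainWeight_pos (k : ℕ) {i : ℕ} {w : List B} (hw : 0 < φ i w) :
    0 < chainWeight g φ k i w := mul_pos hw (h.chainFactor_pos k hw)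

omit h in
theorem chainWeight_eq_zero (k : ℕ) {i : ℕ} {w : List B} (hw : φ i w = 0) :
    chainWeight g φ k i w = 0 := by rw [chainWeight, hw, zero_mul]

/-- The correcting factor is constant on fibres and divides by the fibre sum of `φ i`, so one level
down only the chain weight of level `i + 1` remains. If the fibre sum vanishes, so does `φ (i + 1)`,
its exponent being positive. -/
theorem fiberSum_chainWeight (k i : ℕ) (J : List B) :
    fiberSum (g i) (chainWeight g φ (k + 1) i) J = chainWeight g φ k (i + 1) J := by
  have e : fiberSum (g i) (chainWeight g φ (k + 1) i) J = fiberSum (g i) (φ i) J *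
      ((fiberSum (g i) (φ i) J)⁻¹ * φ (i + 1) J * chainFactor g φ k (i + 1) J) :=
    fiberSum_mul_comp (g i) (φ i) (fun J => (fiberSum (g i) (φ i) J)⁻¹ * φ (i + 1) J *
      chainFactor g φ k (i + 1) J) J
  rw [e, chainWeight]
  by_cases h0 : fiberSum (g i) (φ i) J = 0
  · have : φ (i + 1) J = 0 := by
      rw [h.succ, h0, Real.zero_rpow (coeffSum_ratio_pos h.coeff_pos h.coeff_nonneg i).ne']
    rw [h0, this]; ring
  · field_simp

theorem totalWeight_succ_pos {i n : ℕ} (hn : 0 < totalWeight (φ i) n) :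
    0 < totalWeight (φ (i + 1)) n := by
  obtain ⟨w, hw, hpos⟩ := Finset.exists_lt_of_sum_lt (s := words B n) (f := fun _ => (0 : ℝ))
    (g := φ i) (by simpa [totalWeight] using hn)
  have := (h.submul (i + 1)).totalWeight_pos (h.succ_pos hpos)
  simpa [mem_words.1 hw] using this

theorem sum_chainWeight (k : ℕ) : ∀ (i n : ℕ), 0 < totalWeight (φ i) n →
    ∑ w ∈ words B n, chainWeight g φ k i w = 1 := by
  induction k with
  | zero =>
    intro i n hn
    have : ∀ w ∈ words B n, chainWeight g φ 0 i w = φ i w * (totalWeight (φ i) n)⁻¹ := by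
      intro w hw
      rw [chainWeight, chainFactor, mem_words.1 hw]
    rw [Finset.sum_congr rfl this, ← Finset.sum_mul]
    exact mul_inv_cancel₀ hn.ne'
  | succ k ih =>
    intro i n hn
    rw [← sum_fiberSum (g i)]
    simp_rw [h.fiberSum_chainWeight]
    exact ih (i + 1) n (h.totalWeight_succ_pos hn)

/-- Conditioned on its image, the chain weight has the same distribution on a fibre as `φ i`. This
makes the fibre term in the chain rule agree for the two weights. -/
theorem log_chainWeight_succ {k i : ℕ} {w : List B} (hw : 0 < φ i w) :
    Real.log (chainWeight g φ (k + 1) i w) - Real.log (chainWeight g φ k (i + 1) (w.map (g i))) =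
      Real.log (φ i w) - Real.log (fiberSum (g i) (φ i) (w.map (g i))) := by
  have h1 := h.fiberSum_pos hw
  have h2 := h.succ_pos hw
  have h3 := h.chainWeight_pos k h2
  have e : chainWeight g φ (k + 1) i w = φ i w * ((fiberSum (g i) (φ i) (w.map (g i)))⁻¹ *
      chainWeight g φ k (i + 1) (w.map (g i))) := by
    rw [chainWeight, chainFactor, chainWeight]; ring
  rw [e, Real.log_mul hw.ne' (mul_pos (inv_pos.2 h1) h3).ne', Real.log_mul (inv_pos.2 h1).ne' h3.ne',
    Real.log_inv]
  ring

/-- The exponent turns `A_{i+1} log φ_{i+1}` into `A_i` times the log of the fibre sum, and the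
surplus `A_{i+1} - A_i = a_{i+1}` is exactly the coefficient of the entropy at level `i + 1`. This
is why the exponents are what they are. -/
theorem coeffSum_mul_klSum_succ (i n : ℕ) (q : List B → ℝ) :
    coeffSum a (i + 1) * klSum n q (φ (i + 1)) =
      coeffSum a i * klSum n q (fiberSum (g i) (φ i)) - a (i + 1) * wordEntropy n q := by
  have hpos := coeffSum_pos h.coeff_pos h.coeff_nonneg (i + 1)
  have e : ∀ J, Real.log (φ (i + 1) J) =
      coeffSum a i / coeffSum a (i + 1) * Real.log (fiberSum (g i) (φ i) J) := by
    intro J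
    rw [h.succ]
    rcases (fiberSum_nonneg (h.submul i).nonneg (g := g i) J).eq_or_lt with h0 | h0
    · rw [← h0, Real.zero_rpow (coeffSum_ratio_pos h.coeff_pos h.coeff_nonneg i).ne']; simp
    · rw [Real.log_rpow h0]
  rw [klSum_eq, klSum_eq]
  simp_rw [e]
  have e2 : ∑ w ∈ words B n, q w * (coeffSum a i / coeffSum a (i + 1) *
      Real.log (fiberSum (g i) (φ i) w)) = coeffSum a i / coeffSum a (i + 1) *
      ∑ w ∈ words B n, q w * Real.log (fiberSum (g i) (φ i) w) := by
    rw [Finset.mul_sum]; exact Finset.sum_congr rfl fun w _ => by ring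
  rw [e2, mul_sub, ← mul_assoc, mul_div_cancel₀ _ hpos.ne', coeffSum_succ]
  ring

theorem klSum_chainWeight_nonneg (k i n : ℕ) {p : List B → ℝ} (hp : ∀ w, 0 ≤ p w)
    (hsum : ∑ w ∈ words B n, p w = 1) (hpφ : ∀ w ∈ words B n, φ i w = 0 → p w = 0) :
    0 ≤ klSum n p (chainWeight g φ k i) := by
  have hpφ' : ∀ w ∈ words B n, chainWeight g φ k i w = 0 → p w = 0 := by
    intro w hw h0
    by_contra hne
    have : 0 < φ i w := ((h.submul i).nonneg w).lt_of_ne' fun h1 => hne (hpφ w hw h1)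
    exact (h.chainWeight_pos k this).ne' h0
  refine gibbs_inequality _ _ _ (fun w _ => hp w) (fun w _ => h.chainWeight_nonneg k i w) hpφ' ?_
  rw [hsum]
  by_cases hn : 0 < totalWeight (φ i) n
  · exact (h.sum_chainWeight k i n hn).le
  · have h0 : ∀ w ∈ words B n, φ i w = 0 := by
      intro w hw
      by_contra hne
      have := (h.submul i).totalWeight_pos (((h.submul i).nonneg w).lt_of_ne' hne)
      rw [mem_words.1 hw] at this
      exact hn this
    rw [Finset.sum_congr rfl fun w hw => chainWeight_eq_zero k (h0 w hw)]
    simp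

/-- Induction on the number of levels: the chain rule splits off the fibre term, and
`coeffSum_mul_klSum_succ` absorbs one entropy and passes to the image of `p` at the next level. The
relative entropy to the chain weight is retained because uniqueness depends on it. -/
theorem chainEntropy_sub_le (n : ℕ) (k : ℕ) : ∀ (i : ℕ) (p : List B → ℝ), (∀ w, 0 ≤ p w) →
    ∑ w ∈ words B n, p w = 1 → (∀ w ∈ words B n, φ i w = 0 → p w = 0) →
    chainEntropy g a n k i p - coeffSum a i * klSum n p (φ i) ≤
      coeffSum a (i + k) * Real.log (totalWeight (φ (i + k)) n) -
        coeffSum a i * klSum n p (chainWeight g φ k i) := by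
  induction k with
  | zero =>
    intro i p hp hsum hpφ
    have e : klSum n p (chainWeight g φ 0 i) =
        klSum n p (φ i) + Real.log (totalWeight (φ i) n) := by
      rw [← mul_one (Real.log _), ← hsum, Finset.mul_sum, klSum, klSum, ← Finset.sum_add_distrib]
      refine Finset.sum_congr rfl fun w hw => ?_
      by_cases h0 : p w = 0
      · simp [h0]
      · have hpos : 0 < φ i w := ((h.submul i).nonneg w).lt_of_ne' fun h1 => h0 (hpφ w hw h1)
        have hZ := (h.submul i).totalWeight_pos hpos
        rw [chainWeight, chainFactor, Real.log_mul hpos.ne' (inv_pos.2 hZ).ne', Real.log_inv,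
          mem_words.1 hw]
        ring
    rw [e, chainEntropy, add_zero]
    linarith
  | succ k ih =>
    intro i p hp hsum hpφ
    set p₁ := fiberSum (g i) p with hp₁
    have hsupp : ∀ J ∈ words B n, φ (i + 1) J = 0 → p₁ J = 0 := by
      intro J hJ h0
      refine Finset.sum_eq_zero fun I hI => ?_
      rw [Finset.mem_filter, mem_words, mem_words.1 hJ] at hI
      by_contra hne
      have : 0 < φ i I := ((h.submul i).nonneg I).lt_of_ne' fun h1 =>
        hne (hpφ I (mem_words.2 hI.1) h1)
      have := h.succ_pos this
      rw [hI.2, h0] at this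
      exact this.false
    have hp1 : ∀ w, 0 ≤ p₁ w := fiberSum_nonneg hp
    have hsum1 : ∑ w ∈ words B n, p₁ w = 1 := by rw [hp₁, sum_fiberSum, hsum]
    have hrec := ih (i + 1) p₁ hp1 hsum1 hsupp
    have hkl := h.klSum_chainWeight_nonneg k (i + 1) n hp1 hsum1 hsupp
    have e1 := klSum_eq_add_klFiber (g i) n p (φ i)
    have e2 := h.coeffSum_mul_klSum_succ i n p₁
    have e3 : klSum n p (chainWeight g φ (k + 1) i) =
        klSum n p₁ (chainWeight g φ k (i + 1)) + klFiber (g i) n p (φ i) := by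
      rw [klSum_eq_add_klFiber (g i)]
      simp only [klFiber, h.fiberSum_chainWeight]
      congr 1
      · simp only [klSum, h.fiberSum_chainWeight, hp₁]
      refine Finset.sum_congr rfl fun w hw => ?_
      by_cases h0 : p w = 0
      · simp [h0]
      · have hpos : 0 < φ i w := ((h.submul i).nonneg w).lt_of_ne' fun h1 => h0 (hpφ w hw h1)
        have := h.log_chainWeight_succ (k := k) hpos
        congr 1
        linarith
    rw [← hp₁] at e1
    -- The recursion yields the error with coefficient `A_{i+1}`; as the error is nonnegative, it
    -- may be weakened to `A_i` and recombined with the fibre term.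
    have hle : coeffSum a i ≤ coeffSum a (i + 1) := by
      rw [coeffSum_succ]; linarith [h.coeff_nonneg (i + 1)]
    have hmul := mul_le_mul_of_nonneg_right hle hkl
    rw [chainEntropy, e3, e1, show i + (k + 1) = i + 1 + k by ring]
    simp only [← hp₁]
    linarith

/-- Equality case of the preceding bound: on fibres the chain weight is conditionally `φ i`, so the
fibre term is zero at every level. -/
theorem chainEntropy_chainWeight (n : ℕ) (k : ℕ) : ∀ (i : ℕ), 0 < totalWeight (φ i) n →
    chainEntropy g a n k i (chainWeight g φ k i) -
      coeffSum a i * klSum n (chainWeight g φ k i) (φ i) =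
      coeffSum a (i + k) * Real.log (totalWeight (φ (i + k)) n) := by
  induction k with
  | zero =>
    intro i hn
    have e : klSum n (chainWeight g φ 0 i) (φ i) = - Real.log (totalWeight (φ i) n) := by
      rw [← mul_one (Real.log _), ← h.sum_chainWeight 0 i n hn, Finset.mul_sum, klSum,
        ← Finset.sum_neg_distrib]
      refine Finset.sum_congr rfl fun w hw => ?_
      rcases ((h.submul i).nonneg w).eq_or_lt with h0 | hpos
      · simp [chainWeight_eq_zero 0 h0.symm]
      · have hZ := (h.submul i).totalWeight_pos hpos
        conv_lhs => rw [chainWeight, chainFactor, Real.log_mul hpos.ne' (inv_pos.2 hZ).ne',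
          Real.log_inv, mem_words.1 hw]
        rw [chainWeight, chainFactor, mem_words.1 hw]
        ring
    rw [e, chainEntropy, add_zero]
    ring
  | succ k ih =>
    intro i hn
    have ef : fiberSum (g i) (chainWeight g φ (k + 1) i) = chainWeight g φ k (i + 1) :=
      funext fun J => h.fiberSum_chainWeight k i J
    have hrec := ih (i + 1) (h.totalWeight_succ_pos hn)
    have e1 := klSum_eq_add_klFiber (g i) n (chainWeight g φ (k + 1) i) (φ i)
    have e2 := h.coeffSum_mul_klSum_succ i n (chainWeight g φ k (i + 1))
    have e3 : klFiber (g i) n (chainWeight g φ (k + 1) i) (φ i) = 0 := by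
      refine Finset.sum_eq_zero fun w hw => ?_
      rcases ((h.submul i).nonneg w).eq_or_lt with h0 | hpos
      · simp [chainWeight_eq_zero (k + 1) h0.symm]
      · have := h.log_chainWeight_succ (k := k) hpos
        rw [ef, show ∀ x y z t : ℝ, x - y - z + t = (x - z) - (y - t) by intros; ring, this]
        ring
    rw [ef, e3, add_zero] at e1
    rw [chainEntropy, e1, ef, show i + (k + 1) = i + 1 + k by ring]
    linarith

/-- The factor is an inverse total mass times powers `θ - 1 ≤ 0` of fibre sums. These bases are
submultiplicative up to a constant across a gap of bounded length, so the nonpositive powers reverse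
the inequality. Gluing plays no role here. -/
theorem exists_chainFactor_append_ge (T k : ℕ) : ∀ i, ∃ c : ℝ, 0 < c ∧ ∀ I K J : List B,
    K.length ≤ T → 0 < φ i (I ++ K ++ J) →
    c * (chainFactor g φ k i I * chainFactor g φ k i J) ≤ chainFactor g φ k i (I ++ K ++ J) := by
  induction k with
  | zero =>
    intro i
    obtain ⟨C, hC, hle⟩ := (h.submul i).totalWeight_length.exists_append_append_le T
    refine ⟨C⁻¹, inv_pos.2 hC, fun I K J hK hpos => ?_⟩
    simp only [chainFactor]
    rw [← mul_inv, ← mul_inv]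
    exact inv_anti₀ ((h.submul i).totalWeight_pos hpos) (hle I K J hK)
  | succ k ih =>
    intro i
    obtain ⟨c, hc, hle⟩ := ih (i + 1)
    obtain ⟨C, hC, hle'⟩ := ((h.submul i).fiberSum (g i)).exists_append_append_le T
    set θ := coeffSum a i / coeffSum a (i + 1) with hθ
    have hθ1 : θ - 1 ≤ 0 := by
      linarith [coeffSum_ratio_le_one h.coeff_pos h.coeff_nonneg i]
    have e : ∀ w, 0 < φ i w → chainFactor g φ (k + 1) i w =
        fiberSum (g i) (φ i) (w.map (g i)) ^ (θ - 1) * chainFactor g φ k (i + 1) (w.map (g i)) := by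
      intro w hw
      rw [chainFactor, h.succ, Real.rpow_sub_one (h.fiberSum_pos hw).ne', ← hθ]
      ring
    refine ⟨C ^ (θ - 1) * c, mul_pos (Real.rpow_pos_of_pos hC _) hc, fun I K J hK hpos => ?_⟩
    have hIK := (h.submul i).pos_of_append_pos hpos
    have hI := ((h.submul i).pos_of_append_pos hIK.1).1
    rw [e _ hpos, e _ hI, e _ hIK.2]
    have hpos' := h.succ_pos hpos
    have hs := h.fiberSum_pos hpos
    simp only [List.map_append] at hpos' hs ⊢
    have h1 := hle (I.map (g i)) (K.map (g i)) (J.map (g i)) (by simpa using hK) hpos'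
    have h2 := Real.rpow_le_rpow_of_nonpos hs
      (hle' (I.map (g i)) (K.map (g i)) (J.map (g i)) (by simpa using hK)) hθ1
    have hsI := h.fiberSum_pos hI
    have hsJ := h.fiberSum_pos hIK.2
    rw [Real.mul_rpow hC.le (mul_pos hsI hsJ).le, Real.mul_rpow hsI.le hsJ.le] at h2
    refine le_trans (le_of_eq ?_) (mul_le_mul h2 h1 (mul_nonneg hc.le
      (mul_nonneg (h.chainFactor_nonneg _ _ _) (h.chainFactor_nonneg _ _ _)))
      (Real.rpow_nonneg hs.le _))
    ring

/-- A connecting word that works for `φ i` also works for the chain weight, with a constant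
independent of the words. -/
theorem exists_chainWeight_append_ge (T k i : ℕ) {c₀ : ℝ} (hc₀ : 0 < c₀) :
    ∃ c : ℝ, 0 < c ∧ ∀ I K J : List B,
    K.length ≤ T → 0 < φ i (I ++ K ++ J) → c₀ * (φ i I * φ i J) ≤ φ i (I ++ K ++ J) →
    c * (chainWeight g φ k i I * chainWeight g φ k i J) ≤ chainWeight g φ k i (I ++ K ++ J) := by
  obtain ⟨c, hc, hle⟩ := h.exists_chainFactor_append_ge T k i
  refine ⟨c₀ * c, mul_pos hc₀ hc, fun I K J hK hpos hφ => ?_⟩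
  refine le_trans (le_of_eq ?_) (mul_le_mul hφ (hle I K J hK hpos) (mul_nonneg hc.le
      (mul_nonneg (h.chainFactor_nonneg _ _ _) (h.chainFactor_nonneg _ _ _))) hpos.le)
  simp only [chainWeight]
  ring

theorem chainWeight_nil (k : ℕ) : ∀ i, chainWeight g φ k i [] = 1 := by
  induction k with
  | zero =>
    intro i
    simp [chainWeight, chainFactor, (h.submul i).nil, totalWeight, words_zero]
  | succ k ih =>
    intro i
    rw [← ih (i + 1), ← h.fiberSum_chainWeight, fiberSum_nil]

end IsWeightChain

end Chain

/-! ### Quasi-multiplicative families of distributions on words -/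

section Gluing

variable {B : Type*} [Fintype B]

open scoped Classical in
/-- The mass that `ψ` gives to the words of length `n` with the property `P`. -/
noncomputable def eventWeight (ψ : List B → ℝ) (n : ℕ) (P : List B → Prop) : ℝ :=
  ∑ u ∈ words B n, if P u then ψ u else 0

/-- A family of probability distributions on the words of each length, such that two words can be
glued by means of a connecting word of length in `[p₀, p₁]`, and a word can be extended by a word
of any length `r ≤ R`, up to a loss by the factor `c`. -/
structure IsGluingFamily (ψ : List B → ℝ) (p₀ p₁ R : ℕ) (c : ℝ) : Prop where
  nonneg : ∀ w, 0 ≤ ψ w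
  sum_eq_one : ∀ n, ∑ w ∈ words B n, ψ w = 1
  const_pos : 0 < c
  glue : ∀ I J, 0 < ψ I → 0 < ψ J →
    ∃ K : List B, p₀ ≤ K.length ∧ K.length ≤ p₁ ∧ c * (ψ I * ψ J) ≤ ψ (I ++ K ++ J)
  extend : ∀ I, 0 < ψ I → ∀ r ≤ R, ∃ V : List B, V.length = r ∧ c * ψ I ≤ ψ (I ++ V)

theorem eventWeight_true {ψ : List B → ℝ} (h : ∀ n, ∑ w ∈ words B n, ψ w = 1) (n : ℕ) :
    eventWeight ψ n (fun _ => True) = 1 := by simp [eventWeight, h]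

theorem eventWeight_nonneg {ψ : List B → ℝ} (h : ∀ w, 0 ≤ ψ w) (n : ℕ) (P : List B → Prop) :
    0 ≤ eventWeight ψ n P :=
  Finset.sum_nonneg fun w _ => by split_ifs; exacts [h w, le_rfl]

theorem eventWeight_mono {ψ : List B → ℝ} (h : ∀ w, 0 ≤ ψ w) (n : ℕ) {P Q : List B → Prop}
    (hPQ : ∀ w, w.length = n → P w → Q w) : eventWeight ψ n P ≤ eventWeight ψ n Q := by
  refine Finset.sum_le_sum fun w hw => ?_
  split_ifs with h1 h2 h2
  · exact le_rfl
  · exact absurd (hPQ w (mem_words.1 hw) h1) h2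
  · exact h w
  · exact le_rfl

namespace IsGluingFamily

variable {ψ : List B → ℝ} {p₀ p₁ R : ℕ} {c : ℝ} (h : IsGluingFamily ψ p₀ p₁ R c)
include h

theorem glue_eventWeight (n m : ℕ) (P Q : List B → Prop) :
    c * (eventWeight ψ n P * eventWeight ψ m Q) ≤ ∑ t ∈ Finset.Icc p₀ p₁,
      eventWeight ψ (n + t + m) (fun u => P (u.take n) ∧ Q (u.drop (n + t))) := by
  classical
  have e : ∀ t, eventWeight ψ (n + t + m) (fun u => P (u.take n) ∧ Q (u.drop (n + t))) =
      ∑ I ∈ words B n, ∑ J ∈ words B m, ∑ K ∈ words B t,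
        if P I ∧ Q J then ψ (I ++ K ++ J) else 0 := by
    intro t
    rw [eventWeight, sum_words_add, sum_words_add]
    refine Finset.sum_congr rfl fun I hI => ?_
    rw [Finset.sum_comm]
    refine Finset.sum_congr rfl fun J hJ => Finset.sum_congr rfl fun K hK => ?_
    rw [mem_words] at hI hK
    have e1 : (I ++ K ++ J).take n = I := by rw [List.append_assoc, ← hI, List.take_left]
    have e2 : (I ++ K ++ J).drop (n + t) = J := by
      rw [← hI, ← hK, ← List.length_append, List.drop_left]
    rw [e1, e2]
    congr
  simp_rw [e]
  rw [← sum_sum_sum_comm, eventWeight, eventWeight, Finset.sum_mul_sum]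
  simp_rw [Finset.mul_sum]
  refine Finset.sum_le_sum fun I _ => Finset.sum_le_sum fun J _ => ?_
  have hnn : ∀ t ∈ Finset.Icc p₀ p₁,
      0 ≤ ∑ K ∈ words B t, if P I ∧ Q J then ψ (I ++ K ++ J) else 0 := fun t _ =>
    Finset.sum_nonneg fun K _ => by split_ifs; exacts [h.nonneg _, le_rfl]
  by_cases hPQ : P I ∧ Q J
  · rw [if_pos hPQ.1, if_pos hPQ.2]
    rcases (h.nonneg I).eq_or_lt with h0 | hI
    · rw [← h0, zero_mul, mul_zero]; exact Finset.sum_nonneg hnn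
    rcases (h.nonneg J).eq_or_lt with h0 | hJ
    · rw [← h0, mul_zero, mul_zero]; exact Finset.sum_nonneg hnn
    obtain ⟨K, hK0, hK1, hK⟩ := h.glue I J hI hJ
    refine hK.trans (le_trans ?_ (Finset.single_le_sum hnn (Finset.mem_Icc.2 ⟨hK0, hK1⟩)))
    simp only [if_pos hPQ]
    exact Finset.single_le_sum (f := fun K => ψ (I ++ K ++ J)) (fun K _ => h.nonneg _) (by simp)
  · refine le_trans (le_of_eq ?_) (Finset.sum_nonneg hnn)
    rw [not_and_or] at hPQ
    rcases hPQ with hP | hQ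
    · rw [if_neg hP, zero_mul, mul_zero]
    · rw [if_neg hQ, mul_zero, mul_zero]

theorem extend_eventWeight (n r : ℕ) (hr : r ≤ R) (P : List B → Prop) :
    c * eventWeight ψ n P ≤ eventWeight ψ (n + r) (fun u => P (u.take n)) := by
  classical
  rw [eventWeight, eventWeight, sum_words_add, Finset.mul_sum]
  refine Finset.sum_le_sum fun I hI => ?_
  rw [mem_words] at hI
  have e : ∀ V : List B, (I ++ V).take n = I := fun V => by rw [← hI, List.take_left]
  simp only [e]
  split_ifs with hP
  · rcases (h.nonneg I).eq_or_lt with h0 | hI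
    · rw [← h0, mul_zero]; exact Finset.sum_nonneg fun V _ => h.nonneg _
    · obtain ⟨V, hV, hle⟩ := h.extend I hI r hr
      exact hle.trans (Finset.single_le_sum (f := fun V => ψ (I ++ V)) (fun V _ => h.nonneg _)
        (by simpa using hV))
  · simp

/-- Two gluings around an arbitrary middle word of length `w`: the middle word carries total mass
`1`, so the gap between the events can be made as long as desired without further loss. -/
theorem pair_eventWeight (L M w : ℕ) (P Q : List B → Prop) :
    c ^ 2 * (eventWeight ψ L P * eventWeight ψ M Q) ≤
      ∑ t ∈ Finset.Icc p₀ p₁, ∑ t' ∈ Finset.Icc p₀ p₁, eventWeight ψ (L + t + w + t' + M)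
        (fun u => P (u.take L) ∧ Q (u.drop (L + t + w + t'))) := by
  have h1 := h.glue_eventWeight L w P (fun _ => True)
  rw [eventWeight_true h.sum_eq_one, mul_one] at h1
  have h2 := mul_le_mul_of_nonneg_right h1 (mul_nonneg h.const_pos.le
    (eventWeight_nonneg h.nonneg M Q))
  refine (le_of_eq (by ring)).trans (h2.trans ?_)
  rw [Finset.sum_mul]
  refine Finset.sum_le_sum fun t _ => ?_
  refine (le_of_eq (by ring)).trans ((h.glue_eventWeight (L + t + w) M _ Q).trans ?_)
  refine Finset.sum_le_sum fun t' _ => eventWeight_mono h.nonneg _ ?_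
  rintro u - ⟨⟨hu, -⟩, hu'⟩
  rw [List.take_take, min_eq_left (by omega)] at hu
  exact ⟨hu, hu'⟩

/-- Arbitrary words of lengths `j` and `v` are glued in front and behind. The connecting words have
variable lengths `t`, `t'`, so the result is extended by `2 * p₁ - t - t'` letters to reach a length
independent of them. Two gluings and one extension cost `c ^ 3`; the factor `p₁ + 1` bounds the
number of values of `t'`. -/
theorem shifted_eventWeight (hR : 2 * p₁ ≤ R) (L j v : ℕ) (P : List B → Prop) :
    c ^ 3 * eventWeight ψ L P ≤ (p₁ + 1) * ∑ t ∈ Finset.Icc p₀ p₁,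
      eventWeight ψ (j + L + v + 2 * p₁) (fun u => P ((u.drop (j + t)).take L)) := by
  have h1 := h.glue_eventWeight j L (fun _ => True) P
  rw [eventWeight_true h.sum_eq_one, one_mul] at h1
  have h2 := mul_le_mul_of_nonneg_right h1 (sq_nonneg c)
  refine (le_of_eq (by ring)).trans (h2.trans ?_)
  rw [Finset.sum_mul, Finset.mul_sum]
  refine Finset.sum_le_sum fun t ht => ?_
  have h3 := h.glue_eventWeight (j + t + L) v (fun u => True ∧ P (u.drop (j + t))) (fun _ => True)
  rw [eventWeight_true h.sum_eq_one, mul_one] at h3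
  have h4 := mul_le_mul_of_nonneg_right h3 h.const_pos.le
  simp only [true_and, and_true] at h4 ⊢
  refine (le_of_eq (by ring)).trans (h4.trans ?_)
  rw [Finset.sum_mul]
  have hcard : ((Finset.Icc p₀ p₁).card : ℝ) ≤ p₁ + 1 := by
    rw [Nat.card_Icc]
    have : p₁ + 1 - p₀ ≤ p₁ + 1 := Nat.sub_le _ _
    exact_mod_cast this
  refine le_trans (Finset.sum_le_card_nsmul _ _ (eventWeight ψ (j + L + v + 2 * p₁)
    (fun u => P ((u.drop (j + t)).take L))) ?_) ?_
  · intro t' ht'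
    rw [Finset.mem_Icc] at ht ht'
    rw [mul_comm]
    refine (h.extend_eventWeight (j + t + L + t' + v) (2 * p₁ - t - t') (by omega) _).trans ?_
    rw [show j + t + L + t' + v + (2 * p₁ - t - t') = j + L + v + 2 * p₁ by omega]
    refine eventWeight_mono h.nonneg _ fun u _ hu => ?_
    rw [List.take_take, min_eq_left (by omega), List.drop_take] at hu
    rwa [show j + t + L - (j + t) = L by omega] at hu
  · rw [nsmul_eq_mul]
    exact mul_le_mul_of_nonneg_right hcard (eventWeight_nonneg h.nonneg _ _)

end IsGluingFamily

end Gluing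

/-! ### Itineraries and block entropies -/

section Itinerary

variable {X B : Type*}

/-- The word `ζ(x) ζ(σ x) … ζ(σ^{n-1} x)`. -/
def itinerary (σ : X → X) (ζ : X → B) (n : ℕ) (x : X) : List B :=
  (List.range n).map fun j => ζ (σ^[j] x)

variable (σ : X → X) (ζ : X → B)

@[simp] theorem length_itinerary (n : ℕ) (x : X) : (itinerary σ ζ n x).length = n := by
  simp [itinerary]

theorem itinerary_add (n m : ℕ) (x : X) :
    itinerary σ ζ (n + m) x = itinerary σ ζ n x ++ itinerary σ ζ m (σ^[n] x) := by
  simp only [itinerary, List.range_add, List.map_append, List.map_map]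
  congr 1
  refine List.map_congr_left fun j _ => ?_
  simp only [Function.comp, ← Function.iterate_add_apply, Nat.add_comm]

theorem map_itinerary (g : B → B) (n : ℕ) (x : X) :
    (itinerary σ ζ n x).map g = itinerary σ (g ∘ ζ) n x := by
  simp [itinerary]

theorem take_drop_itinerary {n j L : ℕ} (h : j + L ≤ n) (x : X) :
    ((itinerary σ ζ n x).drop j).take L = itinerary σ ζ L (σ^[j] x) := by
  obtain ⟨r, rfl⟩ := Nat.exists_eq_add_of_le h
  rw [itinerary_add, itinerary_add, List.append_assoc]
  rw [List.drop_left' (length_itinerary σ ζ j x), List.take_left' (length_itinerary σ ζ L _)]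

theorem take_itinerary {n L : ℕ} (h : L ≤ n) (x : X) :
    (itinerary σ ζ n x).take L = itinerary σ ζ L x := by
  simpa using take_drop_itinerary σ ζ (j := 0) (n := n) (L := L) (by simpa using h) x

theorem drop_itinerary (n j : ℕ) (x : X) :
    (itinerary σ ζ (j + n) x).drop j = itinerary σ ζ n (σ^[j] x) := by
  rw [itinerary_add, List.drop_left' (length_itinerary σ ζ j x)]

theorem itinerary_eq_iff {n : ℕ} {x y : X} :
    itinerary σ ζ n x = itinerary σ ζ n y ↔ ∀ j < n, ζ (σ^[j] x) = ζ (σ^[j] y) := by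
  simp [itinerary]

variable {σ ζ} [TopologicalSpace X]

theorem isLocallyConstant_itinerary (hσ : Continuous σ) (hζ : IsLocallyConstant ζ) (n : ℕ) :
    IsLocallyConstant (itinerary σ ζ n) := by
  induction n with
  | zero =>
    have : itinerary σ ζ 0 = fun _ => [] := by funext x; simp [itinerary]
    rw [this]; exact IsLocallyConstant.const []
  | succ n ih =>
    have : itinerary σ ζ (n + 1) = fun x => itinerary σ ζ n x ++ [ζ (σ^[n] x)] := by
      funext x; rw [itinerary_add]; simp [itinerary]
    rw [this]
    exact ih.comp₂ (hζ.comp_continuous (hσ.iterate n)) fun u b => u ++ [b]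

theorem isClopen_itinerary (hσ : Continuous σ) (hζ : IsLocallyConstant ζ) (n : ℕ)
    (P : List B → Prop) : IsClopen {x | P (itinerary σ ζ n x)} := by
  have h := isLocallyConstant_itinerary hσ hζ n
  exact ⟨⟨h {w | ¬ P w}⟩, h {w | P w}⟩

variable [MeasurableSpace X] [BorelSpace X]

theorem measurableSet_itinerary (hσ : Continuous σ) (hζ : IsLocallyConstant ζ) (n : ℕ)
    (P : List B → Prop) : MeasurableSet {x | P (itinerary σ ζ n x)} :=
  (isClopen_itinerary hσ hζ n P).isOpen.measurableSet

/-- The distribution of the itineraries of a point chosen according to `μ`. -/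
noncomputable def itineraryDist (μ : Measure X) (σ : X → X) (ζ : X → B) (w : List B) : ℝ :=
  μ.real {x | itinerary σ ζ w.length x = w}

omit [TopologicalSpace X] [BorelSpace X] in
theorem itineraryDist_nonneg (μ : Measure X) (w : List B) : 0 ≤ itineraryDist μ σ ζ w :=
  measureReal_nonneg

variable [Fintype B]

omit [Fintype B] in
theorem sum_measureReal_itinerary (hσ : Continuous σ) (hζ : IsLocallyConstant ζ) (μ : Measure X)
    [IsFiniteMeasure μ] (n : ℕ) (s : Finset (List B)) (S : Set X) (hS : MeasurableSet S) :
    ∑ w ∈ s, μ.real (S ∩ {x | itinerary σ ζ n x = w}) =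
      μ.real (S ∩ {x | itinerary σ ζ n x ∈ s}) := by
  have : S ∩ {x | itinerary σ ζ n x ∈ s} = ⋃ w ∈ s, S ∩ {x | itinerary σ ζ n x = w} := by
    ext x; simp
  rw [this, measureReal_biUnion_finset]
  · intro u _ v _ huv
    rw [Function.onFun, Set.disjoint_left]
    rintro x ⟨-, h1⟩ ⟨-, h2⟩
    exact huv (h1.symm.trans h2)
  · exact fun w _ => hS.inter (measurableSet_itinerary hσ hζ n (· = w))

theorem sum_itineraryDist (hσ : Continuous σ) (hζ : IsLocallyConstant ζ) (μ : Measure X)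
    [IsProbabilityMeasure μ] (n : ℕ) : ∑ w ∈ words B n, itineraryDist μ σ ζ w = 1 := by
  have := sum_measureReal_itinerary hσ hζ μ n (words B n) Set.univ MeasurableSet.univ
  simp only [Set.univ_inter, mem_words, length_itinerary, Set.ofPred_true,
    probReal_univ] at this
  rw [← this]
  exact Finset.sum_congr rfl fun w hw => by rw [itineraryDist, mem_words.1 hw]

theorem fiberSum_itineraryDist [DecidableEq B] (hσ : Continuous σ) (hζ : IsLocallyConstant ζ)
    (μ : Measure X) [IsFiniteMeasure μ] (g : B → B) :
    fiberSum g (itineraryDist μ σ ζ) = itineraryDist μ σ (g ∘ ζ) := by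
  funext J
  have := sum_measureReal_itinerary hσ hζ μ J.length
    ((words B J.length).filter fun I => I.map g = J) Set.univ MeasurableSet.univ
  simp only [Set.univ_inter, Finset.mem_filter, mem_words, length_itinerary, true_and,
    map_itinerary] at this
  rw [itineraryDist, ← this]
  refine Finset.sum_congr rfl fun w hw => ?_
  rw [itineraryDist, mem_words.1 (Finset.mem_filter.1 hw).1]

theorem sum_itineraryDist_append_right (hσ : Continuous σ) (hζ : IsLocallyConstant ζ)
    (μ : Measure X) [IsFiniteMeasure μ] (u : List B) (m : ℕ) :
    ∑ v ∈ words B m, itineraryDist μ σ ζ (u ++ v) = itineraryDist μ σ ζ u := by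
  have := sum_measureReal_itinerary hσ hζ (n := u.length + m) μ
    ((words B m).map ⟨fun v => u ++ v, List.append_right_injective u⟩) Set.univ MeasurableSet.univ
  simp only [Set.univ_inter, Finset.sum_map, Function.Embedding.coeFn_mk, Finset.mem_map,
    mem_words] at this
  rw [itineraryDist]
  trans μ.real {x | ∃ v : List B, v.length = m ∧ u ++ v = itinerary σ ζ (u.length + m) x}
  · rw [← this]
    refine Finset.sum_congr rfl fun v hv => ?_
    rw [itineraryDist, List.length_append, mem_words.1 hv]
  · congr 1
    ext x
    simp only [Set.mem_ofPred_eq, itinerary_add]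
    constructor
    · rintro ⟨v, hv, h⟩
      exact (List.append_inj_left h (by simp)).symm
    · intro h
      exact ⟨itinerary σ ζ m (σ^[u.length] x), by simp, by rw [h]⟩

theorem sum_itineraryDist_append_left (hσ : Continuous σ) (hζ : IsLocallyConstant ζ)
    (μ : Measure X) [IsFiniteMeasure μ] (n : ℕ) (v : List B) :
    ∑ u ∈ words B n, itineraryDist μ σ ζ (u ++ v) = itineraryDist (μ.map σ^[n]) σ ζ v := by
  have := sum_measureReal_itinerary hσ hζ (n := n + v.length) μ
    ((words B n).map ⟨fun u => u ++ v, List.append_left_injective v⟩) Set.univ MeasurableSet.univ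
  simp only [Set.univ_inter, Finset.sum_map, Function.Embedding.coeFn_mk, Finset.mem_map,
    mem_words] at this
  rw [itineraryDist, map_measureReal_apply (hσ.iterate n).measurable
    (measurableSet_itinerary hσ hζ _ (· = v))]
  trans μ.real {x | ∃ u : List B, u.length = n ∧ u ++ v = itinerary σ ζ (n + v.length) x}
  · rw [← this]
    refine Finset.sum_congr rfl fun u hu => ?_
    rw [itineraryDist, List.length_append, mem_words.1 hu]
  · congr 1
    ext x
    simp only [Set.mem_ofPred_eq, itinerary_add, Set.mem_preimage]
    constructor
    · rintro ⟨u, hu, h⟩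
      exact (List.append_inj_right h (by simpa using hu)).symm
    · intro h
      exact ⟨itinerary σ ζ n x, by simp, by rw [h]⟩

/-- The entropy of the partition into the cylinders of length `n`. -/
noncomputable def blockEntropy (μ : Measure X) (σ : X → X) (ζ : X → B) (n : ℕ) : ℝ :=
  wordEntropy n (itineraryDist μ σ ζ)

theorem isProbabilityMeasure_map_iterate (hσ : Continuous σ) (μ : Measure X)
    [IsProbabilityMeasure μ] (n : ℕ) : IsProbabilityMeasure (μ.map σ^[n]) :=
  Measure.isProbabilityMeasure_map (hσ.iterate n).measurable.aemeasurable

theorem blockEntropy_add_le (hσ : Continuous σ) (hζ : IsLocallyConstant ζ) (μ : Measure X)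
    [IsProbabilityMeasure μ] (n m : ℕ) :
    blockEntropy μ σ ζ (n + m) ≤ blockEntropy μ σ ζ n + blockEntropy (μ.map σ^[n]) σ ζ m :=
  wordEntropy_append_le n m _ _ _ (fun w _ => itineraryDist_nonneg μ w)
    (sum_itineraryDist hσ hζ μ _)
    (fun u _ => (sum_itineraryDist_append_right hσ hζ μ u m).symm)
    (fun v _ => (sum_itineraryDist_append_left hσ hζ μ n v).symm)

theorem blockEntropy_le_add (hσ : Continuous σ) (hζ : IsLocallyConstant ζ) (μ : Measure X)
    [IsProbabilityMeasure μ] (n m : ℕ) :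
    blockEntropy μ σ ζ n ≤ blockEntropy μ σ ζ (n + m) := by
  rw [blockEntropy, blockEntropy, wordEntropy, wordEntropy, sum_words_add]
  refine Finset.sum_le_sum fun u _ => ?_
  have hsum := sum_itineraryDist_append_right hσ hζ μ u m
  rw [Real.negMulLog, ← hsum, neg_mul, Finset.sum_mul, ← Finset.sum_neg_distrib]
  refine Finset.sum_le_sum fun v hv => ?_
  rw [Real.negMulLog, neg_mul, neg_le_neg_iff]
  have h0 : 0 ≤ itineraryDist μ σ ζ (u ++ v) := itineraryDist_nonneg μ _
  rcases h0.eq_or_lt with h | h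
  · rw [← h]; simp
  · exact mul_le_mul_of_nonneg_left (Real.log_le_log h
      (Finset.single_le_sum (f := fun v => itineraryDist μ σ ζ (u ++ v))
        (fun v _ => itineraryDist_nonneg μ _) hv)) h0

theorem blockEntropy_le [Nonempty B] (hσ : Continuous σ) (hζ : IsLocallyConstant ζ)
    (μ : Measure X) [IsProbabilityMeasure μ] (n : ℕ) :
    blockEntropy μ σ ζ n ≤ n * Real.log (Fintype.card B) :=
  wordEntropy_le n _ (fun w _ => itineraryDist_nonneg μ w) (sum_itineraryDist hσ hζ μ n)

omit [TopologicalSpace X] [BorelSpace X] in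
theorem blockEntropy_nonneg (μ : Measure X) [IsProbabilityMeasure μ] (n : ℕ) :
    0 ≤ blockEntropy μ σ ζ n :=
  wordEntropy_nonneg n _ (fun w _ => itineraryDist_nonneg μ w) fun _ _ => measureReal_le_one

/-- The sum of the entropies of `M`-blocks along an orbit segment dominates, up to a constant,
`M` times the entropy of the whole segment. -/
theorem mul_blockEntropy_le [Nonempty B] (hσ : Continuous σ) (hζ : IsLocallyConstant ζ)
    (μ : Measure X) [IsProbabilityMeasure μ] (M n : ℕ) :
    M * blockEntropy μ σ ζ n ≤ ∑ b ∈ Finset.range n, blockEntropy (μ.map σ^[b]) σ ζ M +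
      2 * M ^ 2 * Real.log (Fintype.card B) := by
  set C := Real.log (Fintype.card B) with hC
  have hC0 : 0 ≤ C := Real.log_natCast_nonneg _
  let H : ℕ → ℕ → ℝ := fun n b => blockEntropy (μ.map σ^[b]) σ ζ n
  have hP : ∀ b, IsProbabilityMeasure (μ.map σ^[b]) := isProbabilityMeasure_map_iterate hσ μ
  have hadd : ∀ n m b, H (n + m) b ≤ H n b + H m (b + n) := by
    intro n m b
    have := blockEntropy_add_le hσ hζ (μ.map σ^[b]) n m
    rw [Measure.map_map (hσ.iterate n).measurable (hσ.iterate b).measurable,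
      ← Function.iterate_add, add_comm n b] at this
    exact this
  have hle : ∀ n b, H n b ≤ n * C := fun n b => blockEntropy_le hσ hζ (μ.map σ^[b]) n
  have hmono : ∀ n m b, H n b ≤ H (n + m) b := fun n m b =>
    blockEntropy_le_add hσ hζ (μ.map σ^[b]) n m
  -- All `M` starting phases are treated together: cutting one `M`-block off the front of each uses
  -- every position of a stretch of length `M` once, and the remaining windows start `M` further on.
  have hsum_le : ∀ n b, ∑ k ∈ Finset.range M, H n (b + k) ≤
      ∑ j ∈ Finset.range n, H M (b + j) + M ^ 2 * C := by
    intro n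
    induction n using Nat.strong_induction_on with
    | _ n ih =>
      intro b
      have hnn : 0 ≤ ∑ j ∈ Finset.range n, H M (b + j) :=
        Finset.sum_nonneg fun j _ => blockEntropy_nonneg _ _
      rcases Nat.eq_zero_or_pos M with hM | hM
      · subst hM; simpa using hnn
      rcases lt_or_ge n M with hn | hn
      · have h1 : ∑ k ∈ Finset.range M, H n (b + k) ≤ ∑ k ∈ Finset.range M, (M * C : ℝ) :=
          Finset.sum_le_sum fun k _ => (hle n _).trans
            (mul_le_mul_of_nonneg_right (by exact_mod_cast hn.le) hC0)
        rw [Finset.sum_const, Finset.card_range, nsmul_eq_mul] at h1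
        nlinarith
      · obtain ⟨r, rfl⟩ := Nat.exists_eq_add_of_le hn
        have h1 := ih r (by omega) (b + M)
        have h2 : ∑ k ∈ Finset.range M, H (M + r) (b + k) ≤
            ∑ k ∈ Finset.range M, (H M (b + k) + H r (b + M + k)) :=
          Finset.sum_le_sum fun k _ => by
            have := hadd M r (b + k)
            rwa [show b + k + M = b + M + k by ring] at this
        rw [Finset.sum_add_distrib] at h2
        rw [Finset.sum_range_add]
        simp only [← add_assoc]
        linarith
  -- Changing the phase by `k < M` costs at most the entropy of `k` letters.
  have h1 : ∀ k ∈ Finset.range M, H n 0 ≤ M * C + H n k := by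
    intro k hk
    have h2 := hmono n k 0
    rw [add_comm n k] at h2
    have h3 := hadd k n 0
    rw [zero_add] at h3
    have h4 : (k : ℝ) * C ≤ M * C :=
      mul_le_mul_of_nonneg_right (by exact_mod_cast (Finset.mem_range.1 hk).le) hC0
    linarith [hle k 0]
  have h2 := Finset.sum_le_sum h1
  have h3 := hsum_le n 0
  simp only [zero_add] at h3
  rw [Finset.sum_add_distrib, Finset.sum_const, Finset.sum_const, Finset.card_range,
    nsmul_eq_mul, nsmul_eq_mul] at h2
  have h4 : H n 0 = blockEntropy μ σ ζ n := by simp [H]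
  rw [h4] at h2
  nlinarith

theorem subadditive_blockEntropy (hσ : Continuous σ) (hζ : IsLocallyConstant ζ) {μ : Measure X}
    [IsProbabilityMeasure μ] (hμ : MeasurePreserving σ μ μ) :
    Subadditive (blockEntropy μ σ ζ) := by
  intro n m
  have := blockEntropy_add_le hσ hζ μ n m
  rwa [(hμ.iterate n).map_eq] at this

/-- The entropy of an invariant measure with respect to the partition given by `ζ`. -/
noncomputable def entropyRate (μ : Measure X) (σ : X → X) (ζ : X → B) : ℝ :=
  limUnder atTop (fun n : ℕ => blockEntropy μ σ ζ n / (n : ℝ))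

/-- Fekete's lemma; the limit is also the infimum, which gives the inequality at each finite `n`. -/
theorem entropyRate_eq_lim (hσ : Continuous σ) (hζ : IsLocallyConstant ζ) {μ : Measure X}
    [IsProbabilityMeasure μ] (hμ : MeasurePreserving σ μ μ) :
    Tendsto (fun n : ℕ => blockEntropy μ σ ζ n / (n : ℝ)) atTop (nhds (entropyRate μ σ ζ)) ∧
      ∀ n : ℕ, n * entropyRate μ σ ζ ≤ blockEntropy μ σ ζ n := by
  have hsub := subadditive_blockEntropy hσ hζ hμ
  have hbdd : BddBelow (Set.range fun n : ℕ => blockEntropy μ σ ζ n / (n : ℝ)) :=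
    ⟨0, by rintro _ ⟨n, rfl⟩; exact div_nonneg (blockEntropy_nonneg μ n) (Nat.cast_nonneg n)⟩
  have ht := hsub.tendsto_lim hbdd
  have e : entropyRate μ σ ζ = hsub.lim := ht.limUnder_eq
  refine ⟨e ▸ ht, fun n => ?_⟩
  rcases Nat.eq_zero_or_pos n with rfl | hn
  · simpa using blockEntropy_nonneg (σ := σ) (ζ := ζ) μ 0
  · have := hsub.lim_le_div hbdd hn.ne'
    rw [e]
    rwa [le_div_iff₀ (by exact_mod_cast hn), mul_comm] at this

end Itinerary

/-! ### The weight on words given by a potential -/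

section Potential

variable {X B : Type*} [TopologicalSpace X] [CompactSpace X]

/-- Bounded variation of ergodic sums on the cylinders of `ζ`. -/
def HasBoundedVariation (σ : X → X) (ζ : X → B) (f : X → ℝ) (C : ℝ) : Prop :=
  ∀ n x y, itinerary σ ζ n x = itinerary σ ζ n y →
    |birkhoffSum σ f n x - birkhoffSum σ f n y| ≤ C

/-- Specification with connecting words of length in `[p₀, p₁]`, expressed by orbits. -/
def HasSpecification (σ : X → X) (ζ : X → B) (p₀ p₁ : ℕ) : Prop :=
  ∀ n m x y, ∃ z t, p₀ ≤ t ∧ t ≤ p₁ ∧ itinerary σ ζ n z = itinerary σ ζ n x ∧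
    itinerary σ ζ m (σ^[n + t] z) = itinerary σ ζ m y

/-- The weight `w ↦ sup_{[w]} exp (S_n f / a)`. -/
noncomputable def expWeight (σ : X → X) (ζ : X → B) (f : X → ℝ) (a : ℝ) (w : List B) : ℝ :=
  ⨆ x : {x // itinerary σ ζ w.length x = w}, Real.exp (birkhoffSum σ f w.length x / a)

variable {σ : X → X} {ζ : X → B} (f : C(X, ℝ)) {a : ℝ}

theorem abs_birkhoffSum_le (n : ℕ) (x : X) : |birkhoffSum σ f n x| ≤ n * ‖f‖ := by
  rw [birkhoffSum]
  refine (Finset.abs_sum_le_sum_abs _ _).trans ?_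
  refine (Finset.sum_le_card_nsmul _ _ ‖f‖ fun k _ => f.norm_coe_le_norm _).trans ?_
  simp

omit [CompactSpace X] in
theorem expWeight_nonneg (w : List B) : 0 ≤ expWeight σ ζ f a w :=
  Real.iSup_nonneg fun _ => (Real.exp_pos _).le

theorem le_expWeight (ha : 0 < a) (n : ℕ) (x : X) :
    Real.exp (birkhoffSum σ f n x / a) ≤ expWeight σ ζ f a (itinerary σ ζ n x) := by
  have hn := length_itinerary σ ζ n x
  have hb : BddAbove (Set.range fun y : {y // itinerary σ ζ (itinerary σ ζ n x).length y =
      itinerary σ ζ n x} => Real.exp (birkhoffSum σ f (itinerary σ ζ n x).length y / a)) := by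
    refine ⟨Real.exp (n * ‖f‖ / a), ?_⟩
    rintro _ ⟨y, rfl⟩
    simp only [hn]
    exact Real.exp_le_exp.2 (div_le_div_of_nonneg_right
      ((le_abs_self _).trans (abs_birkhoffSum_le f n y.1)) ha.le)
  have := le_ciSup hb ⟨x, by rw [hn]⟩
  refine le_trans (le_of_eq ?_) this
  simp only [hn]

omit [CompactSpace X] in
theorem expWeight_le (ha : 0 < a) {C : ℝ} (hf : HasBoundedVariation σ ζ f C) (n : ℕ) (x : X) :
    expWeight σ ζ f a (itinerary σ ζ n x) ≤
      Real.exp (C / a) * Real.exp (birkhoffSum σ f n x / a) := by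
  refine Real.iSup_le ?_ (mul_pos (Real.exp_pos _) (Real.exp_pos _)).le
  rintro ⟨y, hy⟩
  simp only [length_itinerary] at hy ⊢
  rw [← Real.exp_add, ← add_div]
  refine Real.exp_le_exp.2 (div_le_div_of_nonneg_right ?_ ha.le)
  linarith [le_of_abs_le (hf n y x hy)]

theorem expWeight_pos (ha : 0 < a) (n : ℕ) (x : X) :
    0 < expWeight σ ζ f a (itinerary σ ζ n x) :=
  (Real.exp_pos _).trans_le (le_expWeight f ha n x)

omit [CompactSpace X] in
theorem exists_itinerary_eq_of_expWeight_ne_zero {w : List B} (hw : expWeight σ ζ f a w ≠ 0) :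
    ∃ x, itinerary σ ζ w.length x = w := by
  by_contra! h
  have : IsEmpty {x // itinerary σ ζ w.length x = w} := ⟨fun x => h x.1 x.2⟩
  exact hw (Real.iSup_of_isEmpty _)

theorem isSubmultiplicativeWeight_expWeight [Nonempty X] (ha : 0 < a) :
    IsSubmultiplicativeWeight (expWeight σ ζ f a) where
  nonneg := expWeight_nonneg f
  nil := by
    -- A supremum over an empty type would be `0`, so nonemptiness of `X` is what makes the empty
    -- word have weight `1`.
    have : Nonempty {x : X // itinerary σ ζ ([] : List B).length x = []} :=
      ‹Nonempty X›.map fun x => ⟨x, by simp [itinerary]⟩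
    simp [expWeight]
  append_le I J := by
    refine Real.iSup_le ?_ (mul_nonneg (expWeight_nonneg f I) (expWeight_nonneg f J))
    rintro ⟨x, hx⟩
    rw [List.length_append, itinerary_add] at hx
    have h1 : itinerary σ ζ I.length x = I := List.append_inj_left hx (by simp)
    have h2 : itinerary σ ζ J.length (σ^[I.length] x) = J := List.append_inj_right hx (by simp)
    simp only [List.length_append]
    rw [birkhoffSum_add, add_div, Real.exp_add]
    have e1 := le_expWeight (σ := σ) (ζ := ζ) f ha I.length x
    have e2 := le_expWeight (σ := σ) (ζ := ζ) f ha J.length (σ^[I.length] x)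
    rw [h1] at e1
    rw [h2] at e2
    exact mul_le_mul e1 e2 (Real.exp_pos _).le (expWeight_nonneg f I)

/-- In the exponent, bounded variation costs `C` for each of the two outer blocks, and the ergodic
sum over the gap is at least `-R * ‖f‖`. -/
theorem expWeight_append_ge (ha : 0 < a) {C : ℝ} (hf : HasBoundedVariation σ ζ f C) {R n t m : ℕ}
    (ht : t ≤ R) (z : X) :
    Real.exp (-(2 * C + R * ‖f‖) / a) * (expWeight σ ζ f a (itinerary σ ζ n z) *
      expWeight σ ζ f a (itinerary σ ζ m (σ^[n + t] z))) ≤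
      expWeight σ ζ f a (itinerary σ ζ (n + t + m) z) := by
  have h1 := expWeight_le f ha hf n z
  have h2 := expWeight_le f ha hf m (σ^[n + t] z)
  refine le_trans ?_ (le_expWeight f ha (n + t + m) z)
  refine (mul_le_mul_of_nonneg_left (mul_le_mul h1 h2 (expWeight_nonneg f _)
    (mul_pos (Real.exp_pos _) (Real.exp_pos _)).le) (Real.exp_pos _).le).trans ?_
  simp only [← Real.exp_add, ← add_div]
  refine Real.exp_le_exp.2 (div_le_div_of_nonneg_right ?_ ha.le)
  rw [birkhoffSum_add, birkhoffSum_add]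
  have h3 := neg_le_of_abs_le (abs_birkhoffSum_le (σ := σ) f t (σ^[n] z))
  have h4 : (t : ℝ) * ‖f‖ ≤ R * ‖f‖ :=
    mul_le_mul_of_nonneg_right (by exact_mod_cast ht) (norm_nonneg f)
  linarith

theorem exists_gluing_expWeight (ha : 0 < a) {C : ℝ} (hf : HasBoundedVariation σ ζ f C)
    {p₀ p₁ : ℕ} (hs : HasSpecification σ ζ p₀ p₁) {R : ℕ} (hR : p₁ ≤ R) {I J : List B}
    (hI : 0 < expWeight σ ζ f a I) (hJ : 0 < expWeight σ ζ f a J) :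
    ∃ K : List B, p₀ ≤ K.length ∧ K.length ≤ p₁ ∧ 0 < expWeight σ ζ f a (I ++ K ++ J) ∧
      Real.exp (-(2 * C + R * ‖f‖) / a) * (expWeight σ ζ f a I * expWeight σ ζ f a J) ≤
        expWeight σ ζ f a (I ++ K ++ J) := by
  obtain ⟨x, hx⟩ := exists_itinerary_eq_of_expWeight_ne_zero f hI.ne'
  obtain ⟨y, hy⟩ := exists_itinerary_eq_of_expWeight_ne_zero f hJ.ne'
  obtain ⟨z, t, ht0, ht1, hz1, hz2⟩ := hs I.length J.length x y
  have e := expWeight_append_ge f ha hf (n := I.length) (m := J.length) (ht1.trans hR) z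
  have e' := expWeight_pos (σ := σ) (ζ := ζ) f ha (I.length + t + J.length) z
  rw [itinerary_add, itinerary_add, hz1, hz2, hx, hy] at e e'
  exact ⟨itinerary σ ζ t (σ^[I.length] z), by simpa using ht0, by simpa using ht1, e', e⟩

/-- An extension is phrased as a gluing with the empty word, so that `exists_chainWeight_append_ge`
covers it too. -/
theorem exists_extension_expWeight [Nonempty X] (ha : 0 < a) {C : ℝ}
    (hf : HasBoundedVariation σ ζ f C) {R r : ℕ} (hr : r ≤ R) {I : List B}
    (hI : 0 < expWeight σ ζ f a I) :
    ∃ V : List B, V.length = r ∧ 0 < expWeight σ ζ f a (I ++ V ++ []) ∧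
      Real.exp (-(2 * C + R * ‖f‖) / a) * (expWeight σ ζ f a I * expWeight σ ζ f a []) ≤
        expWeight σ ζ f a (I ++ V ++ []) := by
  obtain ⟨x, hx⟩ := exists_itinerary_eq_of_expWeight_ne_zero f hI.ne'
  have e := expWeight_append_ge f ha hf (n := I.length) (m := 0) hr x
  have e' := expWeight_pos (σ := σ) (ζ := ζ) f ha (I.length + r + 0) x
  have e0 : itinerary σ ζ 0 (σ^[I.length + r] x) = [] := by simp [itinerary]
  rw [itinerary_add, itinerary_add, hx, e0] at e e'
  exact ⟨itinerary σ ζ r (σ^[I.length] x), by simp, e', e⟩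

variable [Fintype B]

theorem hasGluing_expWeight (ha : 0 < a) {C : ℝ} (hf : HasBoundedVariation σ ζ f C)
    {p₀ p₁ : ℕ} (hs : HasSpecification σ ζ p₀ p₁) : HasGluing (expWeight σ ζ f a) p₁ := by
  refine ⟨Real.exp (-(2 * C + p₁ * ‖f‖) / a), Real.exp_pos _, fun I J => ?_⟩
  have hnn : ∀ t ∈ Finset.range (p₁ + 1), 0 ≤ ∑ K ∈ words B t, expWeight σ ζ f a (I ++ K ++ J) :=
    fun t _ => Finset.sum_nonneg fun K _ => expWeight_nonneg f _
  rcases (expWeight_nonneg (σ := σ) (ζ := ζ) (a := a) f I).eq_or_lt with h0 | hI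
  · rw [← h0, zero_mul, mul_zero]; exact Finset.sum_nonneg hnn
  rcases (expWeight_nonneg (σ := σ) (ζ := ζ) (a := a) f J).eq_or_lt with h0 | hJ
  · rw [← h0, mul_zero, mul_zero]; exact Finset.sum_nonneg hnn
  obtain ⟨K, -, hK, -, hle⟩ := exists_gluing_expWeight f ha hf hs le_rfl hI hJ
  refine hle.trans (le_trans ?_ (Finset.single_le_sum hnn
    (show K.length ∈ Finset.range (p₁ + 1) by simp; omega)))
  exact Finset.single_le_sum (f := fun K => expWeight σ ζ f a (I ++ K ++ J))
    (fun K _ => expWeight_nonneg f _) (by simp)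

variable [DecidableEq B]

/-- The extension bound `2 * p₁` is the amount of padding that `shifted_eventWeight` requires. -/
theorem exists_isGluingFamily [Nonempty X] {a : ℕ → ℝ} (ha : 0 < a 0) (ha' : ∀ i, 0 ≤ a i)
    (g : ℕ → B → B) (m : ℕ) {C : ℝ} (hf : HasBoundedVariation σ ζ f C)
    {p₀ p₁ : ℕ} (hs : HasSpecification σ ζ p₀ p₁) :
    ∃ c, IsGluingFamily (chainWeight g (levelWeight g a (expWeight σ ζ f (a 0))) m 0)
      p₀ p₁ (2 * p₁) c := by
  have hchain := isWeightChain_levelWeight ha ha' g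
    (isSubmultiplicativeWeight_expWeight (σ := σ) (ζ := ζ) f ha)
  obtain ⟨c, hc, hle⟩ := hchain.exists_chainWeight_append_ge (2 * p₁) m 0
    (Real.exp_pos (-(2 * C + (2 * p₁ : ℕ) * ‖f‖) / a 0))
  have hpos : ∀ I, 0 < chainWeight g (levelWeight g a (expWeight σ ζ f (a 0))) m 0 I →
      0 < expWeight σ ζ f (a 0) I := fun I hI =>
    (expWeight_nonneg f I).lt_of_ne' fun h0 => hI.ne' (IsWeightChain.chainWeight_eq_zero m h0)
  refine ⟨c, hchain.chainWeight_nonneg m 0, fun n => hchain.sum_chainWeight m 0 n ?_, hc, ?_, ?_⟩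
  · obtain ⟨x⟩ := ‹Nonempty X›
    simpa using (hchain.submul 0).totalWeight_pos (expWeight_pos (σ := σ) (ζ := ζ) f ha n x)
  · intro I J hI hJ
    obtain ⟨K, hK0, hK1, hp, hK⟩ := exists_gluing_expWeight f ha hf hs
      (show p₁ ≤ 2 * p₁ by omega) (hpos I hI) (hpos J hJ)
    exact ⟨K, hK0, hK1, hle I K J (by omega) hp hK⟩
  · intro I hI r hr
    obtain ⟨V, hV, hp, hle'⟩ := exists_extension_expWeight f ha hf hr (hpos I hI)
    refine ⟨V, hV, ?_⟩
    have := hle I V [] (by omega) hp hle'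
    rwa [hchain.chainWeight_nil, mul_one, List.append_nil] at this

end Potential

/-! ### Orbit averages of measures and their limits -/

section OrbitAverage

variable {X B : Type*} [TopologicalSpace X] [MeasurableSpace X] [BorelSpace X]

/-- The average of the first `n` images of `ν` under `σ`. -/
noncomputable def orbitAverage (σ : X → X) (ν : Measure X) (n : ℕ) : Measure X :=
  (n : ℝ≥0∞)⁻¹ • ∑ j ∈ Finset.range n, ν.map σ^[j]

variable {σ : X → X} (hσ : Continuous σ) (ν : Measure X) [IsProbabilityMeasure ν]
include hσ

theorem isProbabilityMeasure_orbitAverage {n : ℕ} (hn : n ≠ 0) :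
    IsProbabilityMeasure (orbitAverage σ ν n) := by
  constructor
  have : ∀ j ∈ Finset.range n, ν.map σ^[j] Set.univ = 1 := fun j _ =>
    (isProbabilityMeasure_map_iterate hσ ν j).measure_univ
  rw [orbitAverage, Measure.smul_apply, Measure.finsetSum_apply, Finset.sum_congr rfl this]
  simp only [Finset.sum_const, Finset.card_range, nsmul_eq_mul, mul_one, smul_eq_mul]
  exact ENNReal.inv_mul_cancel (by exact_mod_cast hn) (ENNReal.natCast_ne_top n)

theorem mul_measureReal_orbitAverage (n : ℕ) {S : Set X} (hS : MeasurableSet S) :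
    n * (orbitAverage σ ν n).real S = ∑ j ∈ Finset.range n, ν.real (σ^[j] ⁻¹' S) := by
  rcases Nat.eq_zero_or_pos n with rfl | hn
  · simp
  have h1 : ∀ j ∈ Finset.range n, ν.map σ^[j] S = ν (σ^[j] ⁻¹' S) := fun j _ =>
    Measure.map_apply (hσ.iterate j).measurable hS
  rw [measureReal_def, orbitAverage, Measure.smul_apply, Measure.finsetSum_apply,
    Finset.sum_congr rfl h1, smul_eq_mul, ENNReal.toReal_mul, ENNReal.toReal_inv,
    ENNReal.toReal_natCast, ENNReal.toReal_sum (fun j _ => measure_ne_top ν _), ← mul_assoc,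
    mul_inv_cancel₀ (by exact_mod_cast hn.ne'), one_mul]
  rfl

theorem mul_integral_orbitAverage [CompactSpace X] (n : ℕ) (f : C(X, ℝ)) :
    n * ∫ x, f x ∂(orbitAverage σ ν n) = ∫ x, birkhoffSum σ f n x ∂ν := by
  rcases Nat.eq_zero_or_pos n with rfl | hn
  · simp [birkhoffSum]
  have hint : ∀ (κ : Measure X) [IsFiniteMeasure κ] (h : X → ℝ), Continuous h → Integrable h κ :=
    fun κ _ h hh => hh.integrable_of_hasCompactSupport (HasCompactSupport.of_compactSpace h)
  have hP := isProbabilityMeasure_map_iterate hσ ν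
  rw [orbitAverage, integral_smul_measure, integral_finsetSum_measure
    (fun j _ => hint _ _ f.continuous)]
  simp only [birkhoffSum]
  rw [integral_finsetSum (f := fun j x => f (σ^[j] x)) _
    (fun j _ => hint ν _ (f.continuous.comp (hσ.iterate j)))]
  rw [ENNReal.toReal_inv, ENNReal.toReal_natCast, smul_eq_mul, ← mul_assoc,
    mul_inv_cancel₀ (by exact_mod_cast hn.ne'), one_mul]
  refine Finset.sum_congr rfl fun j _ => ?_
  exact integral_map (hσ.iterate j).measurable.aemeasurable
    f.continuous.aestronglyMeasurable

theorem abs_measureReal_preimage_orbitAverage_sub_le {n : ℕ} (hn : 0 < n) {S : Set X}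
    (hS : MeasurableSet S) :
    |(orbitAverage σ ν n).real (σ ⁻¹' S) - (orbitAverage σ ν n).real S| ≤ 1 / n := by
  have h1 := mul_measureReal_orbitAverage hσ ν n hS
  have h2 := mul_measureReal_orbitAverage hσ ν n (hσ.measurable hS)
  have h3 : ∀ j, σ^[j] ⁻¹' (σ ⁻¹' S) = σ^[j + 1] ⁻¹' S := fun j => by
    rw [Function.iterate_succ', Set.preimage_comp]
  simp only [h3] at h2
  have h4 := Finset.sum_range_succ' (fun j => ν.real (σ^[j] ⁻¹' S)) n
  rw [Finset.sum_range_succ] at h4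
  have hn' : (0 : ℝ) < n := by exact_mod_cast hn
  have b1 : ν.real (σ^[n] ⁻¹' S) ≤ 1 := measureReal_le_one
  have b2 : 0 ≤ ν.real (σ^[n] ⁻¹' S) := measureReal_nonneg
  have b3 : ν.real (σ^[0] ⁻¹' S) ≤ 1 := measureReal_le_one
  have b4 : 0 ≤ ν.real (σ^[0] ⁻¹' S) := measureReal_nonneg
  rw [abs_le, ← neg_div, div_le_iff₀ hn',
    le_div_iff₀ hn']
  constructor <;> linarith

variable [Fintype B] {ζ : X → B} (hζ : IsLocallyConstant ζ)
include hζ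

/-- Jensen's inequality for the concave function `-x log x`, cylinder by cylinder. -/
theorem sum_blockEntropy_le_orbitAverage {n : ℕ} (hn : 0 < n) (M : ℕ) :
    ∑ j ∈ Finset.range n, blockEntropy (ν.map σ^[j]) σ ζ M ≤
      n * blockEntropy (orbitAverage σ ν n) σ ζ M := by
  have hn' : (0 : ℝ) < n := by exact_mod_cast hn
  have hP := isProbabilityMeasure_map_iterate hσ ν
  simp only [blockEntropy, wordEntropy]
  rw [Finset.sum_comm, Finset.mul_sum]
  refine Finset.sum_le_sum fun w _ => ?_
  have hS := measurableSet_itinerary hσ hζ w.length (· = w)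
  have key := Real.concaveOn_negMulLog.le_map_sum (t := Finset.range n) (w := fun _ => (n : ℝ)⁻¹)
    (p := fun j => itineraryDist (ν.map σ^[j]) σ ζ w) (fun _ _ => by positivity)
    (by simp [hn'.ne']) (fun j _ => itineraryDist_nonneg _ _)
  have e : ∑ j ∈ Finset.range n, (n : ℝ)⁻¹ • itineraryDist (ν.map σ^[j]) σ ζ w =
      itineraryDist (orbitAverage σ ν n) σ ζ w := by
    simp only [smul_eq_mul]
    rw [← Finset.mul_sum, inv_mul_eq_iff_eq_mul₀ hn'.ne', itineraryDist,
      mul_measureReal_orbitAverage hσ ν n hS]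
    exact Finset.sum_congr rfl fun j _ =>
      map_measureReal_apply (hσ.iterate j).measurable hS
  rw [e] at key
  simp only [smul_eq_mul] at key
  rw [← Finset.mul_sum, inv_mul_le_iff₀ hn'] at key
  exact key

theorem mul_blockEntropy_le_orbitAverage [Nonempty B] {n : ℕ} (hn : 0 < n) (M : ℕ) :
    M * blockEntropy ν σ ζ n ≤ n * blockEntropy (orbitAverage σ ν n) σ ζ M +
      2 * M ^ 2 * Real.log (Fintype.card B) := by
  have h1 := mul_blockEntropy_le hσ hζ ν M n
  have h2 := sum_blockEntropy_le_orbitAverage hσ ν hζ hn M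
  linarith

end OrbitAverage

section Limit

variable {X : Type*} [TopologicalSpace X] [CompactSpace X] [T2Space X] [MeasurableSpace X]
  [BorelSpace X]

/-- The probability measures on a compact Hausdorff space are weakly compact, and a limit along an
ultrafilter avoids passing to subsequences. Indicators of clopen sets are continuous, whence
convergence on them. -/
theorem exists_ultrafilter_tendsto_measure (P : ℕ → Measure X)
    (hP : ∀ n, IsProbabilityMeasure (P n)) :
    ∃ U : Ultrafilter ℕ, (U : Filter ℕ) ≤ atTop ∧ ∃ μ : Measure X, IsProbabilityMeasure μ ∧
      (∀ f : C(X, ℝ), Tendsto (fun n => ∫ x, f x ∂(P n)) U (nhds (∫ x, f x ∂μ))) ∧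
      ∀ S : Set X, IsClopen S → Tendsto (fun n => (P n).real S) U (nhds (μ.real S)) := by
  let U : Ultrafilter ℕ := Ultrafilter.of atTop
  let p : ℕ → ProbabilityMeasure X := fun n => ⟨P n, hP n⟩
  obtain ⟨μ, -, hμ⟩ := isCompact_univ.ultrafilter_le_nhds (U.map p) (by simp)
  have ht : Tendsto p U (nhds μ) := hμ
  have hf : ∀ f : C(X, ℝ),
      Tendsto (fun n => ∫ x, f x ∂(P n)) U (nhds (∫ x, f x ∂(μ : Measure X))) := by
    intro f
    exact ProbabilityMeasure.tendsto_iff_forall_integral_tendsto.1 ht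
      (BoundedContinuousFunction.mkOfCompact f)
  refine ⟨U, Ultrafilter.of_le _, μ, inferInstance, hf, fun S hS => ?_⟩
  have := hf ⟨S.indicator 1, (IsClopen.continuous_indicator hS continuous_one)⟩
  have e : ∀ κ : Measure X, ∫ x, S.indicator (1 : X → ℝ) x ∂κ = κ.real S := fun κ =>
    integral_indicator_one hS.isOpen.measurableSet
  simpa only [ContinuousMap.coe_mk, e] using this

omit [CompactSpace X] [T2Space X] [BorelSpace X] in
theorem measure_ext_of_isClopen (hgen : ‹MeasurableSpace X› =
    MeasurableSpace.generateFrom {S : Set X | IsClopen S}) {μ ν : Measure X}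
    [IsProbabilityMeasure μ] [IsProbabilityMeasure ν]
    (h : ∀ S, IsClopen S → μ.real S = ν.real S) : μ = ν := by
  refine ext_of_generate_finite _ hgen (fun S hS T hT _ => hS.inter hT) (fun S hS => ?_) (by simp)
  exact (measureReal_eq_measureReal_iff).1 (h S hS)

-- An orbit average over `n + 1` steps is invariant up to `1 / (n + 1)` by telescoping, and an
-- invariant limit is detected on the clopen sets, which form a generating π-system.
omit [CompactSpace X] [T2Space X] in
theorem measurePreserving_of_tendsto_orbitAverage {σ : X → X} (hσ : Continuous σ)
    (hgen : ‹MeasurableSpace X› = MeasurableSpace.generateFrom {S : Set X | IsClopen S})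
    {ν : ℕ → Measure X} (hν : ∀ n, IsProbabilityMeasure (ν n)) {U : Ultrafilter ℕ}
    (hU : (U : Filter ℕ) ≤ atTop) {μ : Measure X} [IsProbabilityMeasure μ]
    (hμ : ∀ S : Set X, IsClopen S →
      Tendsto (fun n => (orbitAverage σ (ν n) (n + 1)).real S) U (nhds (μ.real S))) :
    MeasurePreserving σ μ μ := by
  refine ⟨hσ.measurable, ?_⟩
  have hP : IsProbabilityMeasure (μ.map σ) :=
    Measure.isProbabilityMeasure_map hσ.measurable.aemeasurable
  refine measure_ext_of_isClopen hgen fun S hS => ?_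
  have hm := hS.isOpen.measurableSet
  rw [map_measureReal_apply hσ.measurable hm]
  have h1 := (hμ _ (hS.preimage hσ)).sub (hμ S hS)
  have h2 : Tendsto (fun n : ℕ => 1 / ((n : ℝ) + 1)) U (nhds 0) :=
    (tendsto_one_div_add_atTop_nhds_zero_nat (𝕜 := ℝ)).mono_left hU
  have h3 := squeeze_zero_norm (fun n => ?_) h2 (f := fun n =>
    (orbitAverage σ (ν n) (n + 1)).real (σ ⁻¹' S) - (orbitAverage σ (ν n) (n + 1)).real S)
  · linarith [tendsto_nhds_unique h1 h3]
  · have := hν n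
    simpa using abs_measureReal_preimage_orbitAverage_sub_le hσ (ν n) (Nat.succ_pos n) hm

end Limit

/-! ### Sampling points according to a distribution on words -/

section Sample

variable {X B : Type*} [MeasurableSpace X] [Fintype B]

/-- The discrete measure that gives the mass `ψ u` to the point `pt u`, for the words `u` of
length `n`. -/
noncomputable def sampleMeasure (ψ : List B → ℝ) (pt : List B → X) (n : ℕ) : Measure X :=
  ∑ u ∈ words B n, ENNReal.ofReal (ψ u) • Measure.dirac (pt u)

variable {ψ : List B → ℝ} (hψ : ∀ w, 0 ≤ ψ w) (hsum : ∀ n, ∑ w ∈ words B n, ψ w = 1)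
  (pt : List B → X)
include hψ hsum

theorem isProbabilityMeasure_sampleMeasure (n : ℕ) :
    IsProbabilityMeasure (sampleMeasure ψ pt n) := by
  constructor
  simp only [sampleMeasure, Measure.finsetSum_apply, Measure.smul_apply, measure_univ, smul_eq_mul,
    mul_one]
  rw [← ENNReal.ofReal_sum_of_nonneg fun w _ => hψ w, hsum, ENNReal.ofReal_one]

omit hsum in
open scoped Classical in
theorem measureReal_sampleMeasure (n : ℕ) {S : Set X} (hS : MeasurableSet S) :
    (sampleMeasure ψ pt n).real S = ∑ u ∈ words B n, if pt u ∈ S then ψ u else 0 := by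
  simp only [measureReal_def, sampleMeasure, Measure.finsetSum_apply, Measure.smul_apply,
    Measure.dirac_apply' _ hS, smul_eq_mul]
  rw [ENNReal.toReal_sum]
  · refine Finset.sum_congr rfl fun u _ => ?_
    rw [ENNReal.toReal_mul, ENNReal.toReal_ofReal (hψ u)]
    by_cases h : pt u ∈ S <;> simp [h]
  · intro u _
    refine ENNReal.mul_ne_top ENNReal.ofReal_ne_top ?_
    by_cases h : pt u ∈ S <;> simp [h]

variable {σ : X → X} {ζ : X → B} (hpt : ∀ w, ψ w ≠ 0 → itinerary σ ζ w.length (pt w) = w)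
include hpt

omit hsum in
theorem measureReal_sampleMeasure_itinerary {n : ℕ} (P : List B → Prop)
    (hm : MeasurableSet {x | P (itinerary σ ζ n x)}) :
    (sampleMeasure ψ pt n).real {x | P (itinerary σ ζ n x)} = eventWeight ψ n P := by
  rw [measureReal_sampleMeasure hψ pt n hm, eventWeight]
  refine Finset.sum_congr rfl fun u hu => ?_
  by_cases h : ψ u = 0
  · simp [h]
  · have := hpt u h
    rw [mem_words.1 hu] at this
    rw [Set.mem_ofPred_eq, this]

omit hsum in
theorem itineraryDist_sampleMeasure {n : ℕ} {w : List B} (hw : w ∈ words B n)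
    (hm : MeasurableSet {x | itinerary σ ζ n x = w}) :
    itineraryDist (sampleMeasure ψ pt n) σ ζ w = ψ w := by
  rw [itineraryDist, mem_words.1 hw, measureReal_sampleMeasure_itinerary hψ pt hpt (· = w) hm,
    eventWeight, Finset.sum_eq_single w (fun u _ huw => if_neg huw) (fun h => absurd hw h),
    if_pos rfl]

omit hsum in
theorem measureReal_sampleMeasure_preimage {n j L : ℕ} (h : j + L ≤ n) (P : List B → Prop)
    (hm : ∀ n (P : List B → Prop), MeasurableSet {x | P (itinerary σ ζ n x)}) :
    (sampleMeasure ψ pt n).real (σ^[j] ⁻¹' {x | P (itinerary σ ζ L x)}) =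
      eventWeight ψ n (fun u => P ((u.drop j).take L)) := by
  rw [← measureReal_sampleMeasure_itinerary hψ pt hpt
    (fun u => P ((u.drop j).take L)) (hm n fun u => P ((u.drop j).take L))]
  simp only [take_drop_itinerary σ ζ h]
  rfl

end Sample

/-! ### The variational principle -/

/-- Fekete's lemma gives the slope as an infimum, hence the lower bound. For the upper bound, almost
superadditivity is iterated along multiples of `n`, and the result is divided by `(k + 1) * n` with
`k → ∞`. -/
theorem exists_linear_approx {u : ℕ → ℝ} {C : ℝ} (h₁ : ∀ n m, u (n + m) ≤ u n + u m)
    (h₂ : ∀ n m, u n + u m ≤ u (n + m) + C) :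
    ∃ z : ℝ, ∀ n : ℕ, n * z ≤ u n ∧ u n ≤ n * z + C := by
  have hu0 : 0 ≤ u 0 := by have := h₁ 0 0; simp at this; linarith
  have hlow : ∀ n : ℕ, n * (u 1 - C) ≤ u n := by
    intro n
    induction n with
    | zero => simpa using hu0
    | succ n ih => push_cast; linarith [h₂ n 1]
  have hsub : Subadditive u := h₁
  have hbdd : BddBelow (Set.range fun n : ℕ => u n / n) := by
    -- At `n = 0` the quotient has the default value `0`, hence the minimum.
    refine ⟨min 0 (u 1 - C), ?_⟩
    rintro _ ⟨n, rfl⟩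
    rcases Nat.eq_zero_or_pos n with rfl | hn
    · simp
    · refine (min_le_right _ _).trans ?_
      rw [le_div_iff₀ (by exact_mod_cast hn), mul_comm]
      exact hlow n
  refine ⟨hsub.lim, fun n => ?_⟩
  rcases Nat.eq_zero_or_pos n with rfl | hn
  · have := h₂ 0 0
    simp only [add_zero] at this
    simp only [CharP.cast_eq_zero, zero_mul, zero_add]
    exact ⟨hu0, by linarith⟩
  have hn' : (0 : ℝ) < n := by exact_mod_cast hn
  constructor
  · have := hsub.lim_le_div hbdd hn.ne'
    rwa [le_div_iff₀ hn', mul_comm] at this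
  · have hk : ∀ k : ℕ, (k + 1 : ℝ) * u n ≤ u ((k + 1) * n) + k * C := by
      intro k
      induction k with
      | zero => simp
      | succ k ih =>
        have := h₂ ((k + 1) * n) n
        rw [show (k + 1) * n + n = (k + 1 + 1) * n by ring] at this
        push_cast
        linarith
    have ht : Tendsto (fun k : ℕ => u ((k + 1) * n) / (((k + 1) * n : ℕ) : ℝ)) atTop
        (nhds hsub.lim) :=
      (hsub.tendsto_lim hbdd).comp (tendsto_atTop_mono
        (fun k => (Nat.le_succ k).trans (Nat.le_mul_of_pos_right _ hn)) tendsto_id)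
    have hC : 0 ≤ C := by linarith [h₂ 0 0, hu0, h₁ 0 0, show u (0 + 0) = u 0 from rfl]
    have := ge_of_tendsto ht (b := (u n - C) / n) (Eventually.of_forall fun k => ?_)
    · rw [div_le_iff₀ hn'] at this; linarith
    · have hk' : (0 : ℝ) < k + 1 := by positivity
      rw [div_le_div_iff₀ hn' (by positivity)]
      push_cast
      have := mul_le_mul_of_nonneg_right (hk k) hn'.le
      nlinarith

section Integral

variable {X B : Type*} [TopologicalSpace X] [MeasurableSpace X] [BorelSpace X] [Fintype B]

theorem integral_comp_itinerary {σ : X → X} {ζ : X → B} (hσ : Continuous σ)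
    (hζ : IsLocallyConstant ζ) (μ : Measure X) [IsFiniteMeasure μ] (n : ℕ) (G : List B → ℝ) :
    Integrable (fun x => G (itinerary σ ζ n x)) μ ∧
    ∫ x, G (itinerary σ ζ n x) ∂μ = ∑ w ∈ words B n, itineraryDist μ σ ζ w * G w := by
  have e : (fun x => G (itinerary σ ζ n x)) = fun x => ∑ w ∈ words B n,
      {x | itinerary σ ζ n x = w}.indicator (fun _ => G w) x := by
    funext x
    rw [Finset.sum_eq_single (itinerary σ ζ n x)]
    · simp
    · intro w _ hw
      exact Set.indicator_of_notMem (fun h => hw h.symm) _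
    · simp
  have hm := fun w => measurableSet_itinerary hσ hζ n (· = w)
  have hint : ∀ w ∈ words B n,
      Integrable (fun x => {x | itinerary σ ζ n x = w}.indicator (fun _ => G w) x) μ :=
    fun w _ => (integrable_const (G w)).indicator (hm w)
  rw [e]
  refine ⟨integrable_finsetSum _ hint, ?_⟩
  rw [integral_finsetSum _ hint]
  refine Finset.sum_congr rfl fun w hw => ?_
  rw [integral_indicator_const _ (hm w), itineraryDist, mem_words.1 hw, smul_eq_mul]

end Integral

section ChainEntropy

variable {B : Type*} [Fintype B] [DecidableEq B]

theorem wordEntropy_congr {n : ℕ} {p q : List B → ℝ} (h : ∀ w ∈ words B n, p w = q w) :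
    wordEntropy n p = wordEntropy n q :=
  Finset.sum_congr rfl fun w hw => by rw [h w hw]

theorem klSum_congr {n : ℕ} {p q : List B → ℝ} (h : ∀ w ∈ words B n, p w = q w) (r : List B → ℝ) :
    klSum n p r = klSum n q r :=
  Finset.sum_congr rfl fun w hw => by rw [h w hw]

theorem chainEntropy_congr (g : ℕ → B → B) (a : ℕ → ℝ) {n : ℕ} (k : ℕ) :
    ∀ (i : ℕ) {p q : List B → ℝ}, (∀ w ∈ words B n, p w = q w) →
    chainEntropy g a n k i p = chainEntropy g a n k i q := by
  induction k with
  | zero => intros; rfl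
  | succ k ih =>
    intro i p q h
    have h' : ∀ J ∈ words B n, fiberSum (g i) p J = fiberSum (g i) q J :=
      fun J hJ => fiberSum_congr h hJ
    rw [chainEntropy, chainEntropy, wordEntropy_congr h', ih (i + 1) h']

end ChainEntropy

/-- A tower of finite codings `ζ i` of a continuous map `σ`, with a potential `f` of bounded
variation and the specification property for the finest coding `ζ 0`. -/
structure IsCodedSystem {X B : Type*} [TopologicalSpace X] [MeasurableSpace X] (σ : X → X)
    (ζ : ℕ → X → B) (g : ℕ → B → B) (f : X → ℝ) (a : ℕ → ℝ) (p₀ p₁ : ℕ) (C : ℝ) : Prop where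
  continuous : Continuous σ
  isLocallyConstant_zero : IsLocallyConstant (ζ 0)
  factor : ∀ i, ζ (i + 1) = g i ∘ ζ i
  coeff_pos : 0 < a 0
  coeff_nonneg : ∀ i, 0 ≤ a i
  variation : HasBoundedVariation σ (ζ 0) f C
  specification : HasSpecification σ (ζ 0) p₀ p₁
  generateFrom : ‹MeasurableSpace X› = MeasurableSpace.generateFrom {S : Set X | IsClopen S}
  determined : ∀ S : Set X, IsClopen S → ∃ k N, ∀ x y,
    itinerary σ (ζ 0) N x = itinerary σ (ζ 0) N y → (σ^[k] x ∈ S ↔ σ^[k] y ∈ S)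

/-- The weighted free energy of a measure, for the codings `ζ 0, …, ζ m`. -/
noncomputable def codedFreeEnergy {X B : Type*} [MeasurableSpace X] [Fintype B]
    (σ : X → X) (ζ : ℕ → X → B) (f : X → ℝ) (a : ℕ → ℝ) (m : ℕ) (μ : Measure X) : ℝ :=
  ∫ x, f x ∂μ + ∑ i ∈ Finset.range (m + 1), a i * entropyRate μ σ (ζ i)

namespace IsCodedSystem

variable {X B : Type*} [TopologicalSpace X] [CompactSpace X] [T2Space X] [MeasurableSpace X]
  [BorelSpace X] [Nonempty X] [Fintype B] [DecidableEq B] {σ : X → X} {ζ : ℕ → X → B}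
  {g : ℕ → B → B} {f : C(X, ℝ)} {a : ℕ → ℝ} {p₀ p₁ : ℕ} {C : ℝ}
  (h : IsCodedSystem σ ζ g f a p₀ p₁ C)
include h

omit [CompactSpace X] [T2Space X] [Nonempty X] [BorelSpace X] [Fintype B] [DecidableEq B] in
theorem isLocallyConstant (i : ℕ) : IsLocallyConstant (ζ i) := by
  induction i with
  | zero => exact h.isLocallyConstant_zero
  | succ i ih => rw [h.factor]; exact ih.comp (g i)

theorem isWeightChain : IsWeightChain g a (levelWeight g a (expWeight σ (ζ 0) f (a 0))) :=
  isWeightChain_levelWeight h.coeff_pos h.coeff_nonneg g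
    (isSubmultiplicativeWeight_expWeight (σ := σ) (ζ := ζ 0) f h.coeff_pos)

theorem chainEntropy_itineraryDist (μ : Measure X) [IsProbabilityMeasure μ] (n k : ℕ) :
    ∀ i, chainEntropy g a n k i (itineraryDist μ σ (ζ i)) =
      ∑ l ∈ Finset.range k, a (i + 1 + l) * blockEntropy μ σ (ζ (i + 1 + l)) n := by
  induction k with
  | zero => intro i; simp [chainEntropy]
  | succ k ih =>
    intro i
    rw [chainEntropy, fiberSum_itineraryDist h.continuous (h.isLocallyConstant i), ← h.factor, ih,
      Finset.sum_range_succ', add_comm]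
    simp only [add_zero, blockEntropy]
    congr 1
    refine Finset.sum_congr rfl fun l _ => ?_
    rw [show i + 1 + 1 + l = i + 1 + (l + 1) by ring]

/-- The quantity optimized by the chain argument is the block version of the weighted free energy:
`-a_0 KL(p | φ_0)` is the entropy term of level `0` plus the potential term. -/
theorem blockFreeEnergy_eq (μ : Measure X) [IsProbabilityMeasure μ] (n m : ℕ) :
    chainEntropy g a n m 0 (itineraryDist μ σ (ζ 0)) - coeffSum a 0 *
        klSum n (itineraryDist μ σ (ζ 0)) (expWeight σ (ζ 0) f (a 0)) =
      ∑ i ∈ Finset.range (m + 1), a i * blockEntropy μ σ (ζ i) n +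
        ∫ x, a 0 * Real.log (expWeight σ (ζ 0) f (a 0) (itinerary σ (ζ 0) n x)) ∂μ := by
  rw [h.chainEntropy_itineraryDist, klSum_eq, coeffSum_zero, Finset.sum_range_succ',
    integral_const_mul, (integral_comp_itinerary h.continuous h.isLocallyConstant_zero μ n
      (fun w => Real.log (expWeight σ (ζ 0) f (a 0) w))).2]
  simp only [zero_add, blockEntropy]
  simp only [add_comm 1]
  ring

theorem integrable_of_continuous (μ : Measure X) [IsFiniteMeasure μ] {u : X → ℝ}
    (hu : Continuous u) : Integrable u μ :=
  hu.integrable_of_hasCompactSupport (HasCompactSupport.of_compactSpace u)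

theorem continuous_birkhoffSum (n : ℕ) : Continuous (birkhoffSum σ f n) := by
  unfold birkhoffSum
  exact continuous_finsetSum _ fun j _ => f.continuous.comp (h.continuous.iterate j)

theorem integral_birkhoffSum {μ : Measure X} [IsProbabilityMeasure μ]
    (hμ : MeasurePreserving σ μ μ) (n : ℕ) :
    ∫ x, birkhoffSum σ f n x ∂μ = n * ∫ x, f x ∂μ := by
  simp only [birkhoffSum]
  rw [integral_finsetSum (f := fun j x => f (σ^[j] x)) _
    (fun j _ => h.integrable_of_continuous μ (f.continuous.comp (h.continuous.iterate j)))]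
  have : ∀ j ∈ Finset.range n, ∫ x, f (σ^[j] x) ∂μ = ∫ x, f x ∂μ := by
    intro j _
    conv_rhs => rw [← (hμ.iterate j).map_eq]
    exact (integral_map (h.continuous.iterate j).measurable.aemeasurable
      f.continuous.aestronglyMeasurable).symm
  rw [Finset.sum_congr rfl this]
  simp

theorem integral_birkhoffSum_le (μ : Measure X) [IsProbabilityMeasure μ] (n : ℕ) :
    ∫ x, birkhoffSum σ f n x ∂μ ≤
      ∫ x, a 0 * Real.log (expWeight σ (ζ 0) f (a 0) (itinerary σ (ζ 0) n x)) ∂μ := by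
  refine integral_mono (h.integrable_of_continuous μ (h.continuous_birkhoffSum n))
    ((integral_comp_itinerary h.continuous h.isLocallyConstant_zero μ n
      fun w => Real.log (expWeight σ (ζ 0) f (a 0) w)).1.const_mul (a 0)) fun x => ?_
  have := Real.log_le_log (Real.exp_pos _)
    (le_expWeight (σ := σ) (ζ := ζ 0) f h.coeff_pos n x)
  rw [Real.log_exp, div_le_iff₀ h.coeff_pos] at this
  simp only
  linarith

theorem le_integral_birkhoffSum (μ : Measure X) [IsProbabilityMeasure μ] (n : ℕ) :
    ∫ x, a 0 * Real.log (expWeight σ (ζ 0) f (a 0) (itinerary σ (ζ 0) n x)) ∂μ ≤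
      ∫ x, birkhoffSum σ f n x ∂μ + C := by
  have e : ∫ x, birkhoffSum σ f n x ∂μ + C = ∫ x, (birkhoffSum σ f n x + C) ∂μ := by
    rw [integral_add (h.integrable_of_continuous μ (h.continuous_birkhoffSum n))
      (integrable_const C)]
    simp
  rw [e]
  refine integral_mono
    ((integral_comp_itinerary h.continuous h.isLocallyConstant_zero μ n
      fun w => Real.log (expWeight σ (ζ 0) f (a 0) w)).1.const_mul (a 0))
    (h.integrable_of_continuous μ ((h.continuous_birkhoffSum n).add continuous_const)) fun x => ?_
  have := Real.log_le_log (expWeight_pos (σ := σ) (ζ := ζ 0) f h.coeff_pos n x)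
    (expWeight_le f h.coeff_pos h.variation n x)
  rw [Real.log_mul (Real.exp_pos _).ne' (Real.exp_pos _).ne', Real.log_exp, Real.log_exp, ← add_div,
    le_div_iff₀ h.coeff_pos] at this
  simp only
  linarith

theorem totalWeight_levelWeight_pos (i n : ℕ) :
    0 < totalWeight (levelWeight g a (expWeight σ (ζ 0) f (a 0)) i) n := by
  induction i with
  | zero =>
    obtain ⟨x⟩ := ‹Nonempty X›
    simpa using (h.isWeightChain.submul 0).totalWeight_pos
      (expWeight_pos (σ := σ) (ζ := ζ 0) f h.coeff_pos n x)
  | succ i ih => exact h.isWeightChain.totalWeight_succ_pos ih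

/-- The mass of the last weight is both submultiplicative and quasi-supermultiplicative, so its
logarithm is linear up to a bounded error. The boundedness of the error is what uniqueness needs. -/
theorem exists_pressure (m : ℕ) : ∃ z D : ℝ, ∀ n : ℕ,
    n * z ≤ coeffSum a m * Real.log (totalWeight (levelWeight g a (expWeight σ (ζ 0) f (a 0)) m) n) ∧
    coeffSum a m * Real.log (totalWeight (levelWeight g a (expWeight σ (ζ 0) f (a 0)) m) n) ≤
      n * z + D := by
  have hs := h.isWeightChain.submul m
  have hA := coeffSum_pos h.coeff_pos h.coeff_nonneg m
  obtain ⟨K, hK, hle⟩ := hs.exists_totalWeight_mul_le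
    (levelWeight_hasGluing h.coeff_pos h.coeff_nonneg g
      (isSubmultiplicativeWeight_expWeight (σ := σ) (ζ := ζ 0) f h.coeff_pos)
      (hasGluing_expWeight f h.coeff_pos h.variation h.specification) m)
  have hp := h.totalWeight_levelWeight_pos m
  obtain ⟨z, hz⟩ := exists_linear_approx
    (u := fun n => Real.log (totalWeight (levelWeight g a (expWeight σ (ζ 0) f (a 0)) m) n))
    (C := Real.log K) (fun n k => by
      rw [← Real.log_mul (hp n).ne' (hp k).ne']
      exact Real.log_le_log (hp _) (hs.totalWeight_add_le n k))
    (fun n k => by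
      rw [← Real.log_mul (hp n).ne' (hp k).ne', add_comm, ← Real.log_mul hK.ne' (hp _).ne']
      exact Real.log_le_log (mul_pos (hp n) (hp k)) (hle n k))
  refine ⟨coeffSum a m * z, coeffSum a m * Real.log K, fun n => ?_⟩
  have h1 := mul_le_mul_of_nonneg_left (hz n).1 hA.le
  have h2 := mul_le_mul_of_nonneg_left (hz n).2 hA.le
  exact ⟨by linarith, by linarith⟩

omit [CompactSpace X] [T2Space X] [Nonempty X] [DecidableEq B] [Fintype B] [BorelSpace X] h in
theorem itineraryDist_eq_zero {ζ : X → B} {f : X → ℝ} (μ : Measure X) {w : List B} {a : ℝ}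
    (hw : expWeight σ ζ f a w = 0) (hpos : ∀ x, 0 < expWeight σ ζ f a (itinerary σ ζ w.length x)) :
    itineraryDist μ σ ζ w = 0 := by
  have : {x | itinerary σ ζ w.length x = w} = ∅ := by
    ext x
    simp only [Set.mem_ofPred_eq, Set.mem_empty_iff_false, iff_false]
    intro hx
    have := hpos x
    rw [hx, hw] at this
    exact this.false
  rw [itineraryDist, this, measureReal_empty]

/-- The upper bound in the variational principle, with the relative entropy as error term. -/
theorem codedFreeEnergy_add_klSum_le {μ : Measure X} [IsProbabilityMeasure μ]
    (hμ : MeasurePreserving σ μ μ) (m n : ℕ) :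
    n * codedFreeEnergy σ ζ f a m μ + a 0 * klSum n (itineraryDist μ σ (ζ 0))
        (chainWeight g (levelWeight g a (expWeight σ (ζ 0) f (a 0))) m 0) ≤
      coeffSum a m *
        Real.log (totalWeight (levelWeight g a (expWeight σ (ζ 0) f (a 0)) m) n) ∧
    0 ≤ klSum n (itineraryDist μ σ (ζ 0))
        (chainWeight g (levelWeight g a (expWeight σ (ζ 0) f (a 0))) m 0) := by
  have hsum := sum_itineraryDist h.continuous h.isLocallyConstant_zero μ n
  have hsupp : ∀ w ∈ words B n, levelWeight g a (expWeight σ (ζ 0) f (a 0)) 0 w = 0 →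
      itineraryDist μ σ (ζ 0) w = 0 := fun w _ hw =>
    itineraryDist_eq_zero μ hw fun x => expWeight_pos f h.coeff_pos _ x
  have hkey := h.isWeightChain.chainEntropy_sub_le n m 0 (itineraryDist μ σ (ζ 0))
    (itineraryDist_nonneg μ) hsum hsupp
  have hE := h.blockFreeEnergy_eq μ n m
  have hint := h.integral_birkhoffSum_le μ n
  rw [h.integral_birkhoffSum hμ] at hint
  have hent : n * ∑ i ∈ Finset.range (m + 1), a i * entropyRate μ σ (ζ i) ≤
      ∑ i ∈ Finset.range (m + 1), a i * blockEntropy μ σ (ζ i) n := by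
    rw [Finset.mul_sum]
    refine Finset.sum_le_sum fun i _ => ?_
    have := mul_le_mul_of_nonneg_left
      ((entropyRate_eq_lim h.continuous (h.isLocallyConstant i) hμ).2 n) (h.coeff_nonneg i)
    linarith
  refine ⟨?_, h.isWeightChain.klSum_chainWeight_nonneg m 0 n (itineraryDist_nonneg μ) hsum hsupp⟩
  rw [zero_add, coeffSum_zero] at hkey
  rw [coeffSum_zero] at hE
  have e0 : klSum n (itineraryDist μ σ (ζ 0)) (levelWeight g a (expWeight σ (ζ 0) f (a 0)) 0) =
    klSum n (itineraryDist μ σ (ζ 0)) (expWeight σ (ζ 0) f (a 0)) := rfl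
  rw [e0] at hkey
  rw [codedFreeEnergy, mul_add]
  linarith

end IsCodedSystem

namespace IsCodedSystem

variable {X B : Type*} [TopologicalSpace X] [CompactSpace X] [T2Space X] [MeasurableSpace X]
  [BorelSpace X] [Nonempty X] [Fintype B] [DecidableEq B] {σ : X → X} {ζ : ℕ → X → B}
  {g : ℕ → B → B} {f : C(X, ℝ)} {a : ℕ → ℝ} {p₀ p₁ : ℕ} {C : ℝ}
  (h : IsCodedSystem σ ζ g f a p₀ p₁ C)
include h

theorem exists_points (m : ℕ) : ∃ pt : List B → X, ∀ w,
    chainWeight g (levelWeight g a (expWeight σ (ζ 0) f (a 0))) m 0 w ≠ 0 →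
      itinerary σ (ζ 0) w.length (pt w) = w := by
  have : ∀ w : List B, ∃ x : X,
      chainWeight g (levelWeight g a (expWeight σ (ζ 0) f (a 0))) m 0 w ≠ 0 →
        itinerary σ (ζ 0) w.length x = w := by
    intro w
    by_cases hw : chainWeight g (levelWeight g a (expWeight σ (ζ 0) f (a 0))) m 0 w = 0
    · obtain ⟨x⟩ := ‹Nonempty X›
      exact ⟨x, fun h0 => absurd hw h0⟩
    · have h0 : expWeight σ (ζ 0) f (a 0) w ≠ 0 := fun h0 =>
        hw (IsWeightChain.chainWeight_eq_zero m h0)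
      obtain ⟨x, hx⟩ := exists_itinerary_eq_of_expWeight_ne_zero f h0
      exact ⟨x, fun _ => hx⟩
  choose pt hpt using this
  exact ⟨pt, hpt⟩

/-- The lower bound in the variational principle, before passing to the limit. -/
theorem le_orbitAverage_sampleMeasure {m : ℕ} {pt : List B → X} (hpt : ∀ w,
    chainWeight g (levelWeight g a (expWeight σ (ζ 0) f (a 0))) m 0 w ≠ 0 →
      itinerary σ (ζ 0) w.length (pt w) = w) {n : ℕ} (hn : 0 < n) (M : ℕ) {ν : Measure X}
    (hν : ν = sampleMeasure (chainWeight g (levelWeight g a (expWeight σ (ζ 0) f (a 0))) m 0) pt n) :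
    M * (coeffSum a m *
        Real.log (totalWeight (levelWeight g a (expWeight σ (ζ 0) f (a 0)) m) n)) ≤
      n * (M * ∫ x, f x ∂(orbitAverage σ ν n) +
        ∑ i ∈ Finset.range (m + 1), a i * blockEntropy (orbitAverage σ ν n) σ (ζ i) M) +
      (∑ i ∈ Finset.range (m + 1), a i * (2 * M ^ 2 * Real.log (Fintype.card B)) + M * C) := by
  have hB : Nonempty B := ‹Nonempty X›.map (ζ 0)
  set ψ := chainWeight g (levelWeight g a (expWeight σ (ζ 0) f (a 0))) m 0 with hψ
  have hnn := h.isWeightChain.chainWeight_nonneg m 0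
  have hsum := fun n => h.isWeightChain.sum_chainWeight m 0 n (h.totalWeight_levelWeight_pos 0 n)
  have hP : IsProbabilityMeasure ν := hν ▸ isProbabilityMeasure_sampleMeasure hnn hsum pt n
  have hdist : ∀ w ∈ words B n, itineraryDist ν σ (ζ 0) w = ψ w := fun w hw => by
    rw [hν]
    exact itineraryDist_sampleMeasure hnn pt hpt hw
      (measurableSet_itinerary h.continuous h.isLocallyConstant_zero n (· = w))
  have h1 := h.isWeightChain.chainEntropy_chainWeight n m 0 (h.totalWeight_levelWeight_pos 0 n)
  have h2 := h.blockFreeEnergy_eq ν n m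
  rw [chainEntropy_congr g a m 0 hdist, klSum_congr hdist] at h2
  have e0 : klSum n ψ (levelWeight g a (expWeight σ (ζ 0) f (a 0)) 0) =
    klSum n ψ (expWeight σ (ζ 0) f (a 0)) := rfl
  rw [← hψ, e0, h2, zero_add] at h1
  have h3 := h.le_integral_birkhoffSum ν n
  rw [← mul_integral_orbitAverage h.continuous ν n f] at h3
  have h4 : ∑ i ∈ Finset.range (m + 1), a i * (M * blockEntropy ν σ (ζ i) n) ≤
      ∑ i ∈ Finset.range (m + 1), a i * (n * blockEntropy (orbitAverage σ ν n) σ (ζ i) M +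
      2 * M ^ 2 * Real.log (Fintype.card B)) :=
    Finset.sum_le_sum fun i _ => mul_le_mul_of_nonneg_left
      (mul_blockEntropy_le_orbitAverage h.continuous ν (h.isLocallyConstant i) hn M)
      (h.coeff_nonneg i)
  have h5 : ∑ i ∈ Finset.range (m + 1), a i * (M * blockEntropy ν σ (ζ i) n) =
      M * ∑ i ∈ Finset.range (m + 1), a i * blockEntropy ν σ (ζ i) n := by
    rw [Finset.mul_sum]; exact Finset.sum_congr rfl fun i _ => by ring
  have h6 : ∑ i ∈ Finset.range (m + 1), a i * (n * blockEntropy (orbitAverage σ ν n) σ (ζ i) M +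
      2 * M ^ 2 * Real.log (Fintype.card B)) =
      n * ∑ i ∈ Finset.range (m + 1), a i * blockEntropy (orbitAverage σ ν n) σ (ζ i) M +
      ∑ i ∈ Finset.range (m + 1), a i * (2 * M ^ 2 * Real.log (Fintype.card B)) := by
    rw [Finset.mul_sum, ← Finset.sum_add_distrib]
    exact Finset.sum_congr rfl fun i _ => by ring
  rw [h5, h6] at h4
  rw [← h1]
  have h7 := mul_le_mul_of_nonneg_left h3 (Nat.cast_nonneg (α := ℝ) M)
  linarith

theorem tendsto_blockEntropy {U : Filter ℕ} {P : ℕ → Measure X} {μ : Measure X}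
    (hP : ∀ S : Set X, IsClopen S → Tendsto (fun n => (P n).real S) U (nhds (μ.real S)))
    (i M : ℕ) : Tendsto (fun n => blockEntropy (P n) σ (ζ i) M) U
      (nhds (blockEntropy μ σ (ζ i) M)) :=
  tendsto_finsetSum _ fun w _ => (Real.continuous_negMulLog.tendsto _).comp
    (hP _ (isClopen_itinerary h.continuous (h.isLocallyConstant i) w.length (· = w)))

/-- The block length `M` is fixed while `n → ∞` along the ultrafilter, since entropies of `M`-blocks
are continuous in the measures of clopen sets. Only afterwards does `M → ∞`. -/
theorem le_codedFreeEnergy_of_tendsto {m : ℕ} {pt : List B → X} (hpt : ∀ w,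
    chainWeight g (levelWeight g a (expWeight σ (ζ 0) f (a 0))) m 0 w ≠ 0 →
      itinerary σ (ζ 0) w.length (pt w) = w) {z : ℝ}
    (hz : ∀ n : ℕ, n * z ≤ coeffSum a m *
      Real.log (totalWeight (levelWeight g a (expWeight σ (ζ 0) f (a 0)) m) n))
    {ν : ℕ → Measure X} (hν : ∀ n, ν n =
      sampleMeasure (chainWeight g (levelWeight g a (expWeight σ (ζ 0) f (a 0))) m 0) pt (n + 1))
    {U : Ultrafilter ℕ} (hU : (U : Filter ℕ) ≤ atTop) {μ : Measure X} [IsProbabilityMeasure μ]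
    (hμ : MeasurePreserving σ μ μ)
    (hf : Tendsto (fun n => ∫ x, f x ∂(orbitAverage σ (ν n) (n + 1))) U (nhds (∫ x, f x ∂μ)))
    (hS : ∀ S : Set X, IsClopen S →
      Tendsto (fun n => (orbitAverage σ (ν n) (n + 1)).real S) U (nhds (μ.real S))) :
    z ≤ codedFreeEnergy σ ζ f a m μ := by
  have key : ∀ M : ℕ, M * z ≤ M * ∫ x, f x ∂μ +
      ∑ i ∈ Finset.range (m + 1), a i * blockEntropy μ σ (ζ i) M := by
    intro M
    set D := ∑ i ∈ Finset.range (m + 1), a i * (2 * M ^ 2 * Real.log (Fintype.card B)) + M * C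
    have ht1 : Tendsto (fun n => M * ∫ x, f x ∂(orbitAverage σ (ν n) (n + 1)) +
        ∑ i ∈ Finset.range (m + 1), a i *
          blockEntropy (orbitAverage σ (ν n) (n + 1)) σ (ζ i) M) U
        (nhds (M * ∫ x, f x ∂μ + ∑ i ∈ Finset.range (m + 1), a i * blockEntropy μ σ (ζ i) M)) :=
      (hf.const_mul _).add (tendsto_finsetSum _ fun i _ =>
        (h.tendsto_blockEntropy hS i M).const_mul _)
    have ht2 : Tendsto (fun n : ℕ => D * (1 / ((n : ℝ) + 1))) U (nhds (D * 0)) :=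
      ((tendsto_one_div_add_atTop_nhds_zero_nat (𝕜 := ℝ)).const_mul D).mono_left hU
    have ht := ht1.add ht2
    rw [mul_zero, add_zero] at ht
    refine ge_of_tendsto ht (Eventually.of_forall fun n => ?_)
    have h1 := h.le_orbitAverage_sampleMeasure hpt (Nat.succ_pos n) M (hν n)
    have h2 := mul_le_mul_of_nonneg_left (hz (n + 1)) (Nat.cast_nonneg (α := ℝ) M)
    have h3 := h2.trans h1
    simp only [Nat.succ_eq_add_one] at h3
    push_cast at h3
    have hn : (0 : ℝ) < n + 1 := by positivity
    rw [mul_one_div, ← mul_le_mul_iff_right₀ hn, mul_add (_ : ℝ) _ (D / _), mul_div_cancel₀ _ hn.ne']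
    linarith
  have hlim : Tendsto (fun M : ℕ => ∫ x, f x ∂μ +
      ∑ i ∈ Finset.range (m + 1), a i * (blockEntropy μ σ (ζ i) M / M)) atTop
      (nhds (codedFreeEnergy σ ζ f a m μ)) :=
    tendsto_const_nhds.add (tendsto_finsetSum _ fun i _ =>
      (entropyRate_eq_lim h.continuous (h.isLocallyConstant i) hμ).1.const_mul _)
  refine ge_of_tendsto hlim ((eventually_gt_atTop 0).mono fun M hM => ?_)
  have hM' : (0 : ℝ) < M := by exact_mod_cast hM
  have e : ∑ i ∈ Finset.range (m + 1), a i * (blockEntropy μ σ (ζ i) M / M) =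
      (∑ i ∈ Finset.range (m + 1), a i * blockEntropy μ σ (ζ i) M) / M := by
    rw [Finset.sum_div]; exact Finset.sum_congr rfl fun i _ => by ring
  rw [e, ← mul_le_mul_iff_right₀ hM', mul_add, mul_div_cancel₀ _ hM'.ne']
  exact key M

end IsCodedSystem

/-! ### Lower bounds for the limit measure -/

section LowerBound

variable {X B : Type*} [TopologicalSpace X] [MeasurableSpace X] [BorelSpace X] [Fintype B]
  {σ : X → X} {ζ : X → B} (hσ : Continuous σ) (hζ : IsLocallyConstant ζ)
  {ψ : List B → ℝ} {p₀ p₁ R : ℕ} {c : ℝ} (hψ : IsGluingFamily ψ p₀ p₁ R c)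
  {pt : List B → X} (hpt : ∀ w, ψ w ≠ 0 → itinerary σ ζ w.length (pt w) = w)
  {U : Ultrafilter ℕ} (hU : (U : Filter ℕ) ≤ atTop) {μ : Measure X} [IsProbabilityMeasure μ]
  (hS : ∀ S : Set X, IsClopen S → Tendsto
    (fun n => (orbitAverage σ (sampleMeasure ψ pt (n + 1)) (n + 1)).real S) U (nhds (μ.real S)))
include hσ hζ hψ hpt hU hS

-- `shifted_eventWeight` is summed over the starting positions that fit into `N` letters. For each
-- `t` a shifted position occurs only once, so the sum over `t` adds a second factor `p₁ + 1`.
omit hU hS in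
theorem eventWeight_le_orbitAverage (hR : 2 * p₁ ≤ R) (L : ℕ) (P : List B → Prop) {N : ℕ}
    (hN : L + 2 * p₁ ≤ N) :
    (N - (L + 2 * p₁) : ℝ) * (c ^ 3 * eventWeight ψ L P) ≤ (p₁ + 1) ^ 2 *
      (N * (orbitAverage σ (sampleMeasure ψ pt N) N).real {x | P (itinerary σ ζ L x)}) := by
  have hm := measurableSet_itinerary hσ hζ
  have hP := isProbabilityMeasure_sampleMeasure hψ.nonneg hψ.sum_eq_one pt N
  rw [mul_measureReal_orbitAverage hσ _ N (hm L P)]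
  set F : ℕ → ℝ := fun j => (sampleMeasure ψ pt N).real (σ^[j] ⁻¹' {x | P (itinerary σ ζ L x)})
    with hF
  have hF0 : ∀ j, 0 ≤ F j := fun j => measureReal_nonneg
  set J := N - (L + 2 * p₁) with hJ
  have hJ' : (J : ℝ) = N - (L + 2 * p₁) := by rw [hJ, Nat.cast_sub hN]; push_cast; ring
  rw [← hJ']
  have h1 : ∀ j ∈ Finset.range J, c ^ 3 * eventWeight ψ L P ≤
      (p₁ + 1) * ∑ t ∈ Finset.Icc p₀ p₁, F (j + t) := by
    intro j hj
    rw [Finset.mem_range] at hj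
    have := hψ.shifted_eventWeight hR L j (N - (L + 2 * p₁) - j) P
    rw [show j + L + (N - (L + 2 * p₁) - j) + 2 * p₁ = N by omega] at this
    refine this.trans (le_of_eq ?_)
    congr 1
    refine Finset.sum_congr rfl fun t ht => ?_
    rw [Finset.mem_Icc] at ht
    exact (measureReal_sampleMeasure_preimage hψ.nonneg pt hpt (by omega) P hm).symm
  have h2 := Finset.sum_le_sum h1
  rw [Finset.sum_const, Finset.card_range, nsmul_eq_mul, ← Finset.mul_sum, Finset.sum_comm] at h2
  have h3 : ∑ t ∈ Finset.Icc p₀ p₁, ∑ j ∈ Finset.range J, F (j + t) ≤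
      ∑ t ∈ Finset.Icc p₀ p₁, ∑ j ∈ Finset.range N, F j := by
    refine Finset.sum_le_sum fun t ht => ?_
    rw [Finset.mem_Icc] at ht
    have e := Finset.sum_range_add F t J
    have h4 : ∑ j ∈ Finset.range (t + J), F j ≤ ∑ j ∈ Finset.range N, F j :=
      Finset.sum_le_sum_of_subset_of_nonneg (Finset.range_mono (by omega)) fun j _ _ => hF0 j
    have h5 : 0 ≤ ∑ j ∈ Finset.range t, F j := Finset.sum_nonneg fun j _ => hF0 j
    simp only [add_comm _ t]
    linarith
  have hcard : ((Finset.Icc p₀ p₁).card : ℝ) ≤ p₁ + 1 := by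
    rw [Nat.card_Icc]
    have : p₁ + 1 - p₀ ≤ p₁ + 1 := Nat.sub_le _ _
    exact_mod_cast this
  rw [Finset.sum_const, nsmul_eq_mul] at h3
  have hT : 0 ≤ ∑ j ∈ Finset.range N, F j := Finset.sum_nonneg fun j _ => hF0 j
  have h6 := mul_le_mul_of_nonneg_right hcard hT
  have hp : (0 : ℝ) ≤ p₁ + 1 := by positivity
  calc (J : ℝ) * (c ^ 3 * eventWeight ψ L P)
      ≤ (p₁ + 1) * ∑ t ∈ Finset.Icc p₀ p₁, ∑ j ∈ Finset.range J, F (j + t) := h2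
    _ ≤ (p₁ + 1) * ((p₁ + 1) * ∑ j ∈ Finset.range N, F j) :=
        mul_le_mul_of_nonneg_left (h3.trans h6) hp
    _ = _ := by ring

/-- Domination of the word distributions by the limit measure, uniform in the length. It serves
twice: for the mixing estimate and for absolute continuity. -/
theorem eventWeight_le_measureReal (hR : 2 * p₁ ≤ R) (L : ℕ) (P : List B → Prop) :
    c ^ 3 * eventWeight ψ L P ≤ (p₁ + 1) ^ 2 * μ.real {x | P (itinerary σ ζ L x)} := by
  have ht := (hS _ (isClopen_itinerary hσ hζ L P)).const_mul (((p₁ : ℝ) + 1) ^ 2)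
  set E := c ^ 3 * eventWeight ψ L P with hE
  have ht2 : Tendsto (fun n : ℕ => (1 - (L + 2 * p₁) * (1 / ((n : ℝ) + 1))) * E) U
      (nhds ((1 - (L + 2 * p₁) * 0) * E)) :=
    ((((tendsto_one_div_add_atTop_nhds_zero_nat (𝕜 := ℝ)).const_mul _).const_sub 1).mul_const
      E).mono_left hU
  rw [mul_zero, sub_zero, one_mul] at ht2
  refine le_of_tendsto_of_tendsto ht2 ht ?_
  refine hU ((eventually_ge_atTop (L + 2 * p₁)).mono fun n hn => ?_)
  have key := eventWeight_le_orbitAverage hσ hζ hψ hpt hR L P (N := n + 1) (by omega)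
  have hn : (0 : ℝ) < n + 1 := by positivity
  push_cast at key
  simp only
  rw [← mul_le_mul_iff_right₀ hn]
  refine le_trans (le_of_eq ?_) (key.trans (le_of_eq ?_))
  · rw [hE]; field_simp
  · ring

/-- The mixing estimate for two events that depend on the first `L` letters. -/
theorem eventWeight_mul_le_sum_measureReal (hR : 2 * p₁ ≤ R) (L s : ℕ) (hs : L + 2 * p₀ ≤ s)
    (P Q : List B → Prop) :
    c ^ 5 * (eventWeight ψ L P * eventWeight ψ L Q) ≤ (p₁ + 1) ^ 4 *
      ∑ i ∈ Finset.range (2 * (p₁ - p₀) + 1), μ.real ({x | P (itinerary σ ζ L x)} ∩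
        σ^[s + i] ⁻¹' {x | Q (itinerary σ ζ L x)}) := by
  obtain ⟨w, rfl⟩ := Nat.exists_eq_add_of_le hs
  set T := ∑ i ∈ Finset.range (2 * (p₁ - p₀) + 1), μ.real ({x | P (itinerary σ ζ L x)} ∩
        σ^[L + 2 * p₀ + w + i] ⁻¹' {x | Q (itinerary σ ζ L x)}) with hT
  have hT0 : 0 ≤ T := Finset.sum_nonneg fun i _ => measureReal_nonneg
  have h1 := mul_le_mul_of_nonneg_left (hψ.pair_eventWeight L L w P Q)
    (pow_nonneg hψ.const_pos.le 3)
  rw [Finset.mul_sum] at h1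
  simp only [Finset.mul_sum] at h1
  -- The two connecting words change the distance between the events by `t + t' - 2 * p₀`, which
  -- lies in `[0, 2 * (p₁ - p₀)]`; for `p₀ = p₁` there is no fluctuation. The power `c ^ 5` comes
  -- from two gluings and the `c ^ 3` of the domination.
  have h2 : ∀ t ∈ Finset.Icc p₀ p₁, ∀ t' ∈ Finset.Icc p₀ p₁,
      c ^ 3 * eventWeight ψ (L + t + w + t' + L)
        (fun u => P (u.take L) ∧ Q (u.drop (L + t + w + t'))) ≤ (p₁ + 1) ^ 2 * T := by
    intro t ht t' ht'
    rw [Finset.mem_Icc] at ht ht'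
    refine (eventWeight_le_measureReal hσ hζ hψ hpt hU hS hR _ _).trans
      (mul_le_mul_of_nonneg_left ?_ (by positivity))
    have e : {x | P ((itinerary σ ζ (L + t + w + t' + L) x).take L) ∧
        Q ((itinerary σ ζ (L + t + w + t' + L) x).drop (L + t + w + t'))} =
        {x | P (itinerary σ ζ L x)} ∩
        σ^[L + 2 * p₀ + w + (t + t' - 2 * p₀)] ⁻¹' {x | Q (itinerary σ ζ L x)} := by
      ext x
      rw [show L + 2 * p₀ + w + (t + t' - 2 * p₀) = L + t + w + t' by omega]
      simp only [Set.mem_ofPred_eq, Set.mem_inter_iff, Set.mem_preimage, drop_itinerary]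
      rw [take_itinerary σ ζ (by omega)]
    rw [e]
    exact Finset.single_le_sum (f := fun i => μ.real ({x | P (itinerary σ ζ L x)} ∩
        σ^[L + 2 * p₀ + w + i] ⁻¹' {x | Q (itinerary σ ζ L x)}))
      (fun i _ => measureReal_nonneg) (by rw [Finset.mem_range]; omega)
  have hcard : ((Finset.Icc p₀ p₁).card : ℝ) ≤ p₁ + 1 := by
    rw [Nat.card_Icc]
    have : p₁ + 1 - p₀ ≤ p₁ + 1 := Nat.sub_le _ _
    exact_mod_cast this
  have h3 := Finset.sum_le_sum fun t ht => Finset.sum_le_sum fun t' ht' => h2 t ht t' ht'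
  simp only [Finset.sum_const, nsmul_eq_mul] at h3
  have h4 : ((Finset.Icc p₀ p₁).card : ℝ) * ((Finset.Icc p₀ p₁).card * ((p₁ + 1) ^ 2 * T)) ≤
      (p₁ + 1) * ((p₁ + 1) * ((p₁ + 1) ^ 2 * T)) := by gcongr
  calc c ^ 5 * (eventWeight ψ L P * eventWeight ψ L Q)
      = c ^ 3 * (c ^ 2 * (eventWeight ψ L P * eventWeight ψ L Q)) := by ring
    _ ≤ _ := h1.trans (h3.trans h4)
    _ = _ := by ring

end LowerBound

/-! ### Mixing -/

section Mixing

variable {X B : Type*} [TopologicalSpace X] [MeasurableSpace X] [BorelSpace X] [Fintype B]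
  {σ : X → X} {ζ : X → B} (hσ : Continuous σ) (hζ : IsLocallyConstant ζ)
  {ψ : List B → ℝ} {p₀ p₁ R : ℕ} {c : ℝ} (hψ : IsGluingFamily ψ p₀ p₁ R c)
  {pt : List B → X} (hpt : ∀ w, ψ w ≠ 0 → itinerary σ ζ w.length (pt w) = w)
include hσ hζ hψ hpt

/-- Pigeonhole: an orbit average is a mean over positions, so some position carries at least the
mean, up to the `N` last positions where the word no longer fits. This replaces an upper bound of
`μ` by `ψ`. -/
theorem exists_shifted_eventWeight_ge {N L : ℕ} (hN : N ≤ L) (hL : 0 < L) (P : List B → Prop) :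
    ∃ j, j + N ≤ L ∧
      (orbitAverage σ (sampleMeasure ψ pt L) L).real {x | P (itinerary σ ζ N x)} - N / L ≤
        eventWeight ψ L (fun u => P ((u.drop j).take N)) := by
  have hm := measurableSet_itinerary hσ hζ
  have hP := isProbabilityMeasure_sampleMeasure hψ.nonneg hψ.sum_eq_one pt L
  have hsum := mul_measureReal_orbitAverage hσ (sampleMeasure ψ pt L) L (hm N P)
  set x := (orbitAverage σ (sampleMeasure ψ pt L) L).real {x | P (itinerary σ ζ N x)}
  have hL' : (0 : ℝ) < L := by exact_mod_cast hL
  by_contra! hcon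
  have hpos : 0 < x - N / L :=
    (eventWeight_nonneg hψ.nonneg L _).trans_lt (hcon 0 (by omega))
  have hx1 : x ≤ 1 := by
    have := isProbabilityMeasure_orbitAverage hσ (sampleMeasure ψ pt L) hL.ne'
    exact measureReal_le_one
  have hNL : N < L := by
    by_contra hge
    have : N = L := by omega
    rw [this, div_self hL'.ne'] at hpos
    linarith
  obtain ⟨J, rfl⟩ := Nat.exists_eq_add_of_le' hNL.le
  have hJ : 0 < J := by omega
  rw [Finset.sum_range_add] at hsum
  have h1 : ∑ j ∈ Finset.range J, (sampleMeasure ψ pt (J + N)).real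
      (σ^[j] ⁻¹' {x | P (itinerary σ ζ N x)}) < ∑ j ∈ Finset.range J, (x - N / (J + N : ℕ)) := by
    refine Finset.sum_lt_sum_of_nonempty ⟨0, by simpa using hJ⟩ fun j hj => ?_
    rw [Finset.mem_range] at hj
    rw [measureReal_sampleMeasure_preimage hψ.nonneg pt hpt (by omega) P hm]
    exact hcon j (by omega)
  have h2 : ∑ j ∈ Finset.range N, (sampleMeasure ψ pt (J + N)).real
      (σ^[J + j] ⁻¹' {x | P (itinerary σ ζ N x)}) ≤ ∑ j ∈ Finset.range N, (1 : ℝ) :=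
    Finset.sum_le_sum fun j _ => measureReal_le_one
  simp only [Finset.sum_const, Finset.card_range, nsmul_eq_mul, mul_one] at h1 h2
  have h3 : ((J + N : ℕ) : ℝ) * (x - N / (J + N : ℕ)) = (J + N : ℕ) * x - N := by
    rw [mul_sub, mul_div_cancel₀ _ hL'.ne']
  have h4 : 0 ≤ (N : ℝ) * (x - N / (J + N : ℕ)) := by positivity
  rw [Nat.cast_add J N, add_mul, ← Nat.cast_add] at h3
  linarith

variable {U : Ultrafilter ℕ} (hU : (U : Filter ℕ) ≤ atTop) {μ : Measure X} [IsProbabilityMeasure μ]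
  (hμ : MeasurePreserving σ μ μ)
  (hS : ∀ S : Set X, IsClopen S → Tendsto
    (fun n => (orbitAverage σ (sampleMeasure ψ pt (n + 1)) (n + 1)).real S) U (nhds (μ.real S)))
include hU hμ hS

theorem eventually_sum_measureReal_itinerary_ge (hR : 2 * p₁ ≤ R) {N₁ N₂ : ℕ}
    (P Q : List B → Prop) {ε : ℝ} (hε : 0 < ε) :
    ∀ᶠ n in atTop, c ^ 5 * (μ.real {x | P (itinerary σ ζ N₁ x)} *
        μ.real {x | Q (itinerary σ ζ N₂ x)}) - ε ≤
      (p₁ + 1) ^ 4 * ∑ i ∈ Finset.range (2 * (p₁ - p₀) + 1),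
        μ.real ({x | P (itinerary σ ζ N₁ x)} ∩ σ^[n + i] ⁻¹' {x | Q (itinerary σ ζ N₂ x)}) := by
  have hκ : 0 < c ^ 5 := pow_pos hψ.const_pos 5
  set δ := ε / (4 * c ^ 5) with hδ
  have hδ0 : 0 < δ := by positivity
  have hm := measurableSet_itinerary hσ hζ
  have e1 := (hS _ (isClopen_itinerary hσ hζ N₁ P)).eventually
    (lt_mem_nhds (sub_lt_self _ hδ0))
  have e2 := (hS _ (isClopen_itinerary hσ hζ N₂ Q)).eventually
    (lt_mem_nhds (sub_lt_self _ hδ0))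
  have e3 : ∀ N : ℕ, ∀ᶠ n : ℕ in (U : Filter ℕ), (N : ℝ) * (1 / ((n : ℝ) + 1)) < δ := by
    intro N
    have : Tendsto (fun n : ℕ => (N : ℝ) * (1 / ((n : ℝ) + 1))) atTop (nhds (N * 0)) :=
      (tendsto_one_div_add_atTop_nhds_zero_nat (𝕜 := ℝ)).const_mul _
    rw [mul_zero] at this
    exact hU (this.eventually (gt_mem_nhds hδ0))
  have e4 : ∀ᶠ n : ℕ in (U : Filter ℕ), N₁ + N₂ ≤ n := hU (eventually_ge_atTop _)
  obtain ⟨l, h1, h2, h3, h3', h4⟩ :=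
    (e1.and (e2.and ((e3 N₁).and ((e3 N₂).and e4)))).exists
  set L := l + 1 with hL
  obtain ⟨j, hj, hj'⟩ := exists_shifted_eventWeight_ge hσ hζ hψ hpt (N := N₁) (L := L)
    (by omega) (by omega) P
  obtain ⟨k, hk, hk'⟩ := exists_shifted_eventWeight_ge hσ hζ hψ hpt (N := N₂) (L := L)
    (by omega) (by omega) Q
  rw [mul_one_div] at h3 h3'
  have hLcast : ((L : ℕ) : ℝ) = l + 1 := by rw [hL]; push_cast; ring
  rw [hLcast] at hj' hk'
  set x := μ.real {x | P (itinerary σ ζ N₁ x)}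
  set y := μ.real {x | Q (itinerary σ ζ N₂ x)}
  have hx1 : x ≤ 1 := measureReal_le_one
  have hy1 : y ≤ 1 := measureReal_le_one
  have hx0 : 0 ≤ x := measureReal_nonneg
  have hy0 : 0 ≤ y := measureReal_nonneg
  have hp0 := eventWeight_nonneg hψ.nonneg L (fun u => P ((u.drop j).take N₁))
  have hq0 := eventWeight_nonneg hψ.nonneg L (fun u => Q ((u.drop k).take N₂))
  have hp : x - 2 * δ ≤ eventWeight ψ L (fun u => P ((u.drop j).take N₁)) := by linarith
  have hq : y - 2 * δ ≤ eventWeight ψ L (fun u => Q ((u.drop k).take N₂)) := by linarith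
  -- Since `x, y ≤ 1`, lowering both by `2 * δ` lowers the product by at most `4 * δ`; if either
  -- number is below `2 * δ` the bound is trivial.
  have hprod : x * y - 4 * δ ≤ eventWeight ψ L (fun u => P ((u.drop j).take N₁)) *
      eventWeight ψ L (fun u => Q ((u.drop k).take N₂)) := by
    rcases le_total x (2 * δ) with hx | hx
    · nlinarith [mul_nonneg hp0 hq0]
    rcases le_total y (2 * δ) with hy | hy
    · nlinarith [mul_nonneg hp0 hq0]
    have := mul_le_mul hp hq (by linarith) hp0
    nlinarith
  have hfin : c ^ 5 * (x * y) - ε ≤ c ^ 5 * (eventWeight ψ L (fun u => P ((u.drop j).take N₁)) *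
      eventWeight ψ L (fun u => Q ((u.drop k).take N₂))) := by
    have h5 := mul_le_mul_of_nonneg_left hprod hκ.le
    have h6 : c ^ 5 * (4 * δ) = ε := by
      rw [hδ, ← mul_assoc, mul_comm _ (4 : ℝ), mul_div_cancel₀ _ (by positivity)]
    linarith
  -- As `k ≤ L`, this leaves a distance `n + j - k ≥ L + 2 * p₀` between the two `L`-blocks.
  -- Invariance under `σ^[j]` then gives the distance `n` between the original events.
  filter_upwards [eventually_ge_atTop (2 * L + 2 * p₀)] with n hn
  refine hfin.trans ((eventWeight_mul_le_sum_measureReal hσ hζ hψ hpt hU hS hR L (n + j - k)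
    (by omega) _ _).trans (le_of_eq ?_))
  congr 1
  refine Finset.sum_congr rfl fun i _ => ?_
  have e : {x | P (((itinerary σ ζ L x).drop j).take N₁)} ∩
      σ^[n + j - k + i] ⁻¹' {x | Q (((itinerary σ ζ L x).drop k).take N₂)} =
      σ^[j] ⁻¹' ({x | P (itinerary σ ζ N₁ x)} ∩
        σ^[n + i] ⁻¹' {x | Q (itinerary σ ζ N₂ x)}) := by
    ext x
    simp only [Set.mem_inter_iff, Set.mem_ofPred_eq, Set.mem_preimage,
      take_drop_itinerary σ ζ hj, take_drop_itinerary σ ζ hk, ← Function.iterate_add_apply]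
    rw [show k + (n + j - k + i) = n + i + j by omega]
  rw [e, (hμ.iterate j).measureReal_preimage]
  exact ((hm N₁ P).inter ((hσ.iterate _).measurable (hm N₂ Q))).nullMeasurableSet

end Mixing

/-! ### Passage from clopen to Borel sets, ergodicity, and lower limits -/

section Approximation

variable {X : Type*} [TopologicalSpace X] [MeasurableSpace X] [BorelSpace X]

theorem exists_isClopen_measureReal_symmDiff_lt
    (hgen : ‹MeasurableSpace X› = MeasurableSpace.generateFrom {S : Set X | IsClopen S})
    (μ : Measure X) [IsFiniteMeasure μ] {S : Set X} (hS : MeasurableSet S) {ε : ℝ} (hε : 0 < ε) :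
    ∃ T, IsClopen T ∧ μ.real (symmDiff S T) < ε := by
  have halg : IsSetAlgebra {S : Set X | IsClopen S} :=
    ⟨isClopen_empty, fun S hS => hS.compl, fun S T hS hT => hS.union hT⟩
  obtain ⟨T, hT, hlt⟩ := (Measure.MeasureDense.of_generateFrom_isSetAlgebra_finite (μ := μ) halg
    hgen).approx S hS (measure_ne_top μ S) ε hε
  refine ⟨T, hT, ?_⟩
  rw [measureReal_def]
  exact (ENNReal.toReal_lt_of_lt_ofReal hlt)

theorem measureReal_le_add_symmDiff (μ : Measure X) [IsFiniteMeasure μ] (S T : Set X) :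
    μ.real T ≤ μ.real S + μ.real (symmDiff S T) :=
  (measureReal_mono (by
    intro x hx; by_cases h : x ∈ S; exacts [Or.inl h, Or.inr (Or.inr ⟨hx, h⟩)])).trans
    (measureReal_union_le _ _)

/-- Lower bounds on correlations extend from clopen sets to Borel sets. -/
theorem eventually_sum_measureReal_ge_of_isClopen
    (hgen : ‹MeasurableSpace X› = MeasurableSpace.generateFrom {S : Set X | IsClopen S})
    {σ : X → X} {μ : Measure X} [IsProbabilityMeasure μ] (hμ : MeasurePreserving σ μ μ)
    {κ K : ℝ} (hκ : 0 ≤ κ) (hK : 0 ≤ K) {q : ℕ}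
    (h : ∀ S T : Set X, IsClopen S → IsClopen T → ∀ ε : ℝ, 0 < ε → ∀ᶠ n in atTop,
      κ * (μ.real S * μ.real T) - ε ≤ K * ∑ i ∈ Finset.range q, μ.real (S ∩ σ^[n + i] ⁻¹' T))
    {S T : Set X} (hS : MeasurableSet S) (hT : MeasurableSet T) {ε : ℝ} (hε : 0 < ε) :
    ∀ᶠ n in atTop, κ * (μ.real S * μ.real T) - ε ≤
      K * ∑ i ∈ Finset.range q, μ.real (S ∩ σ^[n + i] ⁻¹' T) := by
  -- The three terms pay for replacing the sets in the product, for replacing them in the `q`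
  -- correlations, and for the error in the clopen estimate.
  set δ := ε / (2 * κ + 2 * (K * q) + 1) with hδ
  have hD : 0 < 2 * κ + 2 * (K * q) + 1 := by positivity
  have hδ0 : 0 < δ := by positivity
  obtain ⟨S', hS', hSS'⟩ := exists_isClopen_measureReal_symmDiff_lt hgen μ hS hδ0
  obtain ⟨T', hT', hTT'⟩ := exists_isClopen_measureReal_symmDiff_lt hgen μ hT hδ0
  filter_upwards [h S' T' hS' hT' δ hδ0] with n hn
  have hSm := hS'.isOpen.measurableSet
  have hTm := hT'.isOpen.measurableSet
  have h1 : ∀ i ∈ Finset.range q, μ.real (S' ∩ σ^[n + i] ⁻¹' T') ≤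
      μ.real (S ∩ σ^[n + i] ⁻¹' T) + 2 * δ := by
    intro i _
    have hsub : S' ∩ σ^[n + i] ⁻¹' T' ⊆ ((S ∩ σ^[n + i] ⁻¹' T) ∪ symmDiff S S') ∪
        σ^[n + i] ⁻¹' (symmDiff T T') := by
      rintro x ⟨hx1, hx2⟩
      by_cases hxS : x ∈ S
      · by_cases hxT : σ^[n + i] x ∈ T
        · exact Or.inl (Or.inl ⟨hxS, hxT⟩)
        · exact Or.inr (Or.inr ⟨hx2, hxT⟩)
      · exact Or.inl (Or.inr (Or.inr ⟨hx1, hxS⟩))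
    have h2 := (measureReal_mono (μ := μ) hsub).trans ((measureReal_union_le _ _).trans
      (add_le_add_left (measureReal_union_le _ _) _))
    rw [(hμ.iterate _).measureReal_preimage (hT.symmDiff hTm).nullMeasurableSet] at h2
    linarith
  have h2 := Finset.sum_le_sum h1
  rw [Finset.sum_add_distrib, Finset.sum_const, Finset.card_range, nsmul_eq_mul] at h2
  have h3 := mul_le_mul_of_nonneg_left h2 hK
  have b1 := measureReal_le_add_symmDiff μ S' S
  have b2 := measureReal_le_add_symmDiff μ T' T
  rw [symmDiff_comm] at b1 b2
  have c1 : μ.real S ≤ 1 := measureReal_le_one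
  have c2 : μ.real T' ≤ 1 := measureReal_le_one
  have c3 : 0 ≤ μ.real S := measureReal_nonneg
  have c4 : 0 ≤ μ.real T' := measureReal_nonneg
  have h4 : μ.real S * μ.real T ≤ μ.real S' * μ.real T' + 2 * δ := by nlinarith
  have h5 := mul_le_mul_of_nonneg_left h4 hκ
  have h6 : δ * (2 * κ + 2 * (K * q) + 1) = ε := div_mul_cancel₀ _ hD.ne'
  nlinarith

/-- For an invariant set and its complement all correlations vanish, so the product of their
measures is zero. -/
theorem ergodic_of_eventually_sum_measureReal_ge {σ : X → X} {μ : Measure X}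
    [IsProbabilityMeasure μ] (hμ : MeasurePreserving σ μ μ) {κ K : ℝ} (hκ : 0 < κ) {q : ℕ}
    (h : ∀ S T : Set X, MeasurableSet S → MeasurableSet T → ∀ ε : ℝ, 0 < ε → ∀ᶠ n in atTop,
      κ * (μ.real S * μ.real T) - ε ≤ K * ∑ i ∈ Finset.range q, μ.real (S ∩ σ^[n + i] ⁻¹' T)) :
    Ergodic σ μ := by
  refine ⟨hμ, ⟨fun S hS hinv => ?_⟩⟩
  have hprod : κ * (μ.real S * μ.real Sᶜ) ≤ 0 := by
    refine le_of_forall_pos_le_add fun ε hε => ?_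
    obtain ⟨n, hn⟩ := (h S Sᶜ hS hS.compl ε hε).exists
    have hz : ∀ i ∈ Finset.range q, μ.real (S ∩ σ^[n + i] ⁻¹' Sᶜ) = 0 := by
      intro i _
      have : σ^[n + i] ⁻¹' S = S := by
        induction n + i with
        | zero => rfl
        | succ k ih => rw [Function.iterate_succ, Set.preimage_comp, ih, hinv]
      rw [Set.preimage_compl, this, Set.inter_compl_self, measureReal_empty]
    rw [Finset.sum_eq_zero hz] at hn
    linarith
  have h0 : μ.real S * μ.real Sᶜ = 0 :=
    le_antisymm (nonpos_of_mul_nonpos_right hprod hκ)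
      (mul_nonneg measureReal_nonneg measureReal_nonneg)
  rw [eventuallyConst_set']
  rcases mul_eq_zero.1 h0 with h0 | h0
  · left
    rw [ae_eq_empty]
    exact (measureReal_eq_zero_iff).1 h0
  · right
    rw [ae_eq_univ]
    exact (measureReal_eq_zero_iff).1 h0

theorem mul_le_liminf_of_eventually {σ : X → X} {μ : Measure X}
    [IsProbabilityMeasure μ] {κ K : ℝ} (hκ : 0 < κ) (hK : 0 < K) {q : ℕ}
    (h : ∀ S T : Set X, MeasurableSet S → MeasurableSet T → ∀ ε : ℝ, 0 < ε → ∀ᶠ n in atTop,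
      κ * (μ.real S * μ.real T) - ε ≤ K * ∑ i ∈ Finset.range q, μ.real (S ∩ σ^[n + i] ⁻¹' T)) :
    ∃ c : ℝ≥0, 0 < c ∧ ∀ S T : Set X, MeasurableSet S → MeasurableSet T →
      (c : ℝ≥0∞) * μ S * μ T ≤ liminf (fun n : ℕ => ∑ i ∈ Finset.range q,
        μ (S ∩ σ^[n + i] ⁻¹' T)) atTop := by
  refine ⟨(κ / K).toNNReal, Real.toNNReal_pos.2 (div_pos hκ hK), fun S T hS hT => ?_⟩
  have e : ((κ / K).toNNReal : ℝ≥0∞) * μ S * μ T =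
      ENNReal.ofReal (κ / K * (μ.real S * μ.real T)) := by
    rw [ENNReal.ofReal_mul (div_pos hκ hK).le, ENNReal.ofReal_mul measureReal_nonneg,
      ofReal_measureReal, ofReal_measureReal, mul_assoc]
    rfl
  rw [e]
  refine le_of_forall_lt fun b hb => ?_
  obtain ⟨b', hb1, hb2⟩ := exists_between hb
  refine hb1.trans_le (le_liminf_of_le (by isBoundedDefault) ?_)
  have hb'top : b' ≠ ∞ := (hb2.trans ENNReal.ofReal_lt_top).ne
  have hlt : b'.toReal < κ / K * (μ.real S * μ.real T) := by
    rwa [← ENNReal.ofReal_toReal hb'top, ENNReal.ofReal_lt_ofReal_iff_of_nonneg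
      ENNReal.toReal_nonneg] at hb2
  rw [div_mul_eq_mul_div, lt_div_iff₀ hK] at hlt
  filter_upwards [h S T hS hT _ (sub_pos.2 hlt)] with n hn
  rw [← ENNReal.ofReal_toReal hb'top]
  refine ENNReal.ofReal_le_of_le_toReal ?_
  rw [ENNReal.toReal_sum (fun i _ => measure_ne_top μ _)]
  have : b'.toReal * K ≤ (∑ i ∈ Finset.range q, μ.real (S ∩ σ^[n + i] ⁻¹' T)) * K := by linarith
  exact le_of_mul_le_mul_right this hK

end Approximation

/-! ### Uniqueness -/

section KLEvent

variable {B : Type*} [Fintype B]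

/-- A bound on relative entropy forces events that are small for `ψ` to be small for `p`. -/
theorem eventWeight_mul_log_le {n : ℕ} {p ψ : List B → ℝ} (hp : ∀ w, 0 ≤ p w)
    (hψ : ∀ w, 0 ≤ ψ w) (hpsum : ∑ w ∈ words B n, p w = 1) (hψsum : ∑ w ∈ words B n, ψ w = 1)
    (hpψ : ∀ w ∈ words B n, ψ w = 0 → p w = 0) (P : List B → Prop) {q : ℝ} (hq : 0 < q)
    (hle : eventWeight ψ n P ≤ q) :
    eventWeight p n P * -Real.log q ≤ klSum n p ψ + Real.log 2 := by
  classical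
  -- The reference weight is half of `ψ`, magnified by `1 / q` on the event. Its mass is at most
  -- `1/2 + 1/2` because the event has `ψ`-mass at most `q`, and Gibbs' inequality against it brings
  -- out `log q` on the event.
  let r : List B → ℝ := fun w => if P w then ψ w / (2 * q) else ψ w / 2
  have key := gibbs_inequality (words B n) p r (fun w _ => hp w) (fun w _ => ?_) ?_ ?_
  · have e : ∑ w ∈ words B n, p w * (Real.log (p w) - Real.log (r w)) =
        klSum n p ψ + Real.log 2 * ∑ w ∈ words B n, p w + eventWeight p n P * Real.log q := by
      rw [klSum, eventWeight, Finset.mul_sum, Finset.sum_mul, ← Finset.sum_add_distrib,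
        ← Finset.sum_add_distrib]
      refine Finset.sum_congr rfl fun w hw => ?_
      by_cases h0 : p w = 0
      · simp [h0]
      have hne : ψ w ≠ 0 := fun h => h0 (hpψ w hw h)
      by_cases hP : P w
      · simp only [r, if_pos hP]
        rw [Real.log_div hne (by positivity), Real.log_mul two_ne_zero hq.ne']
        ring
      · simp only [r, if_neg hP]
        rw [Real.log_div hne two_ne_zero]
        ring
    rw [e, hpsum] at key
    linarith
  · simp only [r]
    split_ifs
    · exact div_nonneg (hψ w) (by positivity)
    · exact div_nonneg (hψ w) two_pos.le
  · intro w hw h0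
    refine hpψ w hw ?_
    simp only [r] at h0
    split_ifs at h0
    · exact (div_eq_zero_iff.1 h0).resolve_right (by positivity)
    · exact (div_eq_zero_iff.1 h0).resolve_right two_ne_zero
  · have e : ∑ w ∈ words B n, r w ≤ eventWeight ψ n P / (2 * q) + (∑ w ∈ words B n, ψ w) / 2 := by
      rw [eventWeight, Finset.sum_div, Finset.sum_div, ← Finset.sum_add_distrib]
      refine Finset.sum_le_sum fun w _ => ?_
      simp only [r]
      split_ifs
      · linarith [hψ w]
      · simp
    have e2 : eventWeight ψ n P / (2 * q) ≤ 1 / 2 := by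
      rw [div_le_div_iff₀ (by positivity) two_pos]; linarith
    rw [hψsum] at e
    rw [hpsum]
    linarith

end KLEvent

section AbsolutelyContinuous

variable {X B : Type*} [TopologicalSpace X] [MeasurableSpace X] [BorelSpace X] [Fintype B]
  {σ : X → X} {ζ : X → B}

theorem eventWeight_itineraryDist (hσ : Continuous σ) (hζ : IsLocallyConstant ζ) (η : Measure X)
    [IsFiniteMeasure η] (n : ℕ) (P : List B → Prop) :
    eventWeight (itineraryDist η σ ζ) n P = η.real {x | P (itinerary σ ζ n x)} := by
  classical
  have := sum_measureReal_itinerary hσ hζ η n ((words B n).filter P) Set.univ MeasurableSet.univ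
  simp only [Set.univ_inter, Finset.mem_filter, mem_words, length_itinerary, true_and] at this
  rw [← this, eventWeight, Finset.sum_filter]
  refine Finset.sum_congr rfl fun w hw => ?_
  by_cases hP : P w
  · rw [if_pos hP, if_pos hP, itineraryDist, mem_words.1 hw]
  · rw [if_neg hP, if_neg hP]

/-- If `η S > 0 = μ S`, a clopen approximation of `S` is an event on words, up to a shift, that is
tiny for `μ`, hence for `ψ`, but not for `η`. A relative entropy bounded independently of the length
rules this out. -/
theorem absolutelyContinuous_of_klSum_le (hσ : Continuous σ) (hζ : IsLocallyConstant ζ)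
    (hgen : ‹MeasurableSpace X› = MeasurableSpace.generateFrom {S : Set X | IsClopen S})
    (hdet : ∀ S : Set X, IsClopen S → ∃ k N, ∀ x y,
      itinerary σ ζ N x = itinerary σ ζ N y → (σ^[k] x ∈ S ↔ σ^[k] y ∈ S))
    {ψ : List B → ℝ} (hψ : ∀ w, 0 ≤ ψ w) (hψsum : ∀ n, ∑ w ∈ words B n, ψ w = 1)
    {μ η : Measure X} [IsProbabilityMeasure μ] [IsProbabilityMeasure η]
    (hμ : MeasurePreserving σ μ μ) (hη : MeasurePreserving σ η η)
    {K : ℝ} (hK : 0 < K)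
    (hle : ∀ n (P : List B → Prop), eventWeight ψ n P ≤ K * μ.real {x | P (itinerary σ ζ n x)})
    (hsupp : ∀ w, ψ w = 0 → itineraryDist η σ ζ w = 0)
    {D : ℝ} (hD : ∀ n, klSum n (itineraryDist η σ ζ) ψ ≤ D) : η ≪ μ := by
  refine Measure.AbsolutelyContinuous.mk fun S hS h0 => ?_
  rw [← measureReal_eq_zero_iff]
  by_contra hne
  set s := η.real S with hs
  have hs0 : 0 < s := lt_of_le_of_ne measureReal_nonneg (Ne.symm hne)
  set D' := max D 0 + Real.log 2 with hD'
  have hlog2 : 0 < Real.log 2 := Real.log_pos one_lt_two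
  have hD'0 : 0 < D' := by positivity
  -- Chosen so that `s / 2 * -log q = D' + 1` exceeds the available bound `D'`.
  set q := Real.exp (-(2 * (D' + 1) / s)) with hq
  have hq0 : 0 < q := Real.exp_pos _
  have hε : 0 < min (s / 2) (q / K) := lt_min (by positivity) (by positivity)
  -- Approximating with respect to `μ + η` controls both measures by one clopen set.
  obtain ⟨T, hT, hlt⟩ := exists_isClopen_measureReal_symmDiff_lt hgen (μ + η) hS hε
  rw [measureReal_add_apply] at hlt
  have hμT := measureReal_le_add_symmDiff μ S T
  have hηT := measureReal_le_add_symmDiff η T S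
  rw [symmDiff_comm] at hηT
  have b1 : 0 ≤ μ.real (symmDiff S T) := measureReal_nonneg
  have b2 : 0 ≤ η.real (symmDiff S T) := measureReal_nonneg
  have hμS : μ.real S = 0 := (measureReal_eq_zero_iff).2 h0
  have c1 : μ.real T ≤ q / K := by linarith [min_le_right (s / 2) (q / K)]
  have c2 : s / 2 ≤ η.real T := by linarith [min_le_left (s / 2) (q / K)]
  obtain ⟨k, N, hkN⟩ := hdet T hT
  -- Because `σ^[k] x ∈ T` depends only on the `N`-word of `x`, asking it of some point with that
  -- word expresses it as a property of words.
  have hset : {x | ∃ y, itinerary σ ζ N y = itinerary σ ζ N x ∧ σ^[k] y ∈ T} = σ^[k] ⁻¹' T := by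
    ext x
    constructor
    · rintro ⟨y, hy, hyT⟩
      exact (hkN y x hy).1 hyT
    · intro hx
      exact ⟨x, rfl, hx⟩
  have hTm := hT.isOpen.measurableSet.nullMeasurableSet (μ := μ)
  have hTm' := hT.isOpen.measurableSet.nullMeasurableSet (μ := η)
  have h1 := hle N (fun w => ∃ y, itinerary σ ζ N y = w ∧ σ^[k] y ∈ T)
  rw [hset, (hμ.iterate k).measureReal_preimage hTm] at h1
  have h2 : K * μ.real T ≤ q := by rwa [le_div_iff₀ hK, mul_comm] at c1
  have h3 := eventWeight_mul_log_le (n := N) (itineraryDist_nonneg (σ := σ) (ζ := ζ) η) hψ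
    (sum_itineraryDist hσ hζ η N) (hψsum N) (fun w _ => hsupp w)
    (fun w => ∃ y, itinerary σ ζ N y = w ∧ σ^[k] y ∈ T) hq0 (h1.trans h2)
  rw [eventWeight_itineraryDist hσ hζ, hset, (hη.iterate k).measureReal_preimage hTm', hq,
    Real.log_exp, neg_neg] at h3
  have h4 : klSum N (itineraryDist η σ ζ) ψ ≤ max D 0 := (hD N).trans (le_max_left _ _)
  have h5 : s / 2 * (2 * (D' + 1) / s) ≤ η.real T * (2 * (D' + 1) / s) :=
    mul_le_mul_of_nonneg_right c2 (by positivity)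
  have h6 : s / 2 * (2 * (D' + 1) / s) = D' + 1 := by field_simp
  linarith

end AbsolutelyContinuous

/-! ### Existence, uniqueness and mixing for coded systems -/

namespace IsCodedSystem

variable {X B : Type*} [TopologicalSpace X] [CompactSpace X] [T2Space X] [MeasurableSpace X]
  [BorelSpace X] [Nonempty X] [Fintype B] [DecidableEq B] {σ : X → X} {ζ : ℕ → X → B}
  {g : ℕ → B → B} {f : C(X, ℝ)} {a : ℕ → ℝ} {p₀ p₁ : ℕ} {C : ℝ}

theorem exists_unique_equilibrium (h : IsCodedSystem σ ζ g f a p₀ p₁ C) (m : ℕ) :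
    ∃ μ : Measure X, IsProbabilityMeasure μ ∧ MeasurePreserving σ μ μ ∧
      (∀ η : Measure X, IsProbabilityMeasure η → MeasurePreserving σ η η →
        codedFreeEnergy σ ζ f a m η ≤ codedFreeEnergy σ ζ f a m μ) ∧
      (∀ η : Measure X, IsProbabilityMeasure η → MeasurePreserving σ η η →
        codedFreeEnergy σ ζ f a m μ ≤ codedFreeEnergy σ ζ f a m η → η = μ) ∧
      Ergodic σ μ ∧
      ∃ c : ℝ≥0, 0 < c ∧ ∀ S T : Set X, MeasurableSet S → MeasurableSet T →
        (c : ℝ≥0∞) * μ S * μ T ≤ liminf (fun n : ℕ => ∑ i ∈ Finset.range (2 * (p₁ - p₀) + 1),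
          μ (S ∩ σ^[n + i] ⁻¹' T)) atTop := by
  have hσ := h.continuous
  have hζ := h.isLocallyConstant_zero
  obtain ⟨c, hψ⟩ := exists_isGluingFamily f h.coeff_pos h.coeff_nonneg g m h.variation
    h.specification
  obtain ⟨pt, hpt⟩ := h.exists_points m
  obtain ⟨z, D, hz⟩ := h.exists_pressure m
  set ψ := chainWeight g (levelWeight g a (expWeight σ (ζ 0) f (a 0))) m 0 with hψdef
  have hsample := isProbabilityMeasure_sampleMeasure hψ.nonneg hψ.sum_eq_one pt
  obtain ⟨U, hU, μ, hμP, hf, hS⟩ := exists_ultrafilter_tendsto_measure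
    (fun n => orbitAverage σ (sampleMeasure ψ pt (n + 1)) (n + 1))
    (fun n => isProbabilityMeasure_orbitAverage hσ _ (Nat.succ_ne_zero n))
  have hμ : MeasurePreserving σ μ μ := measurePreserving_of_tendsto_orbitAverage hσ h.generateFrom
    (fun n => hsample (n + 1)) hU hS
  have hlow : z ≤ codedFreeEnergy σ ζ f a m μ :=
    h.le_codedFreeEnergy_of_tendsto hpt (fun n => (hz n).1)
      (ν := fun n => sampleMeasure ψ pt (n + 1)) (fun n => rfl) hU hμ (hf f) hS
  -- The bounded error `D` disappears after division by `n`.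
  have hup : ∀ η : Measure X, IsProbabilityMeasure η → MeasurePreserving σ η η →
      codedFreeEnergy σ ζ f a m η ≤ z := by
    intro η hηP hη
    refine le_of_forall_pos_le_add fun ε hε => ?_
    obtain ⟨n, hn⟩ := exists_nat_gt (max D 0 / ε)
    have hn0 : (0 : ℝ) < n := (by positivity : 0 ≤ max D 0 / ε).trans_lt hn
    have h1 := h.codedFreeEnergy_add_klSum_le hη m n
    have h2 := mul_nonneg h.coeff_pos.le h1.2
    rw [div_lt_iff₀ hε] at hn
    rw [← mul_le_mul_iff_right₀ hn0]
    linarith [h1.1, (hz n).2, le_max_left D 0]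
  have hmixC : ∀ S T : Set X, IsClopen S → IsClopen T → ∀ ε : ℝ, 0 < ε → ∀ᶠ n in atTop,
      c ^ 5 * (μ.real S * μ.real T) - ε ≤ (p₁ + 1) ^ 4 *
        ∑ i ∈ Finset.range (2 * (p₁ - p₀) + 1), μ.real (S ∩ σ^[n + i] ⁻¹' T) := by
    intro S T hSc hTc ε hε
    obtain ⟨k₁, N₁, h₁⟩ := h.determined S hSc
    obtain ⟨k₂, N₂, h₂⟩ := h.determined T hTc
    have hset₁ : {x | ∃ y, itinerary σ (ζ 0) N₁ y = itinerary σ (ζ 0) N₁ x ∧ σ^[k₁] y ∈ S} =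
        σ^[k₁] ⁻¹' S := by
      ext x
      exact ⟨fun ⟨y, hy, hyS⟩ => (h₁ y x hy).1 hyS, fun hx => ⟨x, rfl, hx⟩⟩
    have hset₂ : {x | ∃ y, itinerary σ (ζ 0) N₂ y = itinerary σ (ζ 0) N₂ x ∧ σ^[k₂] y ∈ T} =
        σ^[k₂] ⁻¹' T := by
      ext x
      exact ⟨fun ⟨y, hy, hyT⟩ => (h₂ y x hy).1 hyT, fun hx => ⟨x, rfl, hx⟩⟩
    have key := eventually_sum_measureReal_itinerary_ge hσ hζ hψ hpt hU hμ hS le_rfl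
      (fun w => ∃ y, itinerary σ (ζ 0) N₁ y = w ∧ σ^[k₁] y ∈ S)
      (fun w => ∃ y, itinerary σ (ζ 0) N₂ y = w ∧ σ^[k₂] y ∈ T) hε (N₁ := N₁) (N₂ := N₂)
    rw [hset₁, hset₂] at key
    have hSm := hSc.isOpen.measurableSet
    have hTm := hTc.isOpen.measurableSet
    rw [(hμ.iterate _).measureReal_preimage hSm.nullMeasurableSet,
      (hμ.iterate _).measureReal_preimage hTm.nullMeasurableSet] at key
    -- The two clopen sets become word events only after shifts by `k₁` and `k₂`, so the distance
    -- between the events is corrected by `k₁ - k₂`.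
    have hshift : Tendsto (fun n : ℕ => n + k₁ - k₂) atTop atTop :=
      (tendsto_sub_atTop_nat k₂).comp (tendsto_add_atTop_nat k₁)
    filter_upwards [hshift.eventually key, eventually_ge_atTop k₂] with n hn hnk
    refine hn.trans (le_of_eq ?_)
    congr 1
    refine Finset.sum_congr rfl fun i _ => ?_
    have e : σ^[k₁] ⁻¹' S ∩ σ^[n + k₁ - k₂ + i] ⁻¹' (σ^[k₂] ⁻¹' T) =
        σ^[k₁] ⁻¹' (S ∩ σ^[n + i] ⁻¹' T) := by
      ext x
      simp only [Set.mem_inter_iff, Set.mem_preimage, ← Function.iterate_add_apply]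
      rw [show k₂ + (n + k₁ - k₂ + i) = n + i + k₁ by omega]
    rw [e, (hμ.iterate _).measureReal_preimage]
    exact (hSm.inter ((hσ.iterate _).measurable hTm)).nullMeasurableSet
  have hκ : 0 < c ^ 5 := pow_pos hψ.const_pos 5
  have hmix : ∀ S T : Set X, MeasurableSet S → MeasurableSet T → ∀ ε : ℝ, 0 < ε →
      ∀ᶠ n in atTop, c ^ 5 * (μ.real S * μ.real T) - ε ≤ (p₁ + 1) ^ 4 *
        ∑ i ∈ Finset.range (2 * (p₁ - p₀) + 1), μ.real (S ∩ σ^[n + i] ⁻¹' T) :=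
    fun S T hSm hTm ε hε => eventually_sum_measureReal_ge_of_isClopen h.generateFrom hμ hκ.le
      (by positivity) hmixC hSm hTm hε
  have herg := ergodic_of_eventually_sum_measureReal_ge hμ hκ hmix
  refine ⟨μ, hμP, hμ, fun η hηP hη => (hup η hηP hη).trans hlow, fun η hηP hη hle => ?_, herg,
    mul_le_liminf_of_eventually hκ (by positivity) hmix⟩
  -- An invariant probability measure absolutely continuous with respect to an ergodic one equals
  -- it; the remaining task is to bound the relative entropies of `η` by `D / a 0`.
  refine herg.eq_of_absolutelyContinuous hη ?_
  have hc3 : 0 < c ^ 3 := pow_pos hψ.const_pos 3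
  refine absolutelyContinuous_of_klSum_le hσ hζ h.generateFrom h.determined hψ.nonneg
    hψ.sum_eq_one hμ hη (K := (p₁ + 1) ^ 2 / c ^ 3) (by positivity) (fun n P => ?_) (fun w hw => ?_)
    (D := D / a 0) (fun n => ?_)
  · rw [div_mul_eq_mul_div, le_div_iff₀ hc3, mul_comm]
    exact eventWeight_le_measureReal hσ hζ hψ hpt hU hS le_rfl n P
  · have h0 : expWeight σ (ζ 0) f (a 0) w = 0 := by
      by_contra hne
      exact (h.isWeightChain.chainWeight_pos m (i := 0)
        ((expWeight_nonneg (σ := σ) (ζ := ζ 0) (a := a 0) f w).lt_of_ne' hne)).ne' hw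
    exact itineraryDist_eq_zero η h0 fun x => expWeight_pos f h.coeff_pos _ x
  · have h1 := (h.codedFreeEnergy_add_klSum_le hη m n).1
    have h2 : n * z ≤ n * codedFreeEnergy σ ζ f a m η :=
      mul_le_mul_of_nonneg_left (hlow.trans hle) (Nat.cast_nonneg n)
    rw [le_div_iff₀ h.coeff_pos, mul_comm]
    linarith [(hz n).2]

end IsCodedSystem

/-! ### Subshifts -/

section Subshift

variable {A G : Type*} [TopologicalSpace A] [AddMonoidWithOne G] (X : Subshift A G)

theorem iterate_shiftMap_apply (n : ℕ) (x : X.carrier) (h : G) :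
    ((shiftMap X)^[n] x).1 h = x.1 ((n : G) + h) := by
  induction n generalizing h with
  | zero => simp
  | succ n ih =>
    rw [Function.iterate_succ_apply']
    change ((shiftMap X)^[n] x).1 (1 + h) = _
    rw [ih, Nat.cast_succ, add_assoc]

theorem continuous_shiftMap : Continuous (shiftMap X) := by
  refine Continuous.subtype_mk ?_ _
  refine continuous_pi fun h => ?_
  exact (continuous_apply ((1 : G) + h)).comp continuous_subtype_val

variable [DiscreteTopology A]

theorem compactSpace_subshift [Finite A] : CompactSpace X.carrier :=
  isCompact_iff_compactSpace.1 X.isClosed.isCompact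

/-- A locally constant function on a subshift depends on finitely many coordinates. -/
theorem exists_finset_of_isLocallyConstant [Finite A] {D : Type*} {u : X.carrier → D}
    (hu : IsLocallyConstant u) :
    ∃ F : Finset G, ∀ x y : X.carrier, (∀ g ∈ F, x.1 g = y.1 g) → u x = u y := by
  classical
  have hX := compactSpace_subshift X
  have hloc : ∀ x : X.carrier, ∃ F : Finset G, ∀ y : X.carrier,
      (∀ g ∈ F, y.1 g = x.1 g) → u y = u x := by
    intro x
    obtain ⟨V, hV, hVeq⟩ := isOpen_induced_iff.1 (hu {u x})
    have hxV : x.1 ∈ V := by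
      have : x ∈ Subtype.val ⁻¹' V := by rw [hVeq]; rfl
      exact this
    obtain ⟨I, w, hw, hsub⟩ := isOpen_pi_iff.1 hV x.1 hxV
    refine ⟨I, fun y hy => ?_⟩
    have hyV : y.1 ∈ V := hsub fun g hg => by rw [hy g hg]; exact (hw g hg).2
    have : y ∈ u ⁻¹' {u x} := by rw [← hVeq]; exact hyV
    exact this
  choose F hF using hloc
  have hopen : ∀ x : X.carrier, IsOpen {y : X.carrier | ∀ g ∈ F x, y.1 g = x.1 g} := by
    intro x
    have : {y : X.carrier | ∀ g ∈ F x, y.1 g = x.1 g} =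
        ⋂ g ∈ F x, (fun y : X.carrier => y.1 g) ⁻¹' {x.1 g} := by
      ext y; simp
    rw [this]
    exact isOpen_biInter_finset fun g _ => (isOpen_discrete _).preimage
      ((continuous_apply g).comp continuous_subtype_val)
  obtain ⟨t, ht⟩ := isCompact_univ.elim_finite_subcover _ hopen
    (fun x _ => Set.mem_iUnion.2 ⟨x, fun g _ => rfl⟩)
  refine ⟨t.biUnion F, fun x y hxy => ?_⟩
  obtain ⟨z, hz, hxz⟩ := Set.mem_iUnion₂.1 (ht (Set.mem_univ x))
  have h1 := hF z x hxz
  have h2 := hF z y fun g hg => by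
    rw [← hxy g (Finset.mem_biUnion.2 ⟨z, hz, hg⟩)]
    exact hxz g hg
  rw [h1, h2]

/-- A single shift must move all of `F` into the nonnegative coordinates, so the shifts for the
individual elements are added up. -/
theorem exists_window_of_finset (hG : ∀ g : G, ∃ M j : ℕ, (M : G) + g = j) (F : Finset G) :
    ∃ M N : ℕ, ∀ g ∈ F, ∃ j ≤ N, (M : G) + g = (j : ℕ) := by
  classical
  induction F using Finset.induction_on with
  | empty => exact ⟨0, 0, by simp⟩
  | insert g F _ ih =>
    obtain ⟨M, N, h⟩ := ih
    obtain ⟨M', j', h'⟩ := hG g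
    refine ⟨M + M', N + M' + (M + j'), fun g' hg' => ?_⟩
    rcases Finset.mem_insert.1 hg' with rfl | hg'
    · refine ⟨M + j', by omega, ?_⟩
      rw [Nat.cast_add, add_assoc, h', Nat.cast_add]
    · obtain ⟨j, hj, e⟩ := h g' hg'
      refine ⟨M' + j, by omega, ?_⟩
      rw [add_comm M M', Nat.cast_add, add_assoc, e, Nat.cast_add]

/-- A locally constant function on a subshift depends, after a shift, on finitely many coordinates
in `ℕ`. -/
theorem exists_window_of_isLocallyConstant [Finite A] (hG : ∀ g : G, ∃ M j : ℕ, (M : G) + g = j)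
    {D : Type*} {u : X.carrier → D} (hu : IsLocallyConstant u) :
    ∃ M N : ℕ, ∀ x y : X.carrier, (∀ j : ℕ, j ≤ N → x.1 (j : G) = y.1 (j : G)) →
      u ((shiftMap X)^[M] x) = u ((shiftMap X)^[M] y) := by
  obtain ⟨F, hF⟩ := exists_finset_of_isLocallyConstant X hu
  obtain ⟨M, N, hMN⟩ := exists_window_of_finset hG F
  refine ⟨M, N, fun x y hxy => hF _ _ fun g hg => ?_⟩
  obtain ⟨j, hj, e⟩ := hMN g hg
  rw [iterate_shiftMap_apply, iterate_shiftMap_apply, e]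
  exact hxy j hj

theorem window_mono {D : Type*} {u : X.carrier → D} {M N M' N' : ℕ}
    (h : ∀ x y : X.carrier, (∀ j : ℕ, j ≤ N → x.1 (j : G) = y.1 (j : G)) →
      u ((shiftMap X)^[M] x) = u ((shiftMap X)^[M] y)) (hM : M ≤ M') (hN : N + M' ≤ N')
    {x y : X.carrier} (hxy : ∀ j : ℕ, j ≤ N' → x.1 (j : G) = y.1 (j : G)) :
    u ((shiftMap X)^[M'] x) = u ((shiftMap X)^[M'] y) := by
  obtain ⟨r, rfl⟩ := Nat.exists_eq_add_of_le hM
  rw [Function.iterate_add_apply, Function.iterate_add_apply]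
  refine h _ _ fun j hj => ?_
  rw [iterate_shiftMap_apply, iterate_shiftMap_apply, ← Nat.cast_add]
  exact hxy _ (by omega)

variable [Finite A] [MeasurableSpace A] [BorelSpace A] [Countable G]

theorem borelSpace_subshift : BorelSpace X.carrier := inferInstance

theorem generateFrom_isClopen_subshift :
    (inferInstance : MeasurableSpace X.carrier) =
      MeasurableSpace.generateFrom {S : Set X.carrier | IsClopen S} := by
  have := compactSpace_subshift X
  rw [(borelSpace_subshift X).measurable_eq]
  exact isTopologicalBasis_isClopen.borel_eq_generateFrom

end Subshift

/-- Two codings with the same level sets define the same partition; values that are not attained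
contribute `F ∅ = 0`. -/
theorem sum_fiber_eq_sum_fiber {X α β : Type*} {E₁ : X → α} {E₂ : X → β} {s : Finset α}
    {t : Finset β} (h₁ : ∀ x, E₁ x ∈ s) (h₂ : ∀ x, E₂ x ∈ t)
    (h : ∀ x y, E₁ x = E₁ y ↔ E₂ x = E₂ y) {F : Set X → ℝ} (hF : F ∅ = 0) :
    ∑ a ∈ s, F {x | E₁ x = a} = ∑ b ∈ t, F {x | E₂ x = b} := by
  have hne : ∀ a, F {x | E₁ x = a} ≠ 0 → ∃ x, E₁ x = a := by
    intro a ha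
    by_contra! hcon
    exact ha (by rw [show {x | E₁ x = a} = ∅ from Set.eq_empty_of_forall_notMem hcon, hF])
  have hset : ∀ x, {y | E₁ y = E₁ x} = {y | E₂ y = E₂ x} := fun x => Set.ext fun y => h y x
  refine Finset.sum_bij_ne_zero (fun a _ ha => E₂ (hne a ha).choose) (fun a _ ha => h₂ _) ?_ ?_ ?_
  · intro a _ ha b _ hb hab
    rw [← (hne a ha).choose_spec, ← (hne b hb).choose_spec]
    exact (h _ _).2 hab
  · intro b _ hb
    obtain ⟨x, rfl⟩ : ∃ x, E₂ x = b := by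
      by_contra! hcon
      exact hb (by rw [show {x | E₂ x = b} = ∅ from Set.eq_empty_of_forall_notMem hcon, hF])
    have hx : F {y | E₁ y = E₁ x} ≠ 0 := by rwa [hset x]
    exact ⟨E₁ x, h₁ x, hx, (h _ _).1 (hne _ hx).choose_spec⟩
  · intro a _ ha
    rw [← hset, (hne a ha).choose_spec]

/-! ### Codings of a tower of subshifts by windows of letters -/

section Tower

variable {m : ℕ} {A : Fin (m + 1) → Type*} {G : Type*} [∀ i, TopologicalSpace (A i)]
  [AddMonoidWithOne G] (X : ∀ i, Subshift (A i) G)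
  (π : ∀ i : Fin m, (X i.castSucc).carrier → (X i.succ).carrier)

theorem tower_zero : tower X π 0 = id := rfl

theorem tower_succ (i : Fin m) : tower X π i.succ = π i ∘ tower X π i.castSucc :=
  Fin.induction_succ _ _ i

variable (hπ : ∀ i, IsFactorMap (X i.castSucc) (X i.succ) (π i))
include hπ

theorem continuous_tower (i : Fin (m + 1)) : Continuous (tower X π i) := by
  induction i using Fin.induction with
  | zero => exact continuous_id
  | succ i ih => rw [tower_succ]; exact (hπ i).continuous.comp ih

theorem semiconj_tower (i : Fin (m + 1)) :
    Function.Semiconj (tower X π i) (shiftMap (X 0)) (shiftMap (X i)) := by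
  induction i using Fin.induction with
  | zero => exact Function.Semiconj.id_left
  | succ i ih => rw [tower_succ]; exact (hπ i).semiconj.comp_left ih

/-- The word read by `τ_i x` at the coordinates `i M, …, i M + (m - i) N + s`. -/
def towerWindow (M N s : ℕ) (i : Fin (m + 1)) (x : (X 0).carrier) :
    Fin ((m - i) * N + s + 1) → A i :=
  fun j => (tower X π i x).1 (((i * M + j : ℕ)) : G)

/-- The codings of the first subshift by the words of the subshifts of the tower. -/
def towerCoding (M N s : ℕ) (n : ℕ) (x : (X 0).carrier) :
    Option (Σ i : Fin (m + 1), (Fin ((m - i) * N + s + 1) → A i)) :=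
  if h : n < m + 1 then some ⟨⟨n, h⟩, towerWindow X π M N s ⟨n, h⟩ x⟩ else none

omit hπ in
theorem towerCoding_eq_iff (M N s : ℕ) (i : Fin (m + 1)) (x y : (X 0).carrier) :
    towerCoding X π M N s i x = towerCoding X π M N s i y ↔
      towerWindow X π M N s i x = towerWindow X π M N s i y := by
  rw [towerCoding, towerCoding, dif_pos i.2, dif_pos i.2]
  simp

omit hπ in
theorem towerWindow_eq_iff (M N s : ℕ) (i : Fin (m + 1)) (x y : (X 0).carrier) :
    towerWindow X π M N s i x = towerWindow X π M N s i y ↔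
      ∀ j : ℕ, j ≤ (m - i) * N + s → (tower X π i x).1 (((i * M + j : ℕ)) : G) =
        (tower X π i y).1 (((i * M + j : ℕ)) : G) := by
  constructor
  · intro h j hj
    exact congrFun h ⟨j, by omega⟩
  · intro h
    funext j
    exact h j (by have := j.2; omega)

theorem tower_iterate_apply (i : Fin (m + 1)) (n : ℕ) (x : (X 0).carrier) (h : G) :
    (tower X π i ((shiftMap (X 0))^[n] x)).1 h = (tower X π i x).1 ((n : G) + h) := by
  rw [(semiconj_tower X π hπ i).iterate_right n x, iterate_shiftMap_apply]

/-- Consecutive windows overlap, so `n` of them together read one longer word. For `n = 0` the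
itinerary is empty and carries no information. -/
theorem itinerary_towerCoding_eq_iff (M N s : ℕ) (i : Fin (m + 1)) {n : ℕ} (hn : 0 < n)
    (x y : (X 0).carrier) :
    itinerary (shiftMap (X 0)) (towerCoding X π M N s i) n x =
      itinerary (shiftMap (X 0)) (towerCoding X π M N s i) n y ↔
    ∀ j : ℕ, j < n + ((m - i) * N + s) → (tower X π i x).1 (((i * M + j : ℕ)) : G) =
        (tower X π i y).1 (((i * M + j : ℕ)) : G) := by
  rw [itinerary_eq_iff]
  simp only [towerCoding_eq_iff, towerWindow_eq_iff, tower_iterate_apply X π hπ, ← Nat.cast_add]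
  constructor
  · intro h j hj
    by_cases hjn : j < n
    · have := h j hjn 0 (Nat.zero_le _)
      rwa [show j + (i * M + 0) = i * M + j by ring] at this
    · have := h (n - 1) (by omega) (j - (n - 1)) (by omega)
      rwa [show n - 1 + (i * M + (j - (n - 1))) = i * M + j by omega] at this
  · intro h k hk j hj
    have := h (k + j) (by omega)
    rwa [show i * M + (k + j) = k + (i * M + j) by ring] at this

end Tower

section TowerSystem

variable {m : ℕ} {A : Fin (m + 1) → Type*} {G : Type*} [∀ i, TopologicalSpace (A i)]
  [AddMonoidWithOne G] {X : ∀ i, Subshift (A i) G}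
  {π : ∀ i : Fin m, (X i.castSucc).carrier → (X i.succ).carrier}
  (hπ : ∀ i, IsFactorMap (X i.castSucc) (X i.succ) (π i)) {M N s : ℕ}
include hπ

theorem itinerary_towerCoding_zero_eq_iff {n : ℕ} (hn : 0 < n) (x y : (X 0).carrier) :
    itinerary (shiftMap (X 0)) (towerCoding X π M N s 0) n x =
      itinerary (shiftMap (X 0)) (towerCoding X π M N s 0) n y ↔
    ∀ j : ℕ, j < n + (m * N + s) → x.1 (j : G) = y.1 (j : G) := by
  have := itinerary_towerCoding_eq_iff X π hπ M N s 0 hn x y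
  simpa [tower_zero] using this

/-- A letter of level `i + 1` at a coordinate moved by `M` is a function of `N + 1` consecutive
letters of level `i`. The window moves by `M` and shrinks by `N` at each level, so that it always
suffices for the next one. -/
theorem towerCoding_succ_eq
    (hwin : ∀ (i : Fin m) (x y : (X i.castSucc).carrier),
      (∀ j : ℕ, j ≤ N → x.1 (j : G) = y.1 (j : G)) →
        (π i ((shiftMap (X i.castSucc))^[M] x)).1 0 = (π i ((shiftMap (X i.castSucc))^[M] y)).1 0)
    (n : ℕ) {x y : (X 0).carrier}
    (h : towerCoding X π M N s n x = towerCoding X π M N s n y) :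
    towerCoding X π M N s (n + 1) x = towerCoding X π M N s (n + 1) y := by
  by_cases hn : n < m
  · let i : Fin m := ⟨n, hn⟩
    have h' := (towerWindow_eq_iff X π M N s i.castSucc x y).1
      ((towerCoding_eq_iff X π M N s i.castSucc x y).1 h)
    refine (towerCoding_eq_iff X π M N s i.succ x y).2
      ((towerWindow_eq_iff X π M N s i.succ x y).2 fun j hj => ?_)
    have key : ∀ x : (X 0).carrier, (tower X π i.succ x).1 (((i.succ : ℕ) * M + j : ℕ) : G) =
        (π i ((shiftMap (X i.castSucc))^[M]
          ((shiftMap (X i.castSucc))^[n * M + j] (tower X π i.castSucc x)))).1 0 := by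
      intro x
      have e : (i.succ : ℕ) * M + j = M + (n * M + j) := by
        simp only [Fin.val_succ, i]
        ring
      rw [← Function.iterate_add_apply, (hπ i).semiconj.iterate_right, iterate_shiftMap_apply,
        tower_succ, add_zero, e]
      rfl
    rw [key, key]
    refine hwin i _ _ fun k hk => ?_
    rw [iterate_shiftMap_apply, iterate_shiftMap_apply, ← Nat.cast_add]
    have := h' (j + k) (by
      have e : m - n = m - (n + 1) + 1 := by omega
      simp only [Fin.val_succ, i] at hj
      simp only [Fin.val_castSucc, i]
      rw [e, add_mul]
      omega)
    simpa [i, add_assoc] using this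
  · have hn' : ¬ n + 1 < m + 1 := by omega
    rw [towerCoding, towerCoding, dif_neg hn', dif_neg hn']

theorem isLocallyConstant_towerCoding_zero [∀ i, DiscreteTopology (A i)] [∀ i, Finite (A i)] :
    IsLocallyConstant (towerCoding X π M N s 0) := by
  have h1 : Continuous (towerWindow X π M N s 0) := by
    refine continuous_pi fun j => ?_
    exact (continuous_apply _).comp
      (continuous_subtype_val.comp (continuous_tower X π hπ 0))
  have h2 : IsLocallyConstant (towerWindow X π M N s 0) :=
    (IsLocallyConstant.iff_continuous _).2 h1
  have h3 : towerCoding X π M N s 0 =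
      (fun w => some ⟨0, w⟩) ∘ towerWindow X π M N s 0 := by
    funext x
    rw [towerCoding, dif_pos (Nat.succ_pos m)]
    rfl
  rw [h3]
  exact h2.comp _

theorem hasBoundedVariation_towerCoding {f : C((X 0).carrier, ℝ)}
    {C : ℝ} (hC : 0 < C) (hf : ∀ n : ℕ, 1 ≤ n → ∀ x y : (X 0).carrier,
      (∀ j : ℕ, j < n → x.1 ((s : G) + (j : G)) = y.1 ((s : G) + (j : G))) →
      |∑ i ∈ Finset.range n, f ((shiftMap (X 0))^[i] x)
        - ∑ i ∈ Finset.range n, f ((shiftMap (X 0))^[i] y)| ≤ C) :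
    HasBoundedVariation (shiftMap (X 0)) (towerCoding X π M N s 0) f C := by
  intro n x y hxy
  rcases Nat.eq_zero_or_pos n with rfl | hn
  · simpa using hC.le
  · refine hf n hn x y fun j hj => ?_
    rw [← Nat.cast_add]
    exact (itinerary_towerCoding_zero_eq_iff hπ hn x y).1 hxy _ (by omega)

/-- An itinerary of length `n > 0` sees `n + ℓ` letters, with `ℓ = m * N + s`. The overhang of the
first block therefore counts as part of the gap, and both bounds on the gap grow by `ℓ` while their
difference is unchanged. -/
theorem hasSpecification_towerCoding {p₀ p : ℕ}
    (hX : ∀ I J : List (A 0), IsLegal (X 0) I → IsLegal (X 0) J →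
      ∃ K : List (A 0), p₀ ≤ K.length ∧ K.length ≤ p ∧ IsLegal (X 0) (I ++ K ++ J)) :
    HasSpecification (shiftMap (X 0)) (towerCoding X π M N s 0) (p₀ + (m * N + s))
      (p + (m * N + s)) := by
  set ℓ := m * N + s with hℓ
  have hword : ∀ (n : ℕ) (x : (X 0).carrier),
      IsLegal (X 0) (List.ofFn fun j : Fin n => x.1 ((j : ℕ) : G)) :=
    fun n x => ⟨x.1, x.2, 0, fun j hj => by simp⟩
  have hcod : ∀ (n : ℕ) (x y : (X 0).carrier),
      (∀ j : ℕ, j < n + ℓ → x.1 (j : G) = y.1 (j : G)) →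
      itinerary (shiftMap (X 0)) (towerCoding X π M N s 0) n x =
        itinerary (shiftMap (X 0)) (towerCoding X π M N s 0) n y := by
    intro n x y hxy
    rcases Nat.eq_zero_or_pos n with rfl | hn
    · simp [itinerary]
    · exact (itinerary_towerCoding_zero_eq_iff hπ hn x y).2 hxy
  intro n n' x y
  obtain ⟨K, hK₀, hK₁, z, hz, g, hzg⟩ := hX _ _ (hword (n + ℓ) x) (hword (n' + ℓ) y)
  refine ⟨⟨shift g z, (X 0).mapsTo g hz⟩, K.length + ℓ, by omega, by omega,
    hcod _ _ _ fun j hj => ?_, hcod _ _ _ fun j hj => ?_⟩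
  · have := hzg j (by simp; omega)
    rw [List.getElem_append_left (by simp; omega), List.getElem_append_left (by simp; omega)]
      at this
    simpa using this.symm
  · have := hzg (n + ℓ + K.length + j) (by simp; omega)
    rw [List.getElem_append_right (by simp)] at this
    rw [iterate_shiftMap_apply, ← Nat.cast_add]
    refine Eq.trans ?_ (this.symm.trans ?_)
    · change z (g + _) = _
      congr 3
      omega
    · simp

theorem determined_towerCoding [∀ i, DiscreteTopology (A i)] [∀ i, Finite (A i)]
    (hG : ∀ g : G, ∃ M j : ℕ, (M : G) + g = j) {S : Set (X 0).carrier} (hS : IsClopen S) :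
    ∃ k n, ∀ x y, itinerary (shiftMap (X 0)) (towerCoding X π M N s 0) n x =
      itinerary (shiftMap (X 0)) (towerCoding X π M N s 0) n y →
        ((shiftMap (X 0))^[k] x ∈ S ↔ (shiftMap (X 0))^[k] y ∈ S) := by
  have hu : IsLocallyConstant S.boolIndicator :=
    (IsLocallyConstant.iff_continuous _).2 ((continuous_boolIndicator_iff_isClopen S).2 hS)
  obtain ⟨k, n, h⟩ := exists_window_of_isLocallyConstant (X 0) hG hu
  refine ⟨k, n + 1, fun x y hxy => ?_⟩
  rw [Set.mem_iff_boolIndicator, Set.mem_iff_boolIndicator, h x y fun j hj => ?_]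
  exact (itinerary_towerCoding_zero_eq_iff hπ (Nat.succ_pos n) x y).1 hxy _ (by omega)

section Entropy

variable [∀ i, Fintype (A i)] [∀ i, DiscreteTopology (A i)] [∀ i, MeasurableSpace (A i)]
  [∀ i, BorelSpace (A i)] [Countable G] {μ : Measure (X 0).carrier}

/-- Both partitions have the same atoms up to the shift by `i * M`, which the invariance of `μ`
absorbs. -/
theorem cylinderEntropy_tower (hμ : MeasurePreserving (shiftMap (X 0)) μ μ)
    (i : Fin (m + 1)) {n : ℕ} (hn : 0 < n) :
    cylinderEntropy (X i) (μ.map (tower X π i)) (n + ((m - i) * N + s)) =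
      blockEntropy μ (shiftMap (X 0)) (towerCoding X π M N s i) n := by
  have hτ : Measurable (tower X π i) := (continuous_tower X π hπ i).measurable
  set k := n + ((m - i) * N + s) with hk
  let E : (X 0).carrier → (Fin k → A i) := fun x j => (tower X π i x).1 ((i * M + j : ℕ) : G)
  have h1 : ∀ I : Fin k → A i,
      (μ.map (tower X π i)).real {x | ∀ j : Fin k, x.1 ((j : ℕ) : G) = I j} =
        μ.real {x | E x = I} := by
    intro I
    have hmeas : MeasurableSet {x : (X i).carrier | ∀ j : Fin k, x.1 ((j : ℕ) : G) = I j} := by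
      rw [Set.ofPred_forall]
      exact MeasurableSet.iInter fun j => measurableSet_eq_fun
        ((measurable_pi_apply _).comp measurable_subtype_coe) measurable_const
    rw [measureReal_def, measureReal_def, Measure.map_apply hτ hmeas,
      ← (hμ.iterate (i * M)).measure_preimage (hτ hmeas).nullMeasurableSet]
    congr 2
    ext x
    simp only [Set.mem_preimage, Set.mem_ofPred_eq, tower_iterate_apply X π hπ, E, funext_iff,
      Nat.cast_add]
  rw [cylinderEntropy, blockEntropy, wordEntropy]
  rw [Finset.sum_congr rfl fun I _ => by rw [h1 I]]
  rw [sum_fiber_eq_sum_fiber (E₁ := E)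
    (E₂ := itinerary (shiftMap (X 0)) (towerCoding X π M N s i) n) (t := words _ n)
    (F := fun S => Real.negMulLog (μ.real S)) (fun _ => Finset.mem_univ _)
    (fun x => by simp) ?_ (by simp)]
  · refine Finset.sum_congr rfl fun w hw => ?_
    rw [itineraryDist, mem_words.1 hw]
  · intro x y
    rw [itinerary_towerCoding_eq_iff X π hπ M N s i hn, funext_iff]
    exact ⟨fun h j hj => h ⟨j, hj⟩, fun h j => h j j.2⟩

theorem entropy_tower [IsProbabilityMeasure μ] (hμ : MeasurePreserving (shiftMap (X 0)) μ μ)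
    (i : Fin (m + 1)) (hlc : IsLocallyConstant (towerCoding X π M N s i)) :
    entropy (X i) (μ.map (tower X π i)) =
      entropyRate μ (shiftMap (X 0)) (towerCoding X π M N s i) := by
  have ht := (entropyRate_eq_lim (continuous_shiftMap (X 0)) hlc hμ).1
  set ℓ := (m - i) * N + s with hℓ
  refine Tendsto.limUnder_eq ?_
  -- The block lengths in the two entropies differ by the constant `ℓ`, which does not affect the
  -- rate.
  rw [← tendsto_add_atTop_iff_nat ℓ]
  have hratio : Tendsto (fun n : ℕ => (n : ℝ) / ((n : ℝ) + ℓ)) atTop (nhds 1) :=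
    tendsto_natCast_div_add_atTop (ℓ : ℝ)
  have := ht.mul hratio
  rw [mul_one] at this
  refine this.congr' ?_
  filter_upwards [eventually_gt_atTop 0] with n hn
  rw [hℓ, cylinderEntropy_tower (M := M) hπ hμ i hn, ← hℓ]
  have : (n : ℝ) ≠ 0 := by positivity
  push_cast
  field_simp

end Entropy

end TowerSystem

/-! ### Transfer of the results to towers of subshifts -/

section Tower

variable {m : ℕ} {A : Fin (m + 1) → Type*} {G : Type*} [∀ i, Fintype (A i)]
  [∀ i, TopologicalSpace (A i)] [∀ i, DiscreteTopology (A i)] [∀ i, MeasurableSpace (A i)]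
  [∀ i, BorelSpace (A i)] [AddMonoidWithOne G] [Countable G] {X : ∀ i, Subshift (A i) G}
  {π : ∀ i : Fin m, (X i.castSucc).carrier → (X i.succ).carrier}

theorem exists_common_window (hG : ∀ g : G, ∃ M j : ℕ, (M : G) + g = j)
    (hπ : ∀ i, IsFactorMap (X i.castSucc) (X i.succ) (π i)) :
    ∃ M N : ℕ, ∀ (i : Fin m) (x y : (X i.castSucc).carrier),
      (∀ j : ℕ, j ≤ N → x.1 (j : G) = y.1 (j : G)) →
        (π i ((shiftMap (X i.castSucc))^[M] x)).1 0 =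
          (π i ((shiftMap (X i.castSucc))^[M] y)).1 0 := by
  have hlc : ∀ i, IsLocallyConstant fun y : (X i.castSucc).carrier => (π i y).1 0 := fun i =>
    (IsLocallyConstant.iff_continuous _).2
      ((continuous_apply _).comp (continuous_subtype_val.comp (hπ i).continuous))
  choose M N h using fun i => exists_window_of_isLocallyConstant _ hG (hlc i)
  refine ⟨∑ i, M i, ∑ i, N i + ∑ i, M i, fun i x y hxy => ?_⟩
  exact window_mono _ (u := fun y => (π i y).1 0) (h i)
    (Finset.single_le_sum (fun _ _ => Nat.zero_le _) (Finset.mem_univ i))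
    (Nat.add_le_add_right
      (Finset.single_le_sum (fun _ _ => Nat.zero_le _) (Finset.mem_univ i)) _) hxy

/-- Existence, uniqueness, ergodicity and mixing of the weighted equilibrium state, for connecting
words of length in `[p₀, p]`. -/
theorem exists_unique_weightedEquilibriumState (hG : ∀ g : G, ∃ M j : ℕ, (M : G) + g = j)
    (hπ : ∀ i, IsFactorMap (X i.castSucc) (X i.succ) (π i)) (hne : (X 0).carrier.Nonempty)
    {a : Fin (m + 1) → ℝ} (ha_pos : 0 < a 0) (ha_nonneg : ∀ i, 0 ≤ a i) {p₀ p : ℕ}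
    (hX : ∀ I J : List (A 0), IsLegal (X 0) I → IsLegal (X 0) J →
      ∃ K : List (A 0), p₀ ≤ K.length ∧ K.length ≤ p ∧ IsLegal (X 0) (I ++ K ++ J))
    {f : C((X 0).carrier, ℝ)} {s : ℕ} (hf : HasBoundedErgodicSumVariation (X 0) (s : G) f) :
    ∃ μ : Measure (X 0).carrier, IsWeightedEquilibriumState X π a f μ ∧
      (∀ ν : Measure (X 0).carrier, IsWeightedEquilibriumState X π a f ν → ν = μ) ∧
      Ergodic (shiftMap (X 0)) μ ∧
      ∃ c : ℝ≥0, 0 < c ∧ ∀ S T : Set (X 0).carrier, MeasurableSet S → MeasurableSet T →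
        (c : ℝ≥0∞) * μ S * μ T ≤
          liminf (fun n : ℕ => ∑ i ∈ Finset.range (2 * (p - p₀) + 1),
            μ (S ∩ (shiftMap (X 0))^[n + i] ⁻¹' T)) atTop := by
  classical
  obtain ⟨C, hC, hvar⟩ := hf
  obtain ⟨M, N, hwin⟩ := exists_common_window hG hπ
  have hcompact := compactSpace_subshift (X 0)
  have hnonempty : Nonempty (X 0).carrier := hne.to_subtype
  set ζ := towerCoding X π M N s with hζ
  let a' : ℕ → ℝ := fun n => if h : n < m + 1 then a ⟨n, h⟩ else 0
  -- Each coding factors through the previous one; the code between them is extended by `none` to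
  -- letters that do not occur.
  have hfactor : ∀ n, ζ (n + 1) = Function.extend (ζ n) (ζ (n + 1)) (fun _ => none) ∘ ζ n := by
    intro n
    funext x
    have : Function.FactorsThrough (ζ (n + 1)) (ζ n) :=
      fun x y h => towerCoding_succ_eq hπ hwin n h
    exact (this.extend_apply _ _).symm
  have hsys : IsCodedSystem (shiftMap (X 0)) ζ
      (fun n => Function.extend (ζ n) (ζ (n + 1)) fun _ => none) f a' (p₀ + (m * N + s))
      (p + (m * N + s)) C :=
    { continuous := continuous_shiftMap _
      isLocallyConstant_zero := isLocallyConstant_towerCoding_zero hπ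
      factor := hfactor
      coeff_pos := by
        simp only [a', Nat.succ_pos, dif_pos]
        exact ha_pos
      coeff_nonneg := fun n => by
        simp only [a']
        split_ifs
        · exact ha_nonneg _
        · exact le_rfl
      variation := hasBoundedVariation_towerCoding hπ hC hvar
      specification := hasSpecification_towerCoding hπ hX
      generateFrom := generateFrom_isClopen_subshift (X 0)
      determined := fun S hS => determined_towerCoding hπ hG hS }
  have henergy : ∀ μ : Measure (X 0).carrier, IsProbabilityMeasure μ →
      MeasurePreserving (shiftMap (X 0)) μ μ →
      codedFreeEnergy (shiftMap (X 0)) ζ f a' m μ = weightedFreeEnergy X π a f μ := by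
    intro μ hμP hμ
    rw [codedFreeEnergy, weightedFreeEnergy, Finset.sum_range]
    congr 1
    refine Finset.sum_congr rfl fun i _ => ?_
    rw [entropy_tower (M := M) (N := N) (s := s) hπ hμ i (hsys.isLocallyConstant i)]
    simp only [a', i.2, dif_pos]
    rfl
  obtain ⟨μ, hμP, hμ, hmax, huniq, herg, c, hc, hmix⟩ := hsys.exists_unique_equilibrium m
  refine ⟨μ, ⟨⟨hμP, hμ⟩, fun η hη => ?_⟩, fun ν hν => ?_, herg, c, hc, ?_⟩
  · rw [← henergy η hη.1 hη.2, ← henergy μ hμP hμ]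
    exact hmax η hη.1 hη.2
  · refine huniq ν hν.1.1 hν.1.2 ?_
    rw [henergy ν hν.1.1 hν.1.2, henergy μ hμP hμ]
    exact hν.2 μ ⟨hμP, hμ⟩
  · simpa only [Nat.add_sub_add_right] using hmix

theorem exists_unique_weightedEquilibriumState_of_weakSpecification
    (hG : ∀ g : G, ∃ M j : ℕ, (M : G) + g = j)
    (hπ : ∀ i, IsFactorMap (X i.castSucc) (X i.succ) (π i)) (hne : (X 0).carrier.Nonempty)
    {a : Fin (m + 1) → ℝ} (ha_pos : 0 < a 0) (ha_nonneg : ∀ i, 0 ≤ a i)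
    (hX : WeakSpecification (X 0))
    {f : C((X 0).carrier, ℝ)} {s : ℕ} (hf : HasBoundedErgodicSumVariation (X 0) (s : G) f) :
    ∃ μ : Measure (X 0).carrier, IsWeightedEquilibriumState X π a f μ ∧
      (∀ ν : Measure (X 0).carrier, IsWeightedEquilibriumState X π a f ν → ν = μ) ∧
      Ergodic (shiftMap (X 0)) μ ∧
      (∃ p : ℕ, ∃ c : ℝ≥0, 0 < c ∧ ∀ S T : Set (X 0).carrier,
        MeasurableSet S → MeasurableSet T →
          (c : ℝ≥0∞) * μ S * μ T ≤
            liminf (fun n : ℕ => ∑ i ∈ Finset.range (p + 1),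
              μ (S ∩ (shiftMap (X 0))^[n + i] ⁻¹' T)) atTop) ∧
      (Specification (X 0) →
        ∃ c : ℝ≥0, 0 < c ∧ ∀ S T : Set (X 0).carrier, MeasurableSet S → MeasurableSet T →
          (c : ℝ≥0∞) * μ S * μ T ≤
            liminf (fun n : ℕ => μ (S ∩ (shiftMap (X 0))^[n] ⁻¹' T)) atTop) := by
  obtain ⟨p, hp⟩ := hX
  obtain ⟨μ, hμ, huniq, herg, hmix⟩ := exists_unique_weightedEquilibriumState (p₀ := 0) (p := p)
    hG hπ hne ha_pos ha_nonneg (fun I J hI hJ => by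
      obtain ⟨K, hK, h⟩ := hp I J hI hJ
      exact ⟨K, Nat.zero_le _, hK, h⟩) hf
  refine ⟨μ, hμ, huniq, herg, ⟨_, hmix⟩, ?_⟩
  rintro ⟨q, hq⟩
  obtain ⟨ν, hν, -, -, c, hc, h⟩ := exists_unique_weightedEquilibriumState (p₀ := q) (p := q)
    hG hπ hne ha_pos ha_nonneg (fun I J hI hJ => by
      obtain ⟨K, hK, h⟩ := hq I J hI hJ
      exact ⟨K, hK.ge, hK.le, h⟩) hf
  -- The construction with connecting words of exact length `q` may produce another measure a
  -- priori; uniqueness identifies it with `μ`, and for `p₀ = p = q` the sum of correlations has one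
  -- term.
  obtain rfl := huniq ν hν
  exact ⟨c, hc, by simpa using h⟩

end Tower

end WeightedEquilibrium

theorem theorem1 {m : ℕ} (A : Fin (m + 1) → Type*) [∀ i, Fintype (A i)]
    [∀ i, TopologicalSpace (A i)] [∀ i, DiscreteTopology (A i)]
    [∀ i, MeasurableSpace (A i)] [∀ i, BorelSpace (A i)]
    (a : Fin (m + 1) → ℝ) (ha_pos : 0 < a 0) (ha_nonneg : ∀ i, 0 ≤ a i) :
    -- one-sided subshifts
    (∀ (X : ∀ i, Subshift (A i) ℕ)
        (π : ∀ i : Fin m, (X i.castSucc).carrier → (X i.succ).carrier),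
        (X 0).carrier.Nonempty →
        (∀ i, IsFactorMap (X i.castSucc) (X i.succ) (π i)) →
        WeakSpecification (X 0) →
        ∀ f : C((X 0).carrier, ℝ), HasBoundedErgodicSumVariation (X 0) 0 f →
          ∃ μ : Measure (X 0).carrier,
            IsWeightedEquilibriumState X π a f μ ∧
            (∀ ν : Measure (X 0).carrier, IsWeightedEquilibriumState X π a f ν → ν = μ) ∧
            Ergodic (shiftMap (X 0)) μ ∧
            (∃ p : ℕ, ∃ c : ℝ≥0, 0 < c ∧ ∀ S T : Set (X 0).carrier,
              MeasurableSet S → MeasurableSet T →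
                (c : ℝ≥0∞) * μ S * μ T ≤
                  liminf (fun n : ℕ => ∑ i ∈ Finset.range (p + 1),
                    μ (S ∩ (shiftMap (X 0))^[n + i] ⁻¹' T)) atTop) ∧
            (Specification (X 0) →
              ∃ c : ℝ≥0, 0 < c ∧ ∀ S T : Set (X 0).carrier,
                MeasurableSet S → MeasurableSet T →
                  (c : ℝ≥0∞) * μ S * μ T ≤
                    liminf (fun n : ℕ => μ (S ∩ (shiftMap (X 0))^[n] ⁻¹' T)) atTop)) ∧
    -- two-sided subshifts
    (∀ (X : ∀ i, Subshift (A i) ℤ)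
        (π : ∀ i : Fin m, (X i.castSucc).carrier → (X i.succ).carrier),
        (X 0).carrier.Nonempty →
        (∀ i, IsFactorMap (X i.castSucc) (X i.succ) (π i)) →
        WeakSpecification (X 0) →
        ∀ f : C((X 0).carrier, ℝ), HasBoundedErgodicSumVariation (X 0) 1 f →
          ∃ μ : Measure (X 0).carrier,
            IsWeightedEquilibriumState X π a f μ ∧
            (∀ ν : Measure (X 0).carrier, IsWeightedEquilibriumState X π a f ν → ν = μ) ∧
            Ergodic (shiftMap (X 0)) μ ∧
            (∃ p : ℕ, ∃ c : ℝ≥0, 0 < c ∧ ∀ S T : Set (X 0).carrier,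
              MeasurableSet S → MeasurableSet T →
                (c : ℝ≥0∞) * μ S * μ T ≤
                  liminf (fun n : ℕ => ∑ i ∈ Finset.range (p + 1),
                    μ (S ∩ (shiftMap (X 0))^[n + i] ⁻¹' T)) atTop) ∧
            (Specification (X 0) →
              ∃ c : ℝ≥0, 0 < c ∧ ∀ S T : Set (X 0).carrier,
                MeasurableSet S → MeasurableSet T →
                  (c : ℝ≥0∞) * μ S * μ T ≤
                    liminf (fun n : ℕ => μ (S ∩ (shiftMap (X 0))^[n] ⁻¹' T)) atTop)) := by
  refine ⟨fun X π hne hπ hX f hf => ?_, fun X π hne hπ hX f hf => ?_⟩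
  · refine exists_unique_weightedEquilibriumState_of_weakSpecification
      (fun g => ⟨0, g, by simp⟩) hπ hne ha_pos ha_nonneg hX (s := 0) ?_
    simpa using hf
  · refine exists_unique_weightedEquilibriumState_of_weakSpecification
      -- Translation by `|g|` makes the coordinate `g` nonnegative. The value `s = 1` lengthens the
      -- windows by one letter so that they cover the coordinates `1, …, n` used in the two-sided
      -- variation condition.
      (fun g => ⟨g.natAbs, (g.natAbs + g).toNat, by omega⟩) hπ hne ha_pos ha_nonneg hX (s := 1) ?_
    simpa using hf
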